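/- Let $D=\{|\xi|<1\}$. A family $f(\xi,t)$ is a \emph{strong solution on $[0,b)$ of the suction equation} if for every $T\in[0,b)$ there is $r>1$ such that, for $t\in[0,T]$, $f(\cdot,t)$ is analytic and univalent in $\{|\xi|<r\}$ and $f$ is continuously differentiable in $t$ as a function with values in the analytic functions on $\{|\xi|<r\}$; and if, for $0\le t<b$, $f(0,t)=0$, $f'(0,t)>0$ and $$\operatorname{Re}\bigl[f_t(\xi,t)\,\overline{f'(\xi,t)\,\xi}\bigr]=-1,\qquad |\xi|=1,$$ where $f_t=\partial f/\partial t$ and $f'=\partial f/\partial\xi$. It is \emph{the strong solution with initial function $f_0$, with blow-up time $b$}, if $f(\cdot,0)=f_0$ on $D$ and every strong solution $g$ on some $[0,b')$ with $g(\cdot,0)=f_0$ on $D$ satisfies $b'\le b$ and $g=f$ on $\overline D\times[0,b')$. For $v=\sum_{j\ge1}v_j\xi^j$ and $\rho>1$ put $\|v\|_{\rho,1}=\sum_{j\ge1}|v_j|\rho^j j^{3/2}$. Then: (1) The strong solution with initial function $\xi$ is $f_1(\xi,t)=\sqrt{1-2t}\,\xi$, with blow-up time $1/2$. The area of $f_1(D,t)$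 is $\pi(1-2t)$ for $0\le t\le 1/2$; in particular the fluid is completely sucked out at $t=1/2$. (2) For every $T_0<1/2$ there are $\rho>1$ and $\delta>0$ such that, for every $f_0$ analytic in $D$ with $f_0(0)=0$, $f_0'(0)>0$ and $\|f_0-\xi\|_{\rho,1}<\delta$, the strong solution with initial function $f_0$ exists and its blow-up time is greater than $T_0$ (so it exists for $0\le t\le T_0$). (3) If the initial domain is close to the unit disk, then most of the fluid is sucked out before blow-up: for every $\varepsilon>0$ there are $\rho>1$ and $\delta>0$ such that, for every $f_0$ analytic in $D$ with $f_0(0)=0$, $f_0'(0)>0$ and $\|f_0-\xi\|_{\rho,1}<\delta$, the strong solution $f$ with initial function $f_0$ exists, with some blow-up time $b$, and at some time $T\in(0,b)$ the area of $f(D,T)$ is at most $\varepsilon$ times the area of $f(D,0)$. -/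

import Mathlib

open Set Metric MeasureTheory Filter Topology

/-- The time derivative `f_t(ξ,t)` of a family `f t ξ`, on the time interval `[0,b)`
(one-sided at `t = 0`). -/
noncomputable def timeDeriv (b : ℝ) (f : ℝ → ℂ → ℂ) (t : ℝ) (ξ : ℂ) : ℂ :=
  derivWithin (fun s => f s ξ) (Ico 0 b) t

/-- `f t ξ = f(ξ,t)` is a strong solution on `[0,b)` of the Polubarinova-Galin equation with
suction, `Re [f_t * conj (f' ξ)] = -1` on the unit circle.  On every compact time interval
`[0,T]` with `T < b` the maps `f(·,t)` are analytic and univalent on a common neighbourhood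
`|ξ| < r`, `r > 1`, of the closed unit disk, and `t ↦ f(·,t)` is `C¹` with values in the analytic
functions on `|ξ| < r` (that is, `f` and `f_t` exist and are jointly continuous). -/
structure IsStrongSuctionSolution (b : ℝ) (f : ℝ → ℂ → ℂ) : Prop where
  regular : ∀ T : ℝ, 0 ≤ T → T < b → ∃ r : ℝ, 1 < r ∧
    (∀ t ∈ Icc 0 T, DifferentiableOn ℂ (f t) (ball 0 r) ∧ InjOn (f t) (ball 0 r)) ∧
    (∀ t ∈ Icc 0 T, ∀ ξ ∈ ball (0 : ℂ) r,
      DifferentiableWithinAt ℝ (fun s => f s ξ) (Ico 0 b) t) ∧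
    ContinuousOn (fun p : ℝ × ℂ => f p.1 p.2) (Icc 0 T ×ˢ ball 0 r) ∧
    ContinuousOn (fun p : ℝ × ℂ => timeDeriv b f p.1 p.2) (Icc 0 T ×ˢ ball 0 r)
  map_zero : ∀ t ∈ Ico 0 b, f t 0 = 0
  deriv_zero_pos : ∀ t ∈ Ico 0 b, 0 < (deriv (f t) 0).re ∧ (deriv (f t) 0).im = 0
  equation : ∀ t ∈ Ico 0 b, ∀ ξ : ℂ, ‖ξ‖ = 1 →
    (timeDeriv b f t ξ * (starRingEnd ℂ) (deriv (f t) ξ * ξ)).re = -1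

/-- `f` on `[0,b)` is the strong solution of the suction equation with initial function `f₀`,
and it blows up at time `b`: it starts from `f₀`, and every strong solution `g` on some `[0,b')`
starting from `f₀` has `b' ≤ b` and coincides with `f` on `[0,b')`. -/
structure IsMaximalStrongSuctionSolution (f₀ : ℂ → ℂ) (b : ℝ) (f : ℝ → ℂ → ℂ) : Prop where
  strong : IsStrongSuctionSolution b f
  initial : EqOn (f 0) f₀ (ball 0 1)
  maximal : ∀ (b' : ℝ) (g : ℝ → ℂ → ℂ), IsStrongSuctionSolution b' g →
    EqOn (g 0) f₀ (ball 0 1) →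
      b' ≤ b ∧ ∀ t ∈ Ico 0 b', EqOn (g t) (f t) (closedBall 0 1)

/-- The `j`-th Taylor coefficient of `v` at the origin. -/
noncomputable def taylorCoeffZero (v : ℂ → ℂ) (j : ℕ) : ℂ :=
  iteratedDeriv j v 0 / (j.factorial : ℂ)

/-- The norm `‖v‖_{ρ,n} = ∑_{j ≥ 1} |v_j| ρ^j j^(1/2 + n)` of `v = ∑_{j ≥ 1} v_j ξ^j`, with value
`∞` when the series diverges. -/
noncomputable def perturbationNorm (ρ : ℝ) (n : ℕ) (v : ℂ → ℂ) : ENNReal :=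
  ∑' j : ℕ, ENNReal.ofReal
    (‖taylorCoeffZero v (j + 1)‖ * ρ ^ (j + 1) * ((j + 1 : ℕ) : ℝ) ^ ((1 / 2 : ℝ) + (n : ℝ)))

/-- The initial functions admitted: `f₀` is analytic in the unit disk, `f₀(0) = 0`,
`f₀'(0) > 0` and `‖f₀ - ξ‖_{ρ,1} < δ`. -/
structure IsCloseToDisk (ρ δ : ℝ) (f₀ : ℂ → ℂ) : Prop where
  analytic : DifferentiableOn ℂ f₀ (ball 0 1)
  map_zero : f₀ 0 = 0
  deriv_zero_pos : 0 < (deriv f₀ 0).re ∧ (deriv f₀ 0).im = 0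
  close : perturbationNorm ρ 1 (fun ξ => f₀ ξ - ξ) < ENNReal.ofReal δ

/-- The shrinking disk `f₁(ξ,t) = √(1 - 2t) ξ`. -/
noncomputable def diskSolution (t : ℝ) (ξ : ℂ) : ℂ := ((Real.sqrt (1 - 2 * t) : ℝ) : ℂ) * ξ

/-!
Write `h = 1 / f'` with Taylor coefficients `aₙ`, and `p = -f_t / (ξ f')`.  On the unit circle the
suction equation says `Re p = |h|²`, so the Schwarz formula expresses the Taylor coefficients of
`p` through the autocorrelation of `a`.  Differentiating `f_t = -ξ p / h` gives
`h_t = h (ξ p)' - ξ p h'`, an autonomous cubic differential equation for the sequence `a`.  Its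
right-hand side loses one derivative, a factor `n + 1` in the `n`-th coefficient; this is absorbed
by weights whose radius of convergence shrinks exponentially in time.  The same coefficient
equation gives uniqueness, the existence of solutions close to the explicit one for the disk, and,
through `n = 0`, where `a₀' ≥ a₀³`, the bound `b ≤ f'(0,0)² / 2` on the blow-up time.
-/

open Finset.HasAntidiagonal (antidiagonal mem_antidiagonal)

/-! ### Taylor coefficients at the origin -/

theorem hasSum_taylorCoeffZero {f : ℂ → ℂ} {r : ℝ} (hf : DifferentiableOn ℂ f (ball 0 r)) {z : ℂ}
    (hz : z ∈ ball (0 : ℂ) r) : HasSum (fun n => taylorCoeffZero f n * z ^ n) (f z) := by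
  have h := Complex.hasSum_taylorSeries_on_ball hf hz
  have hterm : (fun n : ℕ => taylorCoeffZero f n * z ^ n) =
      fun n : ℕ => (n.factorial : ℂ)⁻¹ • (z - 0) ^ n • iteratedDeriv n f 0 := by
    ext n
    simp only [taylorCoeffZero, sub_zero, smul_eq_mul]
    ring
  rwa [hterm]

theorem norm_taylorCoeffZero_le {f : ℂ → ℂ} {r R M : ℝ} (hf : DifferentiableOn ℂ f (ball 0 r))
    (hR : 0 < R) (hRr : R < r) (hM : ∀ z ∈ closedBall (0 : ℂ) R, ‖f z‖ ≤ M) (n : ℕ) :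
    ‖taylorCoeffZero f n‖ ≤ M / R ^ n := by
  have hd : DiffContOnCl ℂ f (ball 0 R) :=
    (hf.mono (by rw [closure_ball _ hR.ne']; exact closedBall_subset_ball hRr)).diffContOnCl
  have h := Complex.norm_iteratedDeriv_le_of_forall_mem_sphere_norm_le n hR hd
    (fun z hz => hM z (sphere_subset_closedBall hz))
  have hn : (0 : ℝ) < n.factorial := by positivity
  rw [taylorCoeffZero, norm_div, Complex.norm_natCast, div_le_iff₀ hn]
  exact h.trans_eq (by ring)

theorem taylorCoeffZero_eq_of_hasSum {f : ℂ → ℂ} {a : ℕ → ℂ} {r : ℝ} (hr : 0 < r)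
    (h : ∀ z ∈ ball (0 : ℂ) r, HasSum (fun n => a n * z ^ n) (f z)) : taylorCoeffZero f = a := by
  have hp : HasFPowerSeriesOnBall f (FormalMultilinearSeries.ofScalars ℂ a) 0
      (ENNReal.ofReal (r / 2)) := by
    refine ⟨?_, by simpa using hr, ?_⟩
    · have hr2 : ((r / 2 : ℝ) : ℂ) ∈ ball 0 r := by
        rw [mem_ball_zero_iff, Complex.norm_real, Real.norm_of_nonneg (by positivity)]
        linarith
      have hsummable := (h _ hr2).summable.norm
      rw [ENNReal.ofReal]
      refine FormalMultilinearSeries.le_radius_of_bound _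
        (∑' n, ‖a n * ((r / 2 : ℝ) : ℂ) ^ n‖) fun n => ?_
      refine le_trans (le_of_eq ?_) (hsummable.le_tsum n fun _ _ => norm_nonneg _)
      rw [FormalMultilinearSeries.ofScalars_norm, norm_mul, norm_pow, Complex.norm_real,
        Real.norm_of_nonneg (by positivity), Real.coe_toNNReal _ (by positivity)]
    · intro y hy
      rw [eball_ofReal] at hy
      have := h y (ball_subset_ball (by linarith) hy)
      simpa [FormalMultilinearSeries.ofScalars_apply_eq, mul_comm] using this
  have ha : AnalyticAt ℂ f 0 := ⟨_, hp.hasFPowerSeriesAt⟩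
  have := ha.hasFPowerSeriesAt.eq_formalMultilinearSeries hp.hasFPowerSeriesAt
  exact FormalMultilinearSeries.ofScalars_series_injective ℂ ℂ this

theorem taylorCoeffZero_congr {f g : ℂ → ℂ} {r : ℝ} (hr : 0 < r)
    (hf : DifferentiableOn ℂ f (ball 0 r)) (h : EqOn f g (ball 0 r)) :
    taylorCoeffZero f = taylorCoeffZero g :=
  (taylorCoeffZero_eq_of_hasSum hr fun _ hz => h hz ▸ hasSum_taylorCoeffZero hf hz).symm

@[simp] theorem taylorCoeffZero_zero (f : ℂ → ℂ) : taylorCoeffZero f 0 = f 0 := by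
  simp [taylorCoeffZero]

@[simp] theorem taylorCoeffZero_one (f : ℂ → ℂ) : taylorCoeffZero f 1 = deriv f 0 := by
  simp [taylorCoeffZero]

theorem taylorCoeffZero_sub {f g : ℂ → ℂ} {r : ℝ} (hr : 0 < r)
    (hf : DifferentiableOn ℂ f (ball 0 r)) (hg : DifferentiableOn ℂ g (ball 0 r)) (n : ℕ) :
    taylorCoeffZero (fun z => f z - g z) n = taylorCoeffZero f n - taylorCoeffZero g n := by
  refine congrFun (taylorCoeffZero_eq_of_hasSum hr (a := fun n => _ - _) fun z hz => ?_) n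
  simpa only [sub_mul] using (hasSum_taylorCoeffZero hf hz).sub (hasSum_taylorCoeffZero hg hz)

theorem taylorCoeffZero_deriv (f : ℂ → ℂ) (n : ℕ) :
    taylorCoeffZero (deriv f) n = (n + 1) * taylorCoeffZero f (n + 1) := by
  have hfactorial : (n.factorial : ℂ) ≠ 0 := by exact_mod_cast n.factorial_ne_zero
  have hsucc : (n : ℂ) + 1 ≠ 0 := by exact_mod_cast n.succ_ne_zero
  rw [taylorCoeffZero, taylorCoeffZero, iteratedDeriv_succ', Nat.factorial_succ]
  push_cast
  field_simp

theorem taylorCoeffZero_id_mul {f : ℂ → ℂ} {r : ℝ} (hr : 0 < r)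
    (hf : DifferentiableOn ℂ f (ball 0 r)) (n : ℕ) :
    taylorCoeffZero (fun z => z * f z) (n + 1) = taylorCoeffZero f n := by
  refine congrFun (taylorCoeffZero_eq_of_hasSum hr
    (a := fun n => Nat.casesOn n 0 (taylorCoeffZero f)) fun z hz => ?_) (n + 1)
  rw [← hasSum_nat_add_iff' 1]
  simpa [pow_succ', mul_left_comm] using (hasSum_taylorCoeffZero hf hz).mul_left z

theorem taylorCoeffZero_id_mul_deriv {f : ℂ → ℂ} {r : ℝ} (hr : 0 < r)
    (hf : DifferentiableOn ℂ f (ball 0 r)) (n : ℕ) :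
    taylorCoeffZero (fun z => z * deriv f z) n = n * taylorCoeffZero f n := by
  cases n with
  | zero => simp
  | succ n =>
    rw [taylorCoeffZero_id_mul hr (hf.deriv isOpen_ball), taylorCoeffZero_deriv]
    push_cast; ring

theorem taylorCoeffZero_mul {f g : ℂ → ℂ} {r : ℝ} (hr : 0 < r)
    (hf : DifferentiableOn ℂ f (ball 0 r)) (hg : DifferentiableOn ℂ g (ball 0 r)) (n : ℕ) :
    taylorCoeffZero (fun z => f z * g z) n =
      ∑ p ∈ antidiagonal n, taylorCoeffZero f p.1 * taylorCoeffZero g p.2 := by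
  refine congrFun (taylorCoeffZero_eq_of_hasSum hr
    (a := fun n => ∑ p ∈ antidiagonal n, taylorCoeffZero f p.1 * taylorCoeffZero g p.2)
    fun z hz => ?_) n
  have hfsum := hasSum_taylorCoeffZero hf hz
  have hgsum := hasSum_taylorCoeffZero hg hz
  have hprod := tsum_mul_tsum_eq_tsum_sum_antidiagonal_of_summable_norm hfsum.summable.norm
    hgsum.summable.norm
  have hsummable := (summable_norm_sum_mul_antidiagonal_of_summable_norm hfsum.summable.norm
    hgsum.summable.norm).of_norm
  rw [hfsum.tsum_eq, hgsum.tsum_eq] at hprod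
  have hterm : (fun n => (∑ p ∈ antidiagonal n,
      taylorCoeffZero f p.1 * taylorCoeffZero g p.2) * z ^ n) =
      fun n => ∑ p ∈ antidiagonal n,
        taylorCoeffZero f p.1 * z ^ p.1 * (taylorCoeffZero g p.2 * z ^ p.2) := by
    ext n
    rw [Finset.sum_mul]
    refine Finset.sum_congr rfl fun p hp => ?_
    rw [← mem_antidiagonal.1 hp]
    ring
  rw [hprod, hterm]
  exact hsummable.hasSum

/-! ### Weighted sequences -/

/-- The weight of the sequence norms used here.  The factor `(n + 1)²` makes it stable, up to a
constant, under convolution, and makes the associated power series converge absolutely on the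
closed disk of radius `ρ`. -/
noncomputable def seqWeight (ρ : ℝ) (n : ℕ) : ℝ := (((n : ℝ) + 1) ^ 2 * ρ ^ n)⁻¹

/-- Membership of `a` in the closed ball of radius `κ` of the weighted supremum norm given by
`seqWeight ρ`. -/
def Dominated (ρ κ : ℝ) (a : ℕ → ℂ) : Prop := ∀ n, ‖a n‖ ≤ κ * seqWeight ρ n

theorem seqWeight_pos {ρ : ℝ} (hρ : 0 < ρ) (n : ℕ) : 0 < seqWeight ρ n := by
  unfold seqWeight; positivity

theorem seqWeight_zero (ρ : ℝ) : seqWeight ρ 0 = 1 := by simp [seqWeight]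

theorem seqWeight_add_le {ρ : ℝ} (hρ : 1 ≤ ρ) (l k : ℕ) : seqWeight ρ (l + k) ≤ seqWeight ρ k := by
  unfold seqWeight
  have : 0 < ρ := by linarith
  gcongr
  · linarith [Nat.cast_nonneg (α := ℝ) l]
  · exact Nat.le_add_left k l

theorem seqWeight_le {ρ : ℝ} (hρ : 1 ≤ ρ) (l : ℕ) : seqWeight ρ l ≤ (((l : ℝ) + 1) ^ 2)⁻¹ := by
  unfold seqWeight
  gcongr
  exact le_mul_of_one_le_right (by positivity) (one_le_pow₀ hρ)

theorem seqWeight_antitone {ρ ρ' : ℝ} (hρ : 0 < ρ) (h : ρ ≤ ρ') (n : ℕ) :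
    seqWeight ρ' n ≤ seqWeight ρ n := by
  unfold seqWeight
  gcongr

theorem sum_range_inv_succ_sq_le (N : ℕ) :
    ∑ i ∈ Finset.range (N + 1), (((i : ℝ) + 1) ^ 2)⁻¹ ≤ 2 - 1 / ((N : ℝ) + 1) := by
  induction N with
  | zero => norm_num
  | succ N ih =>
    rw [Finset.sum_range_succ]
    have h : (((N : ℝ) + 1 + 1) ^ 2)⁻¹ ≤ 1 / ((N : ℝ) + 1) - 1 / ((N : ℝ) + 1 + 1) := by
      rw [div_sub_div _ _ (by positivity) (by positivity), ← one_div,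
        div_le_div_iff₀ (by positivity) (by positivity)]
      nlinarith [Nat.cast_nonneg (α := ℝ) N]
    push_cast
    linarith

theorem sum_range_inv_succ_sq_le_two (N : ℕ) :
    ∑ i ∈ Finset.range N, (((i : ℝ) + 1) ^ 2)⁻¹ ≤ 2 := by
  refine (Finset.sum_le_sum_of_subset_of_nonneg
    (Finset.range_mono N.le_succ) fun _ _ _ => by positivity).trans
    ((sum_range_inv_succ_sq_le N).trans ?_)
  have : (0 : ℝ) ≤ 1 / ((N : ℝ) + 1) := by positivity
  linarith

theorem summable_inv_succ_sq : Summable fun i : ℕ => (((i : ℝ) + 1) ^ 2)⁻¹ :=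
  summable_of_sum_range_le (fun _ => by positivity) sum_range_inv_succ_sq_le_two

theorem tsum_inv_succ_sq_le_two : ∑' i : ℕ, (((i : ℝ) + 1) ^ 2)⁻¹ ≤ 2 :=
  Real.tsum_le_of_sum_range_le (fun _ => by positivity) sum_range_inv_succ_sq_le_two

theorem seqWeight_mul_seqWeight_le {ρ : ℝ} (hρ : 0 < ρ) (k l : ℕ) :
    seqWeight ρ k * seqWeight ρ l ≤
      2 * seqWeight ρ (k + l) * ((((k : ℝ) + 1) ^ 2)⁻¹ + (((l : ℝ) + 1) ^ 2)⁻¹) := by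
  have hkl : (((k + l : ℕ) : ℝ) + 1) ^ 2 ≤ 2 * (((k : ℝ) + 1) ^ 2 + ((l : ℝ) + 1) ^ 2) := by
    push_cast
    nlinarith [sq_nonneg ((k : ℝ) - l), Nat.cast_nonneg (α := ℝ) k, Nat.cast_nonneg (α := ℝ) l]
  have hsum : (((k : ℝ) + 1) ^ 2)⁻¹ + (((l : ℝ) + 1) ^ 2)⁻¹ =
      (((k : ℝ) + 1) ^ 2 + ((l : ℝ) + 1) ^ 2) / (((k : ℝ) + 1) ^ 2 * ((l : ℝ) + 1) ^ 2) := by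
    field_simp
    ring
  unfold seqWeight
  rw [hsum, ← mul_inv, ← div_eq_mul_inv, div_mul_div_comm, inv_eq_one_div,
    div_le_div_iff₀ (by positivity) (by positivity), pow_add]
  have hpos : 0 ≤ ρ ^ k * ρ ^ l * (((k : ℝ) + 1) ^ 2 * ((l : ℝ) + 1) ^ 2) := by positivity
  nlinarith [mul_le_mul_of_nonneg_left hkl hpos]

theorem sum_antidiagonal_seqWeight_le {ρ : ℝ} (hρ : 0 < ρ) (n : ℕ) :
    ∑ p ∈ antidiagonal n, seqWeight ρ p.1 * seqWeight ρ p.2 ≤ 8 * seqWeight ρ n := by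
  have hfst : ∑ p ∈ antidiagonal n, (((p.1 : ℝ) + 1) ^ 2)⁻¹ ≤ 2 := by
    rw [Finset.Nat.sum_antidiagonal_eq_sum_range_succ_mk]
    exact sum_range_inv_succ_sq_le_two _
  have hsnd : ∑ p ∈ antidiagonal n, (((p.2 : ℝ) + 1) ^ 2)⁻¹ ≤ 2 := by
    rw [← Finset.Nat.sum_antidiagonal_swap] at hfst
    exact hfst
  calc ∑ p ∈ antidiagonal n, seqWeight ρ p.1 * seqWeight ρ p.2
      ≤ ∑ p ∈ antidiagonal n,
          2 * seqWeight ρ n * ((((p.1 : ℝ) + 1) ^ 2)⁻¹ + (((p.2 : ℝ) + 1) ^ 2)⁻¹) :=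
        Finset.sum_le_sum fun p hp =>
          mem_antidiagonal.1 hp ▸ seqWeight_mul_seqWeight_le hρ p.1 p.2
    _ ≤ 2 * seqWeight ρ n * (2 + 2) := by
        rw [← Finset.mul_sum, Finset.sum_add_distrib]
        have := (seqWeight_pos hρ n).le
        gcongr
    _ = 8 * seqWeight ρ n := by ring

theorem Dominated.nonneg {ρ κ : ℝ} {a : ℕ → ℂ} (h : Dominated ρ κ a) : 0 ≤ κ := by
  have := h 0
  rw [seqWeight_zero, mul_one] at this
  exact (norm_nonneg _).trans this

theorem Dominated.mono {ρ κ κ' : ℝ} {a : ℕ → ℂ} (hρ : 0 < ρ) (h : Dominated ρ κ a) (hk : κ ≤ κ') :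
    Dominated ρ κ' a :=
  fun n => (h n).trans (mul_le_mul_of_nonneg_right hk (seqWeight_pos hρ n).le)

theorem Dominated.add {ρ κ κ' : ℝ} {a b : ℕ → ℂ} (ha : Dominated ρ κ a) (hb : Dominated ρ κ' b) :
    Dominated ρ (κ + κ') (a + b) :=
  fun n => (norm_add_le _ _).trans (by rw [add_mul]; exact add_le_add (ha n) (hb n))

theorem Dominated.sub {ρ κ κ' : ℝ} {a b : ℕ → ℂ} (ha : Dominated ρ κ a) (hb : Dominated ρ κ' b) :
    Dominated ρ (κ + κ') (a - b) := fun n => by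
  rw [Pi.sub_apply, add_mul]
  exact (norm_sub_le _ _).trans (add_le_add (ha n) (hb n))

theorem Dominated.sum_antidiagonal {ρ κ κ' : ℝ} {a b : ℕ → ℂ} (hρ : 0 < ρ) (ha : Dominated ρ κ a)
    (hb : Dominated ρ κ' b) (n : ℕ) :
    ∑ p ∈ antidiagonal n, ‖a p.1‖ * ‖b p.2‖ ≤ 8 * κ * κ' * seqWeight ρ n := by
  calc ∑ p ∈ antidiagonal n, ‖a p.1‖ * ‖b p.2‖
      ≤ ∑ p ∈ antidiagonal n, κ * κ' * (seqWeight ρ p.1 * seqWeight ρ p.2) :=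
        Finset.sum_le_sum fun p _ => by
          rw [mul_mul_mul_comm]
          exact mul_le_mul (ha _) (hb _) (norm_nonneg _)
            (mul_nonneg ha.nonneg (seqWeight_pos hρ _).le)
    _ ≤ κ * κ' * (8 * seqWeight ρ n) := by
        rw [← Finset.mul_sum]
        exact mul_le_mul_of_nonneg_left (sum_antidiagonal_seqWeight_le hρ n)
          (mul_nonneg ha.nonneg hb.nonneg)
    _ = 8 * κ * κ' * seqWeight ρ n := by ring

/-! ### Power series with dominated coefficients -/

/-- The sum of the power series with coefficients `a`. -/
noncomputable def powerSum (a : ℕ → ℂ) (z : ℂ) : ℂ := ∑' n, a n * z ^ n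

theorem powerSum_at_zero (a : ℕ → ℂ) : powerSum a 0 = a 0 := by
  rw [powerSum, tsum_eq_single 0 fun n hn => by rw [zero_pow hn, mul_zero], pow_zero, mul_one]

theorem Dominated.norm_term_le {ρ κ : ℝ} {a : ℕ → ℂ} (hρ : 0 < ρ) (h : Dominated ρ κ a) {z : ℂ}
    (hz : ‖z‖ ≤ ρ) (n : ℕ) : ‖a n * z ^ n‖ ≤ κ * (((n : ℝ) + 1) ^ 2)⁻¹ := by
  rw [norm_mul, norm_pow]
  calc ‖a n‖ * ‖z‖ ^ n ≤ κ * seqWeight ρ n * ρ ^ n :=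
        mul_le_mul (h n) (pow_le_pow_left₀ (norm_nonneg _) hz n) (by positivity)
          (mul_nonneg h.nonneg (seqWeight_pos hρ n).le)
    _ = κ * (((n : ℝ) + 1) ^ 2)⁻¹ := by rw [seqWeight]; field_simp

theorem Dominated.hasSum {ρ κ : ℝ} {a : ℕ → ℂ} (hρ : 0 < ρ) (h : Dominated ρ κ a) {z : ℂ}
    (hz : ‖z‖ ≤ ρ) : HasSum (fun n => a n * z ^ n) (powerSum a z) :=
  (Summable.of_norm_bounded (summable_inv_succ_sq.mul_left κ) (h.norm_term_le hρ hz)).hasSum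

theorem Dominated.norm_powerSum_le {ρ κ : ℝ} {a : ℕ → ℂ} (hρ : 0 < ρ) (h : Dominated ρ κ a) {z : ℂ}
    (hz : ‖z‖ ≤ ρ) : ‖powerSum a z‖ ≤ 2 * κ := by
  refine (tsum_of_norm_bounded (summable_inv_succ_sq.mul_left κ).hasSum
    (h.norm_term_le hρ hz)).trans ?_
  rw [tsum_mul_left]
  nlinarith [tsum_inv_succ_sq_le_two, h.nonneg]

theorem Dominated.differentiableOn_powerSum {ρ κ : ℝ} {a : ℕ → ℂ} (hρ : 0 < ρ)
    (h : Dominated ρ κ a) : DifferentiableOn ℂ (powerSum a) (ball 0 ρ) :=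
  Complex.differentiableOn_tsum_of_summable_norm (summable_inv_succ_sq.mul_left κ)
    (fun n => by fun_prop) isOpen_ball
    fun n z hz => h.norm_term_le hρ (mem_ball_zero_iff.1 hz).le n

theorem Dominated.taylorCoeffZero_powerSum {ρ κ : ℝ} {a : ℕ → ℂ} (hρ : 0 < ρ)
    (h : Dominated ρ κ a) : taylorCoeffZero (powerSum a) = a :=
  taylorCoeffZero_eq_of_hasSum hρ fun _ hz => h.hasSum hρ (mem_ball_zero_iff.1 hz).le

/-! ### Correlations -/

/-- The correlation sequence of `b` and `c`: on the unit circle the nonnegative Fourier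
coefficients of `B conj C`, where `B = ∑ b_n z^n` and `C = ∑ c_n z^n`. -/
noncomputable def correlation (b c : ℕ → ℂ) (k : ℕ) : ℂ := ∑' l, b (l + k) * (starRingEnd ℂ) (c l)

theorem Dominated.norm_correlation_term_le {ρ κ κ' : ℝ} {b c : ℕ → ℂ} (hρ : 1 ≤ ρ)
    (hb : Dominated ρ κ b) (hc : Dominated ρ κ' c) (k l : ℕ) :
    ‖b (l + k) * (starRingEnd ℂ) (c l)‖ ≤
      κ * κ' * seqWeight ρ k * (((l : ℝ) + 1) ^ 2)⁻¹ := by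
  rw [norm_mul, RCLike.norm_conj]
  calc ‖b (l + k)‖ * ‖c l‖ ≤ κ * seqWeight ρ k * (κ' * (((l : ℝ) + 1) ^ 2)⁻¹) := by
        refine mul_le_mul ((hb _).trans ?_) ((hc _).trans ?_) (norm_nonneg _)
          (mul_nonneg hb.nonneg (seqWeight_pos (by linarith) _).le)
        · exact mul_le_mul_of_nonneg_left (seqWeight_add_le hρ _ _) hb.nonneg
        · exact mul_le_mul_of_nonneg_left (seqWeight_le hρ _) hc.nonneg
    _ = κ * κ' * seqWeight ρ k * (((l : ℝ) + 1) ^ 2)⁻¹ := by ring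

theorem Dominated.summable_correlation {ρ κ κ' : ℝ} {b c : ℕ → ℂ} (hρ : 1 ≤ ρ)
    (hb : Dominated ρ κ b) (hc : Dominated ρ κ' c) (k : ℕ) :
    Summable fun l => b (l + k) * (starRingEnd ℂ) (c l) :=
  Summable.of_norm_bounded (summable_inv_succ_sq.mul_left _) (hb.norm_correlation_term_le hρ hc k)

theorem dominated_correlation {ρ κ κ' : ℝ} {b c : ℕ → ℂ} (hρ : 1 ≤ ρ) (hb : Dominated ρ κ b)
    (hc : Dominated ρ κ' c) : Dominated ρ (2 * κ * κ') (correlation b c) := fun k => by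
  refine (tsum_of_norm_bounded (summable_inv_succ_sq.mul_left _).hasSum
    (hb.norm_correlation_term_le hρ hc k)).trans ?_
  rw [tsum_mul_left]
  have h : 0 ≤ κ * κ' * seqWeight ρ k :=
    mul_nonneg (mul_nonneg hb.nonneg hc.nonneg) (seqWeight_pos (by linarith) _).le
  nlinarith [tsum_inv_succ_sq_le_two]

/-- The Taylor coefficients of the function, analytic in the unit disk and real at the origin, whose
real part on the unit circle is `Re (B conj C)`, where `B = ∑ b_n z^n` and `C = ∑ c_n z^n`. -/
noncomputable def schwarzCoeff (b c : ℕ → ℂ) (k : ℕ) : ℂ :=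
  (if k = 0 then 1 / 2 else 1) * (correlation b c k + correlation c b k)

theorem dominated_schwarzCoeff {ρ κ κ' : ℝ} {b c : ℕ → ℂ} (hρ : 1 ≤ ρ) (hb : Dominated ρ κ b)
    (hc : Dominated ρ κ' c) : Dominated ρ (4 * κ * κ') (schwarzCoeff b c) := fun k => by
  have hbc := dominated_correlation hρ hb hc k
  have hcb := dominated_correlation hρ hc hb k
  have hone : ‖((if k = 0 then 1 / 2 else 1 : ℂ))‖ ≤ 1 := by split_ifs <;> norm_num
  rw [schwarzCoeff, norm_mul]
  calc ‖(if k = 0 then 1 / 2 else 1 : ℂ)‖ * ‖correlation b c k + correlation c b k‖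
      ≤ ‖correlation b c k + correlation c b k‖ := mul_le_of_le_one_left (norm_nonneg _) hone
    _ ≤ ‖correlation b c k‖ + ‖correlation c b k‖ := norm_add_le _ _
    _ ≤ 4 * κ * κ' * seqWeight ρ k := by linarith

theorem conj_correlation_zero (b c : ℕ → ℂ) :
    (starRingEnd ℂ) (correlation b c 0) = correlation c b 0 := by
  simp only [correlation, Complex.conj_tsum, map_mul, Complex.conj_conj, add_zero, mul_comm]

theorem schwarzCoeff_zero_im (b c : ℕ → ℂ) : (schwarzCoeff b c 0).im = 0 := by
  rw [schwarzCoeff, ← conj_correlation_zero b c, Complex.add_conj, if_pos rfl]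
  simp

theorem tsum_nat_prod_eq_add {E : Type*} [NormedAddCommGroup E] [CompleteSpace E]
    {F : ℕ × ℕ → E} (hF : Summable F) :
    ∑' p, F p = ∑' k, ∑' l, F (l + k, l) + ∑' k, ∑' l, F (l, l + (k + 1)) := by
  let below : ℕ × ℕ → ℕ × ℕ := fun p => (p.2 + p.1, p.2)
  let above : ℕ × ℕ → ℕ × ℕ := fun p => (p.2, p.2 + (p.1 + 1))
  have below_inj : Function.Injective below := by
    rintro ⟨a, b⟩ ⟨c, d⟩ h
    obtain ⟨h1, h2⟩ := Prod.mk.inj h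
    exact Prod.ext (by simp only at *; omega) h2
  have above_inj : Function.Injective above := by
    rintro ⟨a, b⟩ ⟨c, d⟩ h
    obtain ⟨h1, h2⟩ := Prod.mk.inj h
    exact Prod.ext (by simp only at *; omega) h1
  have range_above : range above = (range below)ᶜ := by
    ext ⟨m, l⟩
    simp only [mem_range, mem_compl_iff, below, above, Prod.mk.injEq, Prod.exists]
    constructor
    · rintro ⟨x, y, rfl, h⟩ ⟨u, v, h1, h2⟩
      omega
    · intro h
      have hml : m < l := by
        by_contra hc
        exact h ⟨m - l, l, by omega, rfl⟩
      exact ⟨l - m - 1, m, rfl, by omega⟩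
  have below_summable : Summable fun p => F (below p) := hF.comp_injective below_inj
  have above_summable : Summable fun p => F (above p) := hF.comp_injective above_inj
  rw [← hF.tsum_subtype_add_tsum_subtype_compl (range below), ← range_above,
    tsum_range F below_inj, tsum_range F above_inj, below_summable.tsum_prod,
    above_summable.tsum_prod]

theorem tsum_mul_tsum_eq_add {R : Type*} [NormedRing R] [CompleteSpace R] {u v : ℕ → R}
    (hu : Summable fun n => ‖u n‖) (hv : Summable fun n => ‖v n‖) :
    (∑' n, u n) * (∑' n, v n) =
      ∑' k, ∑' l, u (l + k) * v l + ∑' k, ∑' l, u l * v (l + (k + 1)) := by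
  have huv : Summable fun p : ℕ × ℕ => u p.1 * v p.2 := summable_mul_of_summable_norm hu hv
  rw [tsum_mul_tsum_of_summable_norm hu hv, tsum_nat_prod_eq_add huv]

theorem powerSum_mul_conj_powerSum {ρ κ κ' : ℝ} {b c : ℕ → ℂ} (hρ : 1 ≤ ρ) (hb : Dominated ρ κ b)
    (hc : Dominated ρ κ' c) {z : ℂ} (hz : ‖z‖ = 1) :
    powerSum b z * (starRingEnd ℂ) (powerSum c z) = powerSum (correlation b c) z +
      (starRingEnd ℂ) (powerSum (correlation c b) z - correlation c b 0) := by
  have hρ0 : 0 < ρ := by linarith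
  have hzn (l : ℕ) : z ^ l * (starRingEnd ℂ) z ^ l = 1 := by
    rw [← mul_pow, Complex.mul_conj, Complex.normSq_eq_norm_sq, hz]
    norm_num
  have hb_sum : Summable fun n => ‖b n * z ^ n‖ := (hb.hasSum hρ0 (hz.trans_le hρ)).summable.norm
  have hc_sum : Summable fun n => ‖(starRingEnd ℂ) (c n * z ^ n)‖ := by
    simpa only [RCLike.norm_conj] using (hc.hasSum hρ0 (hz.trans_le hρ)).summable.norm
  have hcb := ((dominated_correlation hρ hc hb).hasSum hρ0 (hz.trans_le hρ)).summable
  have htail : powerSum (correlation c b) z - correlation c b 0 =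
      ∑' k, correlation c b (k + 1) * z ^ (k + 1) := by
    rw [powerSum, hcb.tsum_eq_zero_add, pow_zero, mul_one, add_sub_cancel_left]
  rw [htail, powerSum, powerSum, powerSum, Complex.conj_tsum, tsum_mul_tsum_eq_add hb_sum hc_sum]
  congr 1
  · refine tsum_congr fun k => ?_
    rw [correlation, ← tsum_mul_right]
    refine tsum_congr fun l => ?_
    simp only [map_mul, map_pow, pow_add]
    linear_combination (b (l + k) * (starRingEnd ℂ) (c l) * z ^ k) * hzn l
  · rw [Complex.conj_tsum]
    refine tsum_congr fun k => ?_
    rw [correlation, ← tsum_mul_right, Complex.conj_tsum]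
    refine tsum_congr fun l => ?_
    simp only [map_mul, map_pow, Complex.conj_conj]
    rw [pow_add _ l (k + 1)]
    linear_combination (b l * (starRingEnd ℂ) (c (l + (k + 1))) *
      ((starRingEnd ℂ) z ^ (k + 1))) * hzn l

theorem powerSum_schwarzCoeff {ρ κ κ' : ℝ} {b c : ℕ → ℂ} (hρ : 1 ≤ ρ) (hb : Dominated ρ κ b)
    (hc : Dominated ρ κ' c) {z : ℂ} (hz : ‖z‖ ≤ ρ) :
    powerSum (schwarzCoeff b c) z = powerSum (correlation b c) z + powerSum (correlation c b) z -
      (correlation b c 0 + correlation c b 0) / 2 := by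
  have hbc := ((dominated_correlation hρ hb hc).hasSum (by linarith) hz).add
    ((dominated_correlation hρ hc hb).hasSum (by linarith) hz)
  have hzero := hasSum_ite_eq (0 : ℕ) ((correlation b c 0 + correlation c b 0) / 2)
  refine HasSum.tsum_eq ((hbc.sub hzero).congr_fun fun k => ?_)
  rcases eq_or_ne k 0 with rfl | hk
  · simp only [schwarzCoeff, if_true, pow_zero]
    ring
  · simp only [schwarzCoeff, if_neg hk]
    ring

theorem re_powerSum_schwarzCoeff {ρ κ κ' : ℝ} {b c : ℕ → ℂ} (hρ : 1 ≤ ρ) (hb : Dominated ρ κ b)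
    (hc : Dominated ρ κ' c) {z : ℂ} (hz : ‖z‖ = 1) :
    (powerSum (schwarzCoeff b c) z).re =
      (powerSum b z * (starRingEnd ℂ) (powerSum c z)).re := by
  rw [powerSum_schwarzCoeff hρ hb hc (hz.trans_le hρ), powerSum_mul_conj_powerSum hρ hb hc hz,
    ← conj_correlation_zero c b, add_comm (starRingEnd ℂ _), Complex.add_conj]
  simp only [Complex.add_re, Complex.sub_re, Complex.conj_re, Complex.div_ofNat_re,
    Complex.ofReal_re]
  ring

/-! ### Analytic functions with given real part on the unit circle -/

theorem re_nonpos_of_re_eq_zero_on_circle {F : ℂ → ℂ} (hF : DiffContOnCl ℂ F (ball 0 1))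
    (hre : ∀ z : ℂ, ‖z‖ = 1 → (F z).re = 0) {z : ℂ} (hz : z ∈ ball (0 : ℂ) 1) :
    (F z).re ≤ 0 := by
  have hexp : DiffContOnCl ℂ (fun z => Complex.exp (F z)) (ball 0 1) :=
    ⟨hF.differentiableOn.cexp, hF.continuousOn.cexp⟩
  have hbound := Complex.norm_le_of_forall_mem_frontier_norm_le isBounded_ball hexp (C := 1)
    (fun w hw => by
      rw [frontier_ball _ one_ne_zero, mem_sphere_zero_iff_norm] at hw
      rw [Complex.norm_exp, hre w hw, Real.exp_zero]) (subset_closure hz)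
  rwa [Complex.norm_exp, Real.exp_le_one_iff] at hbound

theorem eqOn_zero_of_re_eq_zero_on_circle {F : ℂ → ℂ} (hF : DiffContOnCl ℂ F (ball 0 1))
    (hre : ∀ z : ℂ, ‖z‖ = 1 → (F z).re = 0) (h0 : (F 0).im = 0) : EqOn F 0 (ball 0 1) := by
  have hball : ∀ z ∈ ball (0 : ℂ) 1, (F z).re = 0 := fun z hz => by
    have hle := re_nonpos_of_re_eq_zero_on_circle hF hre hz
    have hge := re_nonpos_of_re_eq_zero_on_circle hF.neg (fun w hw => by simp [hre w hw]) hz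
    simp only [Pi.neg_apply, Complex.neg_re] at hge
    linarith
  obtain ⟨c, hc⟩ := AnalyticOnNhd.eq_const_of_re_eq_const
    (hF.differentiableOn.analyticOnNhd isOpen_ball) hball isOpen_ball
    ⟨⟨0, by simp⟩, (convex_ball _ _).isPreconnected⟩
  intro z hz
  rw [hc z hz, ← hc 0 (by simp)]
  exact Complex.ext (hball 0 (by simp)) h0

theorem diffContOnCl_unitBall {F : ℂ → ℂ} {r : ℝ} (hr : 1 < r)
    (hF : DifferentiableOn ℂ F (ball 0 r)) : DiffContOnCl ℂ F (ball 0 1) :=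
  (hF.mono (by
    rw [closure_ball _ one_ne_zero]; exact closedBall_subset_ball hr)).diffContOnCl

theorem exists_sq_mul_geometric_le {q : ℝ} (h0 : 0 ≤ q) (h1 : q < 1) :
    ∃ A : ℝ, ∀ n : ℕ, ((n : ℝ) + 1) ^ 2 * q ^ n ≤ A := by
  have h : Tendsto (fun n : ℕ => ((n : ℝ) + 1) ^ 2 * q ^ n) atTop (𝓝 0) := by
    have e2 := tendsto_pow_const_mul_const_pow_of_lt_one 2 h0 h1
    have e1 := tendsto_pow_const_mul_const_pow_of_lt_one 1 h0 h1
    have e0 := tendsto_pow_const_mul_const_pow_of_lt_one 0 h0 h1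
    have := (e2.add (e1.const_mul 2)).add e0
    simp only [mul_zero, add_zero] at this
    exact this.congr fun n => by ring
  obtain ⟨A, hA⟩ := h.bddAbove_range
  exact ⟨A, fun n => hA ⟨n, rfl⟩⟩

theorem exists_dominated_taylorCoeffZero {ρ R r : ℝ} (hρ : 0 < ρ) (hρR : ρ < R) (hRr : R < r) :
    ∃ A : ℝ, ∀ (f : ℂ → ℂ) (M : ℝ), DifferentiableOn ℂ f (ball 0 r) →
      (∀ z ∈ closedBall (0 : ℂ) R, ‖f z‖ ≤ M) → Dominated ρ (M * A) (taylorCoeffZero f) := by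
  have hR : 0 < R := hρ.trans hρR
  obtain ⟨A, hA⟩ := exists_sq_mul_geometric_le (q := ρ / R) (by positivity)
    ((div_lt_one hR).2 hρR)
  refine ⟨A, fun f M hf hM n => (norm_taylorCoeffZero_le hf hR hRr hM n).trans ?_⟩
  have hM0 : 0 ≤ M := (norm_nonneg _).trans (hM 0 (by simp [hR.le]))
  have hAn := hA n
  rw [div_pow, mul_div_assoc', div_le_iff₀ (by positivity)] at hAn
  rw [seqWeight, ← div_eq_mul_inv, div_le_div_iff₀ (by positivity) (by positivity)]
  nlinarith [mul_le_mul_of_nonneg_left hAn hM0]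

theorem taylorCoeffZero_eq_schwarzCoeff {Q Y B : ℂ → ℂ} {r : ℝ} (hr : 1 < r)
    (hQ : DifferentiableOn ℂ Q (ball 0 r)) (hY : DifferentiableOn ℂ Y (ball 0 r))
    (hB : DifferentiableOn ℂ B (ball 0 r))
    (hre : ∀ z : ℂ, ‖z‖ = 1 → (Q z).re = (Y z * (starRingEnd ℂ) (B z)).re)
    (h0 : (Q 0).im = 0) :
    taylorCoeffZero Q = schwarzCoeff (taylorCoeffZero Y) (taylorCoeffZero B) := by
  obtain ⟨R, hR1, hRr⟩ := exists_between hr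
  obtain ⟨ρ, hρ1, hρR⟩ := exists_between hR1
  have hdom (f : ℂ → ℂ) (hf : DifferentiableOn ℂ f (ball 0 r)) :
      ∃ κ, Dominated ρ κ (taylorCoeffZero f) := by
    obtain ⟨A, hA⟩ := exists_dominated_taylorCoeffZero (by linarith) hρR hRr
    obtain ⟨M, hM⟩ := (isCompact_closedBall (0 : ℂ) R).exists_bound_of_continuousOn
      (hf.continuousOn.mono (closedBall_subset_ball hRr))
    exact ⟨M * A, hA f M hf hM⟩
  obtain ⟨κ, hκ⟩ := hdom Y hY
  obtain ⟨κ', hκ'⟩ := hdom B hB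
  have hp := dominated_schwarzCoeff hρ1.le hκ hκ'
  have hcircle (z : ℂ) (hz : ‖z‖ = 1) :
      (Q z - powerSum (schwarzCoeff (taylorCoeffZero Y) (taylorCoeffZero B)) z).re = 0 := by
    have hzr : z ∈ ball (0 : ℂ) r := by simp [hz, hr]
    rw [Complex.sub_re, re_powerSum_schwarzCoeff hρ1.le hκ hκ' hz, hre z hz, powerSum, powerSum,
      (hasSum_taylorCoeffZero hY hzr).tsum_eq, (hasSum_taylorCoeffZero hB hzr).tsum_eq, sub_self]
  have heq := eqOn_zero_of_re_eq_zero_on_circle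
    ((diffContOnCl_unitBall hr hQ).sub
      (diffContOnCl_unitBall hρ1 (hp.differentiableOn_powerSum (by linarith)))) hcircle (by
      rw [Pi.sub_apply, powerSum_at_zero, Complex.sub_im, h0, schwarzCoeff_zero_im, sub_zero])
  refine taylorCoeffZero_eq_of_hasSum one_pos fun z hz => ?_
  rw [sub_eq_zero.1 (heq hz)]
  exact hp.hasSum (by linarith) ((mem_ball_zero_iff.1 hz).le.trans hρ1.le)

/-! ### Injective analytic functions have no critical point -/

theorem exists_analyticAt_pow_eq {g : ℂ → ℂ} {z₀ : ℂ} (hg : AnalyticAt ℂ g z₀) (hg0 : g z₀ ≠ 0)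
    {n : ℕ} (hn : n ≠ 0) : ∃ m : ℂ → ℂ, AnalyticAt ℂ m z₀ ∧ ∀ z, m z ^ n = g z := by
  refine ⟨fun z => g z₀ ^ ((n : ℂ)⁻¹) * (g z / g z₀) ^ ((n : ℂ)⁻¹), ?_, fun z => ?_⟩
  · refine analyticAt_const.mul ((hg.div analyticAt_const hg0).cpow analyticAt_const ?_)
    simp [div_self hg0]
  · rw [mul_pow, Complex.cpow_nat_inv_pow _ hn, Complex.cpow_nat_inv_pow _ hn]
    field_simp

theorem hasDerivAt_sub_mul_self {m : ℂ → ℂ} {z₀ : ℂ} (hm : DifferentiableAt ℂ m z₀) :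
    HasDerivAt (fun z => (z - z₀) * m z) (m z₀) z₀ := by
  simpa using ((hasDerivAt_id z₀).sub_const z₀).fun_mul hm.hasDerivAt

theorem exists_sub_eq_pow_of_deriv_eq_zero {f : ℂ → ℂ} {z₀ : ℂ} (hf : AnalyticAt ℂ f z₀)
    (hd : deriv f z₀ = 0) (hconst : ¬ ∀ᶠ z in 𝓝 z₀, f z - f z₀ = 0) :
    ∃ (n : ℕ) (φ : ℂ → ℂ) (φ' : ℂ), 1 < n ∧ HasStrictDerivAt φ φ' z₀ ∧ φ' ≠ 0 ∧ φ z₀ = 0 ∧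
      ∀ᶠ z in 𝓝 z₀, f z - f z₀ = φ z ^ n := by
  obtain ⟨n, g, hg, hg0, hfg⟩ :=
    (hf.fun_sub analyticAt_const).exists_eventuallyEq_pow_smul_nonzero_iff.2 hconst
  have hn0 : n ≠ 0 := by
    rintro rfl
    have h := hfg.self_of_nhds
    rw [sub_self, pow_zero, one_smul] at h
    exact hg0 h.symm
  have hn1 : n ≠ 1 := by
    rintro rfl
    simp only [pow_one, smul_eq_mul] at hfg
    have h := (hasDerivAt_sub_mul_self hg.differentiableAt).congr_of_eventuallyEq hfg
    exact hg0 ((h.unique (hf.differentiableAt.hasDerivAt.sub_const _)).trans hd)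
  obtain ⟨m, hm, hmn⟩ := exists_analyticAt_pow_eq hg hg0 hn0
  have hm0 : m z₀ ≠ 0 := fun h => hg0 (by rw [← hmn, h, zero_pow hn0])
  refine ⟨n, fun z => (z - z₀) * m z, m z₀, by omega, ?_, hm0, by simp, ?_⟩
  · have hφ : AnalyticAt ℂ (fun z => (z - z₀) * m z) z₀ := by fun_prop
    simpa only [(hasDerivAt_sub_mul_self hm.differentiableAt).deriv] using hφ.hasStrictDerivAt
  · filter_upwards [hfg] with z hz
    rw [hz, smul_eq_mul, mul_pow, hmn]

theorem deriv_ne_zero_of_analyticAt_of_injOn {f : ℂ → ℂ} {z₀ : ℂ} {U : Set ℂ}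
    (hf : AnalyticAt ℂ f z₀) (hU : U ∈ 𝓝 z₀) (hinj : InjOn f U) : deriv f z₀ ≠ 0 := by
  intro hd
  have hconst : ¬ ∀ᶠ z in 𝓝 z₀, f z - f z₀ = 0 := by
    intro h
    have hsub : U ∩ {z | f z - f z₀ = 0} ⊆ {z₀} := fun z hz =>
      hinj hz.1 (mem_of_mem_nhds hU) (sub_eq_zero.1 hz.2)
    exact infinite_of_mem_nhds z₀ (inter_mem hU h) ((finite_singleton z₀).subset hsub)
  obtain ⟨n, φ, φ', hn, hφ, hφ', hφ0, hfφ⟩ := exists_sub_eq_pow_of_deriv_eq_zero hf hd hconst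
  have himage : φ '' (U ∩ {z | f z - f z₀ = φ z ^ n}) ∈ 𝓝 (0 : ℂ) := by
    rw [← hφ0, ← hφ.map_nhds_eq hφ']
    exact image_mem_map (inter_mem hU hfφ)
  obtain ⟨ε, hε, hsub⟩ := Metric.mem_nhds_iff.1 himage
  have hζ := Complex.isPrimitiveRoot_exp n (by omega)
  set ζ := Complex.exp (2 * Real.pi * Complex.I / n)
  let w : ℂ := ((ε / 2 : ℝ) : ℂ)
  have hw : ‖w‖ = ε / 2 := by simp [w, abs_of_pos hε]
  have hw0 : w ≠ 0 := norm_ne_zero_iff.1 (hw ▸ by positivity)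
  obtain ⟨z₁, ⟨hz₁U, hz₁⟩, hz₁w⟩ := hsub (show w ∈ ball 0 ε by
    rw [mem_ball_zero_iff, hw]; linarith)
  obtain ⟨z₂, ⟨hz₂U, hz₂⟩, hz₂w⟩ := hsub (show ζ * w ∈ ball 0 ε by
    rw [mem_ball_zero_iff, norm_mul, hw, hζ.norm'_eq_one (by omega)]; linarith)
  have heq : f z₁ = f z₂ := by
    rw [mem_ofPred_eq, hz₁w] at hz₁
    rw [mem_ofPred_eq, hz₂w, mul_pow, hζ.pow_eq_one, one_mul, ← hz₁] at hz₂
    exact (sub_left_injective hz₂).symm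
  rw [← hinj hz₁U hz₂U heq, hz₁w] at hz₂w
  exact hζ.ne_one hn ((mul_eq_right₀ hw0).1 hz₂w.symm)

/-! ### Families of analytic functions -/

/-- `f` is a family, indexed by a real parameter in `K`, of analytic functions on `U` which is
continuously differentiable in the parameter, with derivative `G`. -/
structure IsC1AnalyticFamily (K : Set ℝ) (U : Set ℂ) (f G : ℝ → ℂ → ℂ) : Prop where
  differentiableOn : ∀ t ∈ K, DifferentiableOn ℂ (f t) U
  hasDerivWithinAt : ∀ t ∈ K, ∀ z ∈ U, HasDerivWithinAt (fun s => f s z) (G t z) K t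
  continuousOn : ContinuousOn (fun p : ℝ × ℂ => f p.1 p.2) (K ×ˢ U)
  continuousOn_velocity : ContinuousOn (fun p : ℝ × ℂ => G p.1 p.2) (K ×ˢ U)

theorem continuousOn_deriv_family {F : ℝ → ℂ → ℂ} {K : Set ℝ} {U : Set ℂ} (hU : IsOpen U)
    (hd : ∀ t ∈ K, DifferentiableOn ℂ (F t) U)
    (hc : ContinuousOn (fun p : ℝ × ℂ => F p.1 p.2) (K ×ˢ U)) :
    ContinuousOn (fun p : ℝ × ℂ => deriv (F p.1) p.2) (K ×ˢ U) := by
  rintro ⟨t₀, z₀⟩ ⟨ht₀, hz₀⟩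
  have hloc : TendstoLocallyUniformlyOn (fun p : ℝ × ℂ => F p.1) (F t₀)
      (𝓝[K ×ˢ U] (t₀, z₀)) U := by
    rw [Metric.tendstoLocallyUniformlyOn_iff]
    intro ε hε x hx
    have h := Metric.tendsto_nhds.1 (hc (t₀, x) ⟨ht₀, hx⟩) (ε / 2) (by positivity)
    rw [nhdsWithin_prod_eq] at h
    obtain ⟨u, hu, v, hv, huv⟩ := Filter.mem_prod_iff.1 h
    refine ⟨v, hv, ?_⟩
    have hu' : Prod.fst ⁻¹' u ∈ 𝓝[K ×ˢ U] (t₀, z₀) := by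
      rw [nhdsWithin_prod_eq]
      exact Filter.tendsto_fst hu
    filter_upwards [hu'] with p hp y hy
    have hpy : dist (F p.1 y) (F t₀ x) < ε / 2 := huv (mk_mem_prod hp hy)
    have hty : dist (F t₀ y) (F t₀ x) < ε / 2 :=
      huv (mk_mem_prod (mem_of_mem_nhdsWithin ht₀ hu) hy)
    calc dist (F t₀ y) (F p.1 y) ≤ dist (F t₀ y) (F t₀ x) + dist (F p.1 y) (F t₀ x) :=
          dist_triangle_right _ _ _
      _ < ε := by linarith
  have hder := hloc.deriv (by
    filter_upwards [self_mem_nhdsWithin] with p hp using hd p.1 hp.1) hU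
  exact hder.tendsto_comp (((hd t₀ ht₀).deriv hU).continuousOn z₀ hz₀) hz₀ (by
    rw [nhdsWithin_prod_eq]
    exact Filter.tendsto_snd)

namespace IsC1AnalyticFamily

variable {K : Set ℝ} {U : Set ℂ} {f G : ℝ → ℂ → ℂ}

theorem tendstoLocallyUniformlyOn_slope (h : IsC1AnalyticFamily K U f G) (hK : Convex ℝ K)
    {t : ℝ} (ht : t ∈ K) :
    TendstoLocallyUniformlyOn (fun s z => slope (fun s => f s z) t s) (G t) (𝓝[K \ {t}] t) U := by
  rw [Metric.tendstoLocallyUniformlyOn_iff]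
  intro ε hε x hx
  have hG := Metric.tendsto_nhds.1 (h.continuousOn_velocity (t, x) ⟨ht, hx⟩) (ε / 4)
    (by positivity)
  rw [nhdsWithin_prod_eq] at hG
  obtain ⟨u, hu, v, hv, huv⟩ := Filter.mem_prod_iff.1 hG
  obtain ⟨δ, hδ, hδu⟩ := Metric.mem_nhdsWithin_iff.1 hu
  refine ⟨v ∩ U, inter_mem hv self_mem_nhdsWithin, ?_⟩
  have hball : ball t δ ∩ (K \ {t}) ∈ 𝓝[K \ {t}] t :=
    inter_mem (mem_nhdsWithin_of_mem_nhds (ball_mem_nhds t hδ)) self_mem_nhdsWithin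
  filter_upwards [hball] with s hs y hy
  have hderiv : ∀ τ ∈ ball t δ ∩ K,
      HasDerivWithinAt (fun τ => f τ y - (τ - t) • G t y) (G τ y - G t y) (ball t δ ∩ K) τ :=
    fun τ hτ => by
      simpa using ((h.hasDerivWithinAt τ hτ.2 y hy.2).mono inter_subset_right).fun_sub
        (((hasDerivWithinAt_id τ _).sub_const t).smul_const (G t y))
  have hclose : ∀ τ ∈ ball t δ ∩ K, ‖G τ y - G t y‖ ≤ ε / 2 := fun τ hτ => by
    have hτx : dist (G τ y) (G t x) < ε / 4 := huv (mk_mem_prod (hδu hτ) hy.1)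
    have htx : dist (G t y) (G t x) < ε / 4 :=
      huv (mk_mem_prod (mem_of_mem_nhdsWithin ht hu) hy.1)
    rw [← dist_eq_norm]
    linarith [dist_triangle_right (G τ y) (G t y) (G t x)]
  have hst : 0 < ‖s - t‖ := norm_pos_iff.2 (sub_ne_zero.2 hs.2.2)
  have hmean := ((convex_ball t δ).inter hK).norm_image_sub_le_of_norm_hasDerivWithin_le hderiv
    hclose ⟨mem_ball_self hδ, ht⟩ ⟨hs.1, hs.2.1⟩
  have hslope : slope (fun s => f s y) t s - G t y =
      (s - t)⁻¹ • (f s y - (s - t) • G t y - (f t y - (t - t) • G t y)) := by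
    rw [slope_def_module, sub_self, zero_smul, sub_zero, sub_right_comm,
      smul_sub (s - t)⁻¹ (f s y - f t y), inv_smul_smul₀ (sub_ne_zero.2 hs.2.2)]
  rw [dist_comm, dist_eq_norm, hslope, norm_smul, norm_inv]
  calc ‖s - t‖⁻¹ * _ ≤ ‖s - t‖⁻¹ * (ε / 2 * ‖s - t‖) := by gcongr
    _ = ε / 2 := by field_simp
    _ < ε := by linarith

theorem differentiableOn_slope (h : IsC1AnalyticFamily K U f G) {s t : ℝ} (hs : s ∈ K)
    (ht : t ∈ K) : DifferentiableOn ℂ (fun z => slope (fun s => f s z) t s) U := by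
  simp only [slope_def_module]
  exact ((h.differentiableOn s hs).fun_sub (h.differentiableOn t ht)).fun_const_smul _

theorem differentiableOn_velocity (h : IsC1AnalyticFamily K U f G) (hK : Convex ℝ K)
    (hK' : UniqueDiffOn ℝ K) (hU : IsOpen U) {t : ℝ} (ht : t ∈ K) :
    DifferentiableOn ℂ (G t) U := by
  have : (𝓝[K \ {t}] t).NeBot :=
    accPt_principal_iff_nhdsWithin.1 (uniqueDiffWithinAt_iff_accPt.1 (hK' t ht))
  refine (h.tendstoLocallyUniformlyOn_slope hK ht).differentiableOn ?_ hU
  filter_upwards [self_mem_nhdsWithin] with s hs using h.differentiableOn_slope hs.1 ht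

theorem deriv (h : IsC1AnalyticFamily K U f G) (hK : Convex ℝ K) (hK' : UniqueDiffOn ℝ K)
    (hU : IsOpen U) :
    IsC1AnalyticFamily K U (fun t => deriv (f t)) (fun t => deriv (G t)) where
  differentiableOn t ht := (h.differentiableOn t ht).deriv hU
  hasDerivWithinAt t ht z hz := by
    have hev : ∀ᶠ s in 𝓝[K \ {t}] t,
        DifferentiableOn ℂ (fun z => slope (fun s => f s z) t s) U := by
      filter_upwards [self_mem_nhdsWithin] with s hs using h.differentiableOn_slope hs.1 ht
    have hlim := ((h.tendstoLocallyUniformlyOn_slope hK ht).deriv hev hU).tendsto_at hz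
    rw [hasDerivWithinAt_iff_tendsto_slope]
    refine hlim.congr' ?_
    filter_upwards [self_mem_nhdsWithin] with s hs
    have hdiff (τ : ℝ) (hτ : τ ∈ K) : DifferentiableAt ℂ (f τ) z :=
      (h.differentiableOn τ hτ).differentiableAt (hU.mem_nhds hz)
    simp only [Function.comp_apply, slope_def_module]
    rw [deriv_fun_const_smul _ ((hdiff s hs.1).fun_sub (hdiff t ht)),
      deriv_fun_sub (hdiff s hs.1) (hdiff t ht)]
  continuousOn := continuousOn_deriv_family hU h.differentiableOn h.continuousOn
  continuousOn_velocity := continuousOn_deriv_family hU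
    (fun _ ht => h.differentiableOn_velocity hK hK' hU ht) h.continuousOn_velocity

theorem inv (h : IsC1AnalyticFamily K U f G) (h0 : ∀ t ∈ K, ∀ z ∈ U, f t z ≠ 0) :
    IsC1AnalyticFamily K U (fun t z => (f t z)⁻¹) (fun t z => -G t z / f t z ^ 2) where
  differentiableOn t ht := (h.differentiableOn t ht).inv (h0 t ht)
  hasDerivWithinAt t ht z hz := (h.hasDerivWithinAt t ht z hz).fun_inv (h0 t ht z hz)
  continuousOn := h.continuousOn.inv₀ fun p hp => h0 p.1 hp.1 p.2 hp.2
  continuousOn_velocity := h.continuousOn_velocity.neg.div (h.continuousOn.pow 2) fun p hp =>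
    pow_ne_zero 2 (h0 p.1 hp.1 p.2 hp.2)

theorem iteratedDeriv (h : IsC1AnalyticFamily K U f G) (hK : Convex ℝ K) (hK' : UniqueDiffOn ℝ K)
    (hU : IsOpen U) (n : ℕ) :
    IsC1AnalyticFamily K U (fun t => iteratedDeriv n (f t)) (fun t => iteratedDeriv n (G t)) := by
  induction n with
  | zero => simpa only [iteratedDeriv_zero] using h
  | succ n ih => simpa only [iteratedDeriv_succ] using ih.deriv hK hK' hU

theorem hasDerivWithinAt_taylorCoeffZero (h : IsC1AnalyticFamily K U f G) (hK : Convex ℝ K)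
    (hK' : UniqueDiffOn ℝ K) (hU : IsOpen U) (h0 : 0 ∈ U) (n : ℕ) {t : ℝ} (ht : t ∈ K) :
    HasDerivWithinAt (fun s => taylorCoeffZero (f s) n) (taylorCoeffZero (G t) n) K t :=
  ((h.iteratedDeriv hK hK' hU n).hasDerivWithinAt t ht 0 h0).div_const _

end IsC1AnalyticFamily

/-! ### The cubic vector field on coefficient sequences -/

/-- The coefficients of `h (ξ p)' - ξ p h'`, where `h = ∑ aₙ ξⁿ` and `p = ∑ (schwarzCoeff b c)ₙ ξⁿ`.
The coefficients of `1 / f'` of a solution `f` move with the velocity `cubicForm a a a`. -/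
noncomputable def cubicForm (a b c : ℕ → ℂ) (n : ℕ) : ℂ :=
  ∑ p ∈ antidiagonal n, (1 + (p.1 : ℂ) - (p.2 : ℂ)) * (schwarzCoeff b c p.1 * a p.2)

theorem norm_one_add_sub_le (k l : ℕ) : ‖(1 + (k : ℂ) - (l : ℂ))‖ ≤ (k + l : ℕ) + 1 := by
  have hreal : (1 + (k : ℂ) - (l : ℂ)) = ((1 + (k : ℝ) - (l : ℝ) : ℝ) : ℂ) := by push_cast; rfl
  rw [hreal, Complex.norm_real, Real.norm_eq_abs, abs_le]
  push_cast
  constructor <;> linarith [k.cast_nonneg (α := ℝ), l.cast_nonneg (α := ℝ)]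

theorem Dominated.norm_cubicForm_le {ρ κ κ' κ'' : ℝ} {a b c : ℕ → ℂ} (hρ : 1 ≤ ρ)
    (ha : Dominated ρ κ a) (hb : Dominated ρ κ' b) (hc : Dominated ρ κ'' c) (n : ℕ) :
    ‖cubicForm a b c n‖ ≤ (n + 1) * (32 * κ * κ' * κ'' * seqWeight ρ n) := by
  have hconv := (dominated_schwarzCoeff hρ hb hc).sum_antidiagonal (by linarith) ha n
  calc ‖cubicForm a b c n‖
      ≤ ∑ p ∈ antidiagonal n, ((n : ℝ) + 1) * (‖schwarzCoeff b c p.1‖ * ‖a p.2‖) := by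
        refine (norm_sum_le _ _).trans (Finset.sum_le_sum fun p hp => ?_)
        rw [norm_mul, norm_mul, ← mem_antidiagonal.1 hp]
        exact mul_le_mul_of_nonneg_right (norm_one_add_sub_le _ _) (by positivity)
    _ ≤ (n + 1) * (8 * (4 * κ' * κ'') * κ * seqWeight ρ n) := by
        rw [← Finset.mul_sum]
        exact mul_le_mul_of_nonneg_left hconv (by positivity)
    _ = _ := by ring

theorem Dominated.schwarzCoeff_sub_left {ρ κ κ' κ'' : ℝ} {a b c : ℕ → ℂ} (hρ : 1 ≤ ρ)
    (ha : Dominated ρ κ a) (hb : Dominated ρ κ' b) (hc : Dominated ρ κ'' c) (k : ℕ) :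
    schwarzCoeff (a - b) c k = schwarzCoeff a c k - schwarzCoeff b c k := by
  have hcorr : correlation (a - b) c k = correlation a c k - correlation b c k := by
    simp only [correlation, Pi.sub_apply, sub_mul]
    exact (ha.summable_correlation hρ hc k).tsum_sub (hb.summable_correlation hρ hc k)
  have hcorr' : correlation c (a - b) k = correlation c a k - correlation c b k := by
    simp only [correlation, Pi.sub_apply, map_sub, mul_sub]
    exact (hc.summable_correlation hρ ha k).tsum_sub (hc.summable_correlation hρ hb k)
  rw [schwarzCoeff, schwarzCoeff, schwarzCoeff, hcorr, hcorr']
  ring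

theorem schwarzCoeff_comm (b c : ℕ → ℂ) : schwarzCoeff b c = schwarzCoeff c b := by
  ext k
  rw [schwarzCoeff, schwarzCoeff, add_comm]

theorem Dominated.norm_cubicForm_sub_le {ρ K κ : ℝ} {a b : ℕ → ℂ} (hρ : 1 ≤ ρ)
    (ha : Dominated ρ K a) (hb : Dominated ρ K b) (hab : Dominated ρ κ (a - b)) (n : ℕ) :
    ‖cubicForm a a a n - cubicForm b b b n‖ ≤ (n + 1) * (96 * K ^ 2 * κ * seqWeight ρ n) := by
  have hsplit : cubicForm a a a n - cubicForm b b b n =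
      cubicForm (a - b) a a n + cubicForm b (a - b) a n + cubicForm b (a - b) b n := by
    simp only [cubicForm, ← Finset.sum_add_distrib, ← Finset.sum_sub_distrib]
    refine Finset.sum_congr rfl fun p _ => ?_
    rw [ha.schwarzCoeff_sub_left hρ hb ha, ha.schwarzCoeff_sub_left hρ hb hb,
      schwarzCoeff_comm b a, Pi.sub_apply]
    ring
  rw [hsplit]
  refine norm_add₃_le.trans ?_
  linarith [hab.norm_cubicForm_le hρ ha ha n, hb.norm_cubicForm_le hρ hab ha n,
    hb.norm_cubicForm_le hρ hab hb n]

section Continuity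

variable {X : Type*} [TopologicalSpace X] {S : Set X} {ρ K : ℝ} {a : X → ℕ → ℂ}

theorem continuousOn_schwarzCoeff (hρ : 1 ≤ ρ) (ha : ∀ s ∈ S, Dominated ρ K (a s))
    (hc : ∀ n, ContinuousOn (fun s => a s n) S) (k : ℕ) :
    ContinuousOn (fun s => schwarzCoeff (a s) (a s) k) S := by
  have hcorr : ContinuousOn (fun s => correlation (a s) (a s) k) S :=
    continuousOn_tsum (fun l => (hc _).mul (Complex.continuous_conj.comp_continuousOn (hc l)))
      (summable_inv_succ_sq.mul_left _) fun l s hs =>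
        (ha s hs).norm_correlation_term_le hρ (ha s hs) k l
  exact continuousOn_const.mul (hcorr.add hcorr)

theorem continuousOn_cubicForm (hρ : 1 ≤ ρ) (ha : ∀ s ∈ S, Dominated ρ K (a s))
    (hc : ∀ n, ContinuousOn (fun s => a s n) S) (n : ℕ) :
    ContinuousOn (fun s => cubicForm (a s) (a s) (a s) n) S :=
  continuousOn_finsetSum _ fun p _ =>
    continuousOn_const.mul ((continuousOn_schwarzCoeff hρ ha hc p.1).mul (hc p.2))

end Continuity

/-! ### The coefficient equation -/

/-- The sequence-valued curve `b` has velocity `cubicForm a a a` on `[0,T]`. With `b = a` this is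
the equation for the coefficients of `1 / f'`; with `b ≠ a` it is one step of Picard iteration. -/
def IsDrivenBy (T : ℝ) (a b : ℝ → ℕ → ℂ) : Prop :=
  ∀ t ∈ Icc 0 T, ∀ n,
    HasDerivWithinAt (fun s => b s n) (cubicForm (a t) (a t) (a t) n) (Icc 0 T) t

theorem IsDrivenBy.continuousOn {T : ℝ} {a b : ℝ → ℕ → ℂ} (h : IsDrivenBy T a b) (n : ℕ) :
    ContinuousOn (fun t => b t n) (Icc 0 T) :=
  fun t ht => (h t ht n).continuousWithinAt

theorem IsDrivenBy.congr {T : ℝ} {a a' b b' : ℝ → ℕ → ℂ} (h : IsDrivenBy T a b)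
    (ha : EqOn a' a (Icc 0 T)) (hb : EqOn b' b (Icc 0 T)) : IsDrivenBy T a' b' := fun t ht n => by
  rw [ha ht]
  exact (h t ht n).congr (fun s hs => congrFun (hb hs) n) (congrFun (hb ht) n)

theorem IsDrivenBy.mono {T T' : ℝ} {a b : ℝ → ℕ → ℂ} (h : IsDrivenBy T a b) (hT : T' ≤ T) :
    IsDrivenBy T' a b := fun t ht n =>
  (h t ⟨ht.1, ht.2.trans hT⟩ n).mono (Icc_subset_Icc_right hT)

theorem IsDrivenBy.shift {T τ : ℝ} {a b : ℝ → ℕ → ℂ} (h : IsDrivenBy T a b) (hτ : 0 ≤ τ) :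
    IsDrivenBy (T - τ) (fun t => a (τ + t)) (fun t => b (τ + t)) := fun t ht n => by
  have hmem : MapsTo (fun s => τ + s) (Icc 0 (T - τ)) (Icc 0 T) := fun s hs =>
    ⟨add_nonneg hτ hs.1, by linarith [hs.2]⟩
  have hcomp := (h _ (hmem ht) n).scomp t ((hasDerivWithinAt_id t _).const_add τ) hmem
  rwa [one_smul] at hcomp

theorem norm_le_exp_of_norm_deriv_le {E : Type*} [NormedAddCommGroup E] [NormedSpace ℝ E]
    {u u' : ℝ → E} {T K μ : ℝ} (hμ : 0 < μ) (hK : 0 ≤ K)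
    (hu : ∀ t ∈ Icc 0 T, HasDerivWithinAt u (u' t) (Icc 0 T) t)
    (hbd : ∀ t ∈ Icc 0 T, ‖u' t‖ ≤ K * Real.exp (μ * t)) {t : ℝ} (ht : t ∈ Icc 0 T) :
    ‖u t‖ ≤ ‖u 0‖ + K / μ * Real.exp (μ * t) := by
  have hderiv (x : ℝ) : HasDerivAt (fun x => ‖u 0‖ + K / μ * Real.exp (μ * x))
      (K * Real.exp (μ * x)) x := by
    refine (((hasDerivAt_const_mul μ).exp.const_mul (K / μ)).const_add ‖u 0‖).congr_deriv ?_
    field_simp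
  refine image_norm_le_of_norm_deriv_right_le_deriv_boundary
    (fun x hx => (hu x hx).continuousWithinAt)
    (fun x hx => (hu x ⟨hx.1, hx.2.le⟩).mono_of_mem_nhdsWithin ?_) ?_ hderiv
    (fun x hx => hbd x ⟨hx.1, hx.2.le⟩) ht
  · exact mem_of_superset (Icc_mem_nhdsGE hx.2) (Icc_subset_Icc_left hx.1)
  · exact le_add_of_nonneg_right (by positivity)

theorem seqWeight_mul_exp (ρ x : ℝ) (n : ℕ) :
    seqWeight (ρ * Real.exp (-x)) n = seqWeight ρ n * Real.exp (n * x) := by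
  rw [seqWeight, seqWeight, mul_pow, ← Real.exp_nat_mul, ← mul_assoc, mul_inv, ← Real.exp_neg]
  congr 2
  ring

/-- The norm distance of the curves `a` and `b` on `[0,T]` for the weights
`e^{(n+1)νt} seqWeight ρ n` is at most `A`. The radius `ρ e^{-νt}` of the weights shrinks in
time. -/
def IsExpClose (ρ ν T A : ℝ) (a b : ℝ → ℕ → ℂ) : Prop :=
  ∀ t ∈ Icc 0 T, Dominated (ρ * Real.exp (-(ν * t))) (A * Real.exp (ν * t)) (a t - b t)

-- Integrating the weights gains a factor `1 / ((n + 1) ν)`, which pays for the factor `n + 1` lost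
-- in `cubicForm`.
theorem isExpClose_of_isDrivenBy {ρ ν T K A B : ℝ} {a b a' b' : ℝ → ℕ → ℂ} (hν : 0 < ν)
    (hνK : 192 * K ^ 2 ≤ ν) (hρ : ∀ t ∈ Icc 0 T, 1 ≤ ρ * Real.exp (-(ν * t)))
    (ha : ∀ t ∈ Icc 0 T, Dominated (ρ * Real.exp (-(ν * t))) K (a t))
    (hb : ∀ t ∈ Icc 0 T, Dominated (ρ * Real.exp (-(ν * t))) K (b t))
    (hab : IsExpClose ρ ν T A a b) (ha' : IsDrivenBy T a a') (hb' : IsDrivenBy T b b')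
    (h0 : Dominated ρ B (a' 0 - b' 0)) : IsExpClose ρ ν T (B + A / 2) a' b' := by
  intro t ht
  have hA : 0 ≤ A := nonneg_of_mul_nonneg_left (hab t ht).nonneg (Real.exp_pos _)
  have hρ0 : 0 < ρ := pos_of_mul_pos_left (one_pos.trans_le (hρ t ht)) (Real.exp_pos _).le
  have hνt : 0 ≤ ν * t := mul_nonneg hν.le ht.1
  intro n
  have hw := seqWeight_pos hρ0 n
  have hweight (s : ℝ) : Real.exp (ν * s) * seqWeight (ρ * Real.exp (-(ν * s))) n =
      seqWeight ρ n * Real.exp ((n + 1) * ν * s) := by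
    rw [seqWeight_mul_exp, mul_left_comm, ← Real.exp_add]
    ring_nf
  have hgrow := norm_le_exp_of_norm_deriv_le (u := fun s => a' s n - b' s n)
    (K := (n + 1) * (ν / 2 * A * seqWeight ρ n)) (μ := (n + 1) * ν) (by positivity) (by positivity)
    (fun s hs => (ha' s hs n).fun_sub (hb' s hs n)) (fun s hs => by
      calc ‖cubicForm (a s) (a s) (a s) n - cubicForm (b s) (b s) (b s) n‖
          ≤ (n + 1) * (96 * K ^ 2 * (A * Real.exp (ν * s)) *
              seqWeight (ρ * Real.exp (-(ν * s))) n) :=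
            (ha s hs).norm_cubicForm_sub_le (hρ s hs) (hb s hs) (hab s hs) n
        _ = (n + 1) * (96 * K ^ 2 * A * (seqWeight ρ n * Real.exp ((n + 1) * ν * s))) := by
            rw [← hweight]; ring
        _ ≤ (n + 1) * (ν / 2 * A * (seqWeight ρ n * Real.exp ((n + 1) * ν * s))) := by
            gcongr; linarith
        _ = _ := by ring) ht
  have hinit : B * seqWeight ρ n ≤ B * (seqWeight ρ n * Real.exp ((n + 1) * ν * t)) :=
    mul_le_mul_of_nonneg_left (le_mul_of_one_le_right hw.le (Real.one_le_exp (by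
      rw [mul_assoc]; positivity))) h0.nonneg
  calc ‖(a' t - b' t) n‖
      ≤ ‖a' 0 n - b' 0 n‖ + (n + 1) * (ν / 2 * A * seqWeight ρ n) / ((n + 1) * ν) *
          Real.exp ((n + 1) * ν * t) := hgrow
    _ ≤ B * (seqWeight ρ n * Real.exp ((n + 1) * ν * t)) +
          A / 2 * (seqWeight ρ n * Real.exp ((n + 1) * ν * t)) := by
        refine add_le_add ((h0 n).trans hinit) (le_of_eq ?_)
        field_simp
    _ = _ := by rw [← hweight]; ring

theorem Dominated.mono_radius {ρ ρ' κ : ℝ} {a : ℕ → ℂ} (hρ : 0 < ρ) (h : ρ ≤ ρ')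
    (ha : Dominated ρ' κ a) : Dominated ρ κ a := fun n =>
  (ha n).trans (mul_le_mul_of_nonneg_left (seqWeight_antitone hρ h n) ha.nonneg)

theorem tendsto_const_div_two_pow (A : ℝ) : Tendsto (fun k : ℕ => A / 2 ^ k) atTop (𝓝 0) :=
  (tendsto_pow_atTop_atTop_of_one_lt one_lt_two).const_div_atTop A

theorem eq_of_dominated_halving {ρ A : ℝ} {a b : ℕ → ℂ}
    (h : ∀ k : ℕ, Dominated ρ (A / 2 ^ k) (a - b)) : a = b := by
  ext n
  have hlim : Tendsto (fun k : ℕ => A / 2 ^ k * seqWeight ρ n) atTop (𝓝 0) := by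
    simpa only [zero_mul] using (tendsto_const_div_two_pow A).mul_const (seqWeight ρ n)
  exact sub_eq_zero.1 (norm_le_zero_iff.1 (ge_of_tendsto' hlim fun k => h k n))

theorem dominated_zero {ρ : ℝ} : Dominated ρ 0 0 := fun n => by simp

theorem le_mul_exp_mul_exp_neg {ρ ν T t : ℝ} (hρ : 0 ≤ ρ) (hν : 0 ≤ ν) (ht : t ≤ T) :
    ρ ≤ ρ * Real.exp (ν * T) * Real.exp (-(ν * t)) := by
  rw [mul_assoc, ← Real.exp_add]
  refine le_mul_of_one_le_right hρ (Real.one_le_exp ?_)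
  linarith [mul_le_mul_of_nonneg_left ht hν]

theorem Dominated.shrink {ρ ν t κ : ℝ} {a : ℕ → ℂ} (hρ : 0 < ρ) (hν : 0 ≤ ν) (ht : 0 ≤ t)
    (ha : Dominated ρ κ a) : Dominated (ρ * Real.exp (-(ν * t))) κ a :=
  ha.mono_radius (by positivity) (mul_le_of_le_one_right hρ.le
    (Real.exp_le_one_iff.2 (neg_nonpos.2 (mul_nonneg hν ht))))

theorem IsDrivenBy.eqOn_of_dominated_exp {ν T K : ℝ} {a b : ℝ → ℕ → ℂ} (ha : IsDrivenBy T a a)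
    (hb : IsDrivenBy T b b) (hν : 0 < ν) (hνK : 192 * K ^ 2 ≤ ν)
    (haK : ∀ t ∈ Icc 0 T, Dominated (Real.exp (ν * T)) K (a t))
    (hbK : ∀ t ∈ Icc 0 T, Dominated (Real.exp (ν * T)) K (b t)) (h0 : a 0 = b 0) :
    EqOn a b (Icc 0 T) := by
  have hradius (s) (hs : s ∈ Icc 0 T) : 1 ≤ Real.exp (ν * T) * Real.exp (-(ν * s)) := by
    simpa using le_mul_exp_mul_exp_neg zero_le_one hν.le hs.2
  have hhalving (k : ℕ) : IsExpClose (Real.exp (ν * T)) ν T (2 * K / 2 ^ k) a b := by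
    induction k with
    | zero =>
      intro s hs
      refine (((haK s hs).sub (hbK s hs)).shrink (Real.exp_pos _) hν.le hs.1).mono
        (by positivity) ?_
      rw [pow_zero, div_one, ← two_mul]
      exact le_mul_of_one_le_right (mul_nonneg zero_le_two (haK s hs).nonneg)
        (Real.one_le_exp (mul_nonneg hν.le hs.1))
    | succ k ih =>
      have hstep := isExpClose_of_isDrivenBy hν hνK hradius
        (fun s hs => (haK s hs).shrink (Real.exp_pos _) hν.le hs.1)
        (fun s hs => (hbK s hs).shrink (Real.exp_pos _) hν.le hs.1) ih ha hb
        (by rw [h0, sub_self]; exact dominated_zero)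
      rwa [zero_add, div_div, ← pow_succ] at hstep
  intro t ht
  exact eq_of_dominated_halving (ρ := Real.exp (ν * T) * Real.exp (-(ν * t)))
    (A := 2 * K * Real.exp (ν * t)) fun k => by simpa [div_mul_eq_mul_div] using hhalving k t ht

theorem IsDrivenBy.eqOn {ρ T K : ℝ} {a b : ℝ → ℕ → ℂ} (hρ : 1 < ρ) (ha : IsDrivenBy T a a)
    (hb : IsDrivenBy T b b) (haK : ∀ t ∈ Icc 0 T, Dominated ρ K (a t))
    (hbK : ∀ t ∈ Icc 0 T, Dominated ρ K (b t)) (h0 : a 0 = b 0) : EqOn a b (Icc 0 T) := by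
  set ν := 192 * K ^ 2 + 1
  have hνpos : 0 < ν := by positivity
  set σ := Real.log ρ / ν
  have hσpos : 0 < σ := div_pos (Real.log_pos hρ) hνpos
  have hind (k : ℕ) : ∀ t ∈ Icc 0 T, t ≤ k * σ → a t = b t := by
    induction k with
    | zero =>
      intro t ht htk
      rwa [le_antisymm (by simpa using htk) ht.1]
    | succ k ih =>
      intro t ht htk
      rcases le_total t (k * σ) with h | h
      · exact ih t ht h
      have hkσ : 0 ≤ k * σ := by positivity
      have hmem (s) (hs : s ∈ Icc 0 (t - k * σ)) : k * σ + s ∈ Icc 0 T :=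
        ⟨add_nonneg hkσ hs.1, by linarith [hs.2, ht.2]⟩
      have hexp : Real.exp (ν * (t - k * σ)) ≤ ρ := by
        rw [← Real.le_log_iff_exp_le (by linarith), mul_comm, ← le_div_iff₀ hνpos]
        push_cast at htk
        linarith
      have hstep := ((ha.mono ht.2).shift hkσ).eqOn_of_dominated_exp ((hb.mono ht.2).shift hkσ)
        hνpos (by linarith) (fun s hs => (haK _ (hmem s hs)).mono_radius (Real.exp_pos _) hexp)
        (fun s hs => (hbK _ (hmem s hs)).mono_radius (Real.exp_pos _) hexp)
        (by simpa using ih _ ⟨hkσ, h.trans ht.2⟩ le_rfl)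
      simpa using hstep ⟨sub_nonneg.2 h, le_rfl⟩
  intro t ht
  obtain ⟨k, hk⟩ := exists_nat_ge (t / σ)
  exact hind k t ht ((div_le_iff₀ hσpos).1 hk)

/-! ### Picard iteration near a reference solution -/

/-- One step of Picard iteration for the coefficient equation with initial value `c`. -/
noncomputable def picardStep (c : ℕ → ℂ) (a : ℝ → ℕ → ℂ) (t : ℝ) (n : ℕ) : ℂ :=
  c n + ∫ s in (0 : ℝ)..t, cubicForm (a s) (a s) (a s) n

theorem picardStep_at_zero (c : ℕ → ℂ) (a : ℝ → ℕ → ℂ) : picardStep c a 0 = c := by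
  ext n
  simp [picardStep]

theorem isDrivenBy_picardStep {T ρ K : ℝ} {a : ℝ → ℕ → ℂ} (hρ : 1 ≤ ρ)
    (ha : ∀ t ∈ Icc 0 T, Dominated ρ K (a t)) (hcont : ∀ n, ContinuousOn (fun t => a t n) (Icc 0 T))
    (c : ℕ → ℂ) : IsDrivenBy T a (picardStep c a) := fun t ht n => by
  have hvel := continuousOn_cubicForm hρ ha hcont n
  exact ODE.hasDerivWithinAt_picard_Icc (f := fun s _ => cubicForm (a s) (a s) (a s) n)
    (u := univ) (α := fun _ => (0 : ℂ)) ⟨le_rfl, ht.1.trans ht.2⟩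
    (hvel.comp continuousOn_fst fun p hp => hp.1) continuousOn_const (fun _ _ => mem_univ _)
    (c n) ht

theorem IsExpClose.norm_sub_le {ρ ν T A : ℝ} {a b : ℝ → ℕ → ℂ}
    (hρ : ∀ t ∈ Icc 0 T, 1 ≤ ρ * Real.exp (-(ν * t))) (hν : 0 ≤ ν) (hab : IsExpClose ρ ν T A a b)
    (n : ℕ) {t : ℝ} (ht : t ∈ Icc 0 T) : ‖a t n - b t n‖ ≤ A * Real.exp (ν * T) := by
  have hweight : seqWeight (ρ * Real.exp (-(ν * t))) n ≤ 1 :=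
    (seqWeight_le (hρ t ht) n).trans
      (inv_le_one_of_one_le₀ (one_le_pow₀ (le_add_of_nonneg_left n.cast_nonneg)))
  calc ‖a t n - b t n‖ ≤ A * Real.exp (ν * t) * seqWeight (ρ * Real.exp (-(ν * t))) n :=
        hab t ht n
    _ ≤ A * Real.exp (ν * t) := mul_le_of_le_one_right (hab t ht).nonneg hweight
    _ ≤ A * Real.exp (ν * T) :=
        mul_le_mul_of_nonneg_left (Real.exp_le_exp.2 (mul_le_mul_of_nonneg_left ht.2 hν))
          (nonneg_of_mul_nonneg_left (hab t ht).nonneg (Real.exp_pos _))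

theorem continuousOn_of_isExpClose_halving {ρ ν T A : ℝ} {P : ℕ → ℝ → ℕ → ℂ} {h : ℝ → ℕ → ℂ}
    (hρ : ∀ t ∈ Icc 0 T, 1 ≤ ρ * Real.exp (-(ν * t))) (hν : 0 ≤ ν)
    (hPh : ∀ k, IsExpClose ρ ν T (A / 2 ^ k) (P k) h) {n : ℕ}
    (hcont : ∀ k, ContinuousOn (fun t => P k t n) (Icc 0 T)) :
    ContinuousOn (fun t => h t n) (Icc 0 T) := by
  refine TendstoUniformlyOn.continuousOn (F := fun k t => P k t n) (p := atTop) ?_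
    (Frequently.of_forall hcont)
  have hlim : Tendsto (fun k : ℕ => A / 2 ^ k * Real.exp (ν * T)) atTop (𝓝 0) := by
    simpa only [zero_mul] using (tendsto_const_div_two_pow A).mul_const (Real.exp (ν * T))
  rw [Metric.tendstoUniformlyOn_iff]
  intro ε hε
  filter_upwards [hlim.eventually_lt_const hε] with k hk t ht
  rw [dist_comm, dist_eq_norm]
  exact ((hPh k).norm_sub_le hρ hν n ht).trans_lt hk

theorem IsExpClose.exists_limit {ρ ν T A : ℝ} {P : ℕ → ℝ → ℕ → ℂ}
    (hP : ∀ k, IsExpClose ρ ν T (A / 2 / 2 ^ k) (P (k + 1)) (P k)) :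
    ∃ h : ℝ → ℕ → ℂ, ∀ k, IsExpClose ρ ν T (A / 2 ^ k) (P k) h := by
  refine ⟨fun t n => limUnder atTop fun k => P k t n, fun k t ht n => ?_⟩
  have hdist (k : ℕ) : dist (P k t n) (P (k + 1) t n) ≤
      A * Real.exp (ν * t) * seqWeight (ρ * Real.exp (-(ν * t))) n / 2 / 2 ^ k := by
    rw [dist_comm, dist_eq_norm]
    refine (hP k t ht n).trans (le_of_eq ?_)
    ring
  have hle := dist_le_of_le_geometric_two_of_tendsto hdist
    (cauchySeq_of_le_geometric_two hdist).tendsto_limUnder k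
  rw [dist_eq_norm] at hle
  refine hle.trans (le_of_eq ?_)
  ring

theorem IsExpClose.dominated_sub {ρ ν T η : ℝ} {a d : ℝ → ℕ → ℂ} (hρ : 0 < ρ) (hν : 0 ≤ ν)
    (h : IsExpClose ρ ν T (η * Real.exp (-(ν * T))) a d) {t : ℝ} (ht : t ∈ Icc 0 T) :
    Dominated (ρ * Real.exp (-(ν * t))) η (a t - d t) := by
  have hη : 0 ≤ η := nonneg_of_mul_nonneg_left
    (nonneg_of_mul_nonneg_left (h t ht).nonneg (Real.exp_pos _)) (Real.exp_pos _)
  refine (h t ht).mono (by positivity) ?_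
  rw [mul_assoc, ← Real.exp_add]
  refine mul_le_of_le_one_right hη (Real.exp_le_one_iff.2 ?_)
  linarith [mul_le_mul_of_nonneg_left ht.2 hν]

theorem IsExpClose.dominated {ρ ν T D η : ℝ} {a d : ℝ → ℕ → ℂ} (hρ : 0 < ρ) (hν : 0 ≤ ν)
    (hdD : ∀ t ∈ Icc 0 T, Dominated ρ D (d t))
    (h : IsExpClose ρ ν T (η * Real.exp (-(ν * T))) a d) {t : ℝ} (ht : t ∈ Icc 0 T) :
    Dominated (ρ * Real.exp (-(ν * t))) (D + η) (a t) := by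
  have hsum := ((hdD t ht).shrink hρ hν ht.1).add (h.dominated_sub hρ hν ht)
  rwa [add_sub_cancel] at hsum

theorem IsExpClose.refl {ρ ν T A : ℝ} (hρ : 0 < ρ) (hA : 0 ≤ A) (a : ℝ → ℕ → ℂ) :
    IsExpClose ρ ν T A a a := fun t _ => by
  rw [sub_self]
  exact dominated_zero.mono (by positivity) (by positivity)

/-- Picard iteration for the coefficient equation with initial value `c`, starting from `d`. -/
noncomputable def picardIterate (c : ℕ → ℂ) (d : ℝ → ℕ → ℂ) (k : ℕ) : ℝ → ℕ → ℂ :=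
  (picardStep c)^[k] d

theorem picardIterate_succ (c : ℕ → ℂ) (d : ℝ → ℕ → ℂ) (k : ℕ) :
    picardIterate c d (k + 1) = picardStep c (picardIterate c d k) :=
  Function.iterate_succ_apply' _ _ _

section Tube

variable {ρ ν T D η : ℝ} {c : ℕ → ℂ} {d : ℝ → ℕ → ℂ}

theorem isDrivenBy_picardStep_of_isExpClose (hρ : 1 ≤ ρ) (hν : 0 ≤ ν)
    (hdD : ∀ t ∈ Icc 0 T, Dominated (ρ * Real.exp (ν * T)) D (d t)) {a : ℝ → ℕ → ℂ}
    (ha : IsExpClose (ρ * Real.exp (ν * T)) ν T (η * Real.exp (-(ν * T))) a d)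
    (hcont : ∀ n, ContinuousOn (fun t => a t n) (Icc 0 T)) (c : ℕ → ℂ) :
    IsDrivenBy T a (picardStep c a) :=
  isDrivenBy_picardStep hρ (fun _ ht => (ha.dominated (by positivity) hν hdD ht).mono_radius
    (by linarith) (le_mul_exp_mul_exp_neg (by linarith) hν ht.2)) hcont c

theorem isExpClose_of_isDrivenBy_of_tube (hρ : 1 ≤ ρ) (hν : 0 < ν) (hη : 192 * (D + η) ^ 2 ≤ ν)
    (hdD : ∀ t ∈ Icc 0 T, Dominated (ρ * Real.exp (ν * T)) D (d t))
    {A B : ℝ} {a a' b b' : ℝ → ℕ → ℂ}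
    (ha : IsExpClose (ρ * Real.exp (ν * T)) ν T (η * Real.exp (-(ν * T))) a d)
    (hb : IsExpClose (ρ * Real.exp (ν * T)) ν T (η * Real.exp (-(ν * T))) b d)
    (hab : IsExpClose (ρ * Real.exp (ν * T)) ν T A a b)
    (ha' : IsDrivenBy T a a') (hb' : IsDrivenBy T b b')
    (h0 : Dominated (ρ * Real.exp (ν * T)) B (a' 0 - b' 0)) :
    IsExpClose (ρ * Real.exp (ν * T)) ν T (B + A / 2) a' b' :=
  isExpClose_of_isDrivenBy hν hη
    (fun _ ht => hρ.trans (le_mul_exp_mul_exp_neg (by linarith) hν.le ht.2))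
    (fun _ ht => ha.dominated (by positivity) hν.le hdD ht)
    (fun _ ht => hb.dominated (by positivity) hν.le hdD ht) hab ha' hb' h0

theorem picardIterate_mem_tube (hρ : 1 ≤ ρ) (hν : 0 < ν) (hη : 192 * (D + η) ^ 2 ≤ ν)
    (hd : IsDrivenBy T d d) (hdD : ∀ t ∈ Icc 0 T, Dominated (ρ * Real.exp (ν * T)) D (d t))
    (hc : Dominated (ρ * Real.exp (ν * T)) (η * Real.exp (-(ν * T)) / 2) (c - d 0)) (k : ℕ) :
    IsExpClose (ρ * Real.exp (ν * T)) ν T (η * Real.exp (-(ν * T))) (picardIterate c d k) d ∧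
      ∀ n, ContinuousOn (fun t => picardIterate c d k t n) (Icc 0 T) := by
  have hcentre := IsExpClose.refl (ν := ν) (T := T) (ρ := ρ * Real.exp (ν * T))
    (by positivity) (by linarith [hc.nonneg] : 0 ≤ η * Real.exp (-(ν * T))) d
  induction k with
  | zero => exact ⟨hcentre, hd.continuousOn⟩
  | succ k ih =>
    have hstep := isDrivenBy_picardStep_of_isExpClose hρ hν.le hdD ih.1 ih.2 c
    have hclose := isExpClose_of_isDrivenBy_of_tube hρ hν hη hdD ih.1 hcentre ih.1 hstep hd
      (by rwa [picardStep_at_zero])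
    rw [add_halves] at hclose
    rw [picardIterate_succ]
    exact ⟨hclose, hstep.continuousOn⟩

theorem isDrivenBy_picardIterate (hρ : 1 ≤ ρ) (hν : 0 < ν) (hη : 192 * (D + η) ^ 2 ≤ ν)
    (hd : IsDrivenBy T d d) (hdD : ∀ t ∈ Icc 0 T, Dominated (ρ * Real.exp (ν * T)) D (d t))
    (hc : Dominated (ρ * Real.exp (ν * T)) (η * Real.exp (-(ν * T)) / 2) (c - d 0)) (k : ℕ) :
    IsDrivenBy T (picardIterate c d k) (picardIterate c d (k + 1)) := by
  obtain ⟨hclose, hcont⟩ := picardIterate_mem_tube hρ hν hη hd hdD hc k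
  rw [picardIterate_succ]
  exact isDrivenBy_picardStep_of_isExpClose hρ hν.le hdD hclose hcont c

theorem isExpClose_picardIterate_succ (hρ : 1 ≤ ρ) (hν : 0 < ν) (hη : 192 * (D + η) ^ 2 ≤ ν)
    (hd : IsDrivenBy T d d) (hdD : ∀ t ∈ Icc 0 T, Dominated (ρ * Real.exp (ν * T)) D (d t))
    (hc : Dominated (ρ * Real.exp (ν * T)) (η * Real.exp (-(ν * T)) / 2) (c - d 0)) (k : ℕ) :
    IsExpClose (ρ * Real.exp (ν * T)) ν T (η * Real.exp (-(ν * T)) / 2 / 2 ^ k)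
      (picardIterate c d (k + 1)) (picardIterate c d k) := by
  have htube := picardIterate_mem_tube hρ hν hη hd hdD hc
  have hdriven := isDrivenBy_picardIterate hρ hν hη hd hdD hc
  induction k with
  | zero =>
    have hcentre := IsExpClose.refl (ν := ν) (T := T) (ρ := ρ * Real.exp (ν * T))
      (by positivity) le_rfl d
    have hclose := isExpClose_of_isDrivenBy_of_tube hρ hν hη hdD (htube 0).1 (htube 0).1 hcentre
      (hdriven 0) hd (by rwa [picardIterate_succ, picardStep_at_zero])
    rw [zero_div, add_zero] at hclose
    rw [pow_zero, div_one]
    exact hclose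
  | succ k ih =>
    have hclose := isExpClose_of_isDrivenBy_of_tube hρ hν hη hdD (htube (k + 1)).1 (htube k).1 ih
      (hdriven (k + 1)) (hdriven k)
      (by simpa only [picardIterate_succ, picardStep_at_zero, sub_self] using dominated_zero)
    rwa [zero_add, div_div, ← pow_succ] at hclose

theorem exists_isDrivenBy_near (hρ : 1 ≤ ρ) (hT : 0 ≤ T) (hν : 0 < ν)
    (hη : 192 * (D + η) ^ 2 ≤ ν) (hd : IsDrivenBy T d d)
    (hdD : ∀ t ∈ Icc 0 T, Dominated (ρ * Real.exp (ν * T)) D (d t))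
    (hc : Dominated (ρ * Real.exp (ν * T)) (η * Real.exp (-(ν * T)) / 2) (c - d 0)) :
    ∃ h : ℝ → ℕ → ℂ, h 0 = c ∧ IsDrivenBy T h h ∧ ∀ t ∈ Icc 0 T, Dominated ρ η (h t - d t) := by
  have hradius (t) (ht : t ∈ Icc 0 T) : ρ ≤ ρ * Real.exp (ν * T) * Real.exp (-(ν * t)) :=
    le_mul_exp_mul_exp_neg (by linarith) hν.le ht.2
  have htube := picardIterate_mem_tube hρ hν hη hd hdD hc
  obtain ⟨h, hlim⟩ :=
    IsExpClose.exists_limit (isExpClose_picardIterate_succ hρ hν hη hd hdD hc)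
  have hcont (n : ℕ) : ContinuousOn (fun t => h t n) (Icc 0 T) :=
    continuousOn_of_isExpClose_halving (fun t ht => hρ.trans (hradius t ht)) hν.le hlim
      fun k => (htube k).2 n
  have hclose : IsExpClose (ρ * Real.exp (ν * T)) ν T (η * Real.exp (-(ν * T))) h d :=
    fun t ht n => by simpa [picardIterate, norm_sub_rev] using hlim 0 t ht n
  have hstep := isDrivenBy_picardStep_of_isExpClose hρ hν.le hdD hclose hcont c
  have hfix : EqOn (picardStep c h) h (Icc 0 T) := fun t ht => by
    refine eq_of_dominated_halving (ρ := ρ * Real.exp (ν * T) * Real.exp (-(ν * t)))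
      (A := η * Real.exp (-(ν * T)) * Real.exp (ν * t)) fun k => ?_
    have hnext := isExpClose_of_isDrivenBy_of_tube hρ hν hη hdD (htube k).1 hclose (hlim k)
      (isDrivenBy_picardIterate hρ hν hη hd hdD hc k) hstep
      (by simpa only [picardIterate_succ, picardStep_at_zero, sub_self] using dominated_zero) t ht
    have hsum := (hlim (k + 1) t ht).sub hnext
    rw [sub_sub_sub_cancel_left] at hsum
    refine hsum.mono (by positivity) (le_of_eq ?_)
    field_simp
    ring
  refine ⟨h, ?_, hstep.congr (fun _ _ => rfl) fun t ht => (hfix ht).symm, fun t ht => ?_⟩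
  · rw [← hfix ⟨le_rfl, hT⟩, picardStep_at_zero]
  · exact (hclose.dominated_sub (by positivity) hν.le ht).mono_radius (by linarith) (hradius t ht)

end Tube

/-! ### The coefficient equation of a strong solution -/

theorem taylorCoeffZero_mul_add_id_mul_deriv_mul_sub {p h : ℂ → ℂ} {r : ℝ} (hr : 0 < r)
    (hp : DifferentiableOn ℂ p (ball 0 r)) (hh : DifferentiableOn ℂ h (ball 0 r)) (n : ℕ) :
    taylorCoeffZero (fun z => p z * h z - (p z * (z * deriv h z) - z * deriv p z * h z)) n =
      ∑ q ∈ antidiagonal n,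
        (1 + (q.1 : ℂ) - (q.2 : ℂ)) * (taylorCoeffZero p q.1 * taylorCoeffZero h q.2) := by
  have hzp : DifferentiableOn ℂ (fun z => z * deriv p z) (ball 0 r) :=
    differentiableOn_id.fun_mul (hp.deriv isOpen_ball)
  have hzh : DifferentiableOn ℂ (fun z => z * deriv h z) (ball 0 r) :=
    differentiableOn_id.fun_mul (hh.deriv isOpen_ball)
  rw [taylorCoeffZero_sub hr (hp.fun_mul hh) ((hp.fun_mul hzh).fun_sub (hzp.fun_mul hh)),
    taylorCoeffZero_sub hr (hp.fun_mul hzh) (hzp.fun_mul hh), taylorCoeffZero_mul hr hp hh,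
    taylorCoeffZero_mul hr hp hzh, taylorCoeffZero_mul hr hzp hh, ← Finset.sum_sub_distrib,
    ← Finset.sum_sub_distrib]
  refine Finset.sum_congr rfl fun q _ => ?_
  rw [taylorCoeffZero_id_mul_deriv hr hp, taylorCoeffZero_id_mul_deriv hr hh]
  ring

theorem re_neg_mul_inv_eq {z d q : ℂ} (hz : ‖z‖ = 1) (hd : d ≠ 0)
    (h : (z * q * (starRingEnd ℂ) (d * z)).re = -1) :
    (-(q * d⁻¹)).re = (d⁻¹ * (starRingEnd ℂ) d⁻¹).re := by
  have hzz : z * (starRingEnd ℂ) z = 1 := by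
    rw [Complex.mul_conj, Complex.normSq_eq_norm_sq, hz]
    norm_num
  have hnormSq : Complex.normSq d ≠ 0 := by rwa [Ne, Complex.normSq_eq_zero]
  have hquot : z * q * (starRingEnd ℂ) (d * z) = (Complex.normSq d : ℂ) * (q * d⁻¹) := by
    rw [map_mul, ← Complex.mul_conj]
    field_simp
    linear_combination q * (starRingEnd ℂ) d * hzz
  rw [hquot, Complex.re_ofReal_mul] at h
  rw [Complex.mul_conj, map_inv₀, Complex.ofReal_re, Complex.neg_re]
  refine mul_left_cancel₀ hnormSq ?_
  rw [mul_neg, h, neg_neg, mul_inv_cancel₀ hnormSq]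

theorem neg_deriv_div_sq_deriv_eq {f G p : ℂ → ℂ} {z : ℂ} (hp : DifferentiableAt ℂ p z)
    (hf : DifferentiableAt ℂ (deriv f) z) (hf' : deriv f z ≠ 0)
    (hG : G =ᶠ[𝓝 z] fun w => -(w * p w) * deriv f w) :
    -deriv G z / deriv f z ^ 2 = p z * (deriv f z)⁻¹ -
      (p z * (z * deriv (fun w => (deriv f w)⁻¹) z) - z * deriv p z * (deriv f z)⁻¹) := by
  have hGderiv : deriv G z = -(p z + z * deriv p z) * deriv f z - z * p z * deriv (deriv f) z := by
    rw [hG.deriv_eq]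
    refine ((((hasDerivAt_id z).fun_mul hp.hasDerivAt).fun_neg.fun_mul hf.hasDerivAt).congr_deriv
      ?_).deriv
    simp only [id, one_mul]
    ring
  rw [hGderiv, (hf.hasDerivAt.fun_inv hf').deriv]
  field_simp
  ring

/-- The coefficients of the velocity `-G' / f'²` of `h = 1 / f'`.  The function `p = -G / (ξ f')`
has real part `|h|²` on the circle, so it is given by the Schwarz formula, and
`-G' h² = h (ξ p)' - ξ p h'`. -/
theorem taylorCoeffZero_neg_deriv_div_sq_deriv {f G : ℂ → ℂ} {r : ℝ} (hr : 1 < r)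
    (hf : DifferentiableOn ℂ f (ball 0 r)) (hG : DifferentiableOn ℂ G (ball 0 r))
    (hf' : ∀ z ∈ ball (0 : ℂ) r, deriv f z ≠ 0) (hG0 : G 0 = 0)
    (hreal : (deriv G 0 * (deriv f 0)⁻¹).im = 0)
    (heq : ∀ z : ℂ, ‖z‖ = 1 → (G z * (starRingEnd ℂ) (deriv f z * z)).re = -1) :
    taylorCoeffZero (fun z => -deriv G z / deriv f z ^ 2) =
      cubicForm (taylorCoeffZero fun z => (deriv f z)⁻¹) (taylorCoeffZero fun z => (deriv f z)⁻¹)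
        (taylorCoeffZero fun z => (deriv f z)⁻¹) := by
  have hr0 : 0 < r := by linarith
  let h : ℂ → ℂ := fun z => (deriv f z)⁻¹
  let p : ℂ → ℂ := fun z => -(dslope G 0 z * h z)
  have hslope (z : ℂ) : z * dslope G 0 z = G z := by
    simpa [hG0] using sub_smul_dslope G 0 z
  have hf'diff := hf.deriv isOpen_ball
  have hh : DifferentiableOn ℂ h (ball 0 r) := hf'diff.inv hf'
  have hp : DifferentiableOn ℂ p (ball 0 r) :=
    (((Complex.differentiableOn_dslope (ball_mem_nhds _ hr0)).2 hG).fun_mul hh).fun_neg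
  have hschwarz : taylorCoeffZero p = schwarzCoeff (taylorCoeffZero h) (taylorCoeffZero h) := by
    refine taylorCoeffZero_eq_schwarzCoeff hr hp hh hh (fun z hz => ?_) ?_
    · refine re_neg_mul_inv_eq hz (hf' z (by simp [hz, hr])) ?_
      rw [hslope]
      exact heq z hz
    · simpa only [p, h, dslope_same, Complex.neg_im, neg_eq_zero] using hreal
  have hvelocity : EqOn (fun z => p z * h z - (p z * (z * deriv h z) - z * deriv p z * h z))
      (fun z => -deriv G z / deriv f z ^ 2) (ball 0 r) := fun z hz => by
    have hnhds := isOpen_ball.mem_nhds hz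
    refine (neg_deriv_div_sq_deriv_eq (hp.differentiableAt hnhds) (hf'diff.differentiableAt hnhds)
      (hf' z hz) ?_).symm
    filter_upwards [hnhds] with w hw
    have := hf' w hw
    simp only [p, h, ← hslope w]
    field_simp
  ext n
  rw [← taylorCoeffZero_congr hr0 ((hp.fun_mul hh).fun_sub ((hp.fun_mul (differentiableOn_id.fun_mul
    (hh.deriv isOpen_ball))).fun_sub ((differentiableOn_id.fun_mul (hp.deriv isOpen_ball)).fun_mul
    hh))) hvelocity, taylorCoeffZero_mul_add_id_mul_deriv_mul_sub hr0 hp hh, hschwarz, cubicForm]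

/-- The Taylor coefficients of `1 / f'`, at each time. -/
noncomputable def invDerivCoeff (f : ℝ → ℂ → ℂ) (t : ℝ) : ℕ → ℂ :=
  taylorCoeffZero fun z => (deriv (f t) z)⁻¹

theorem invDerivCoeff_at_zero (f : ℝ → ℂ → ℂ) (t : ℝ) :
    invDerivCoeff f t 0 = (deriv (f t) 0)⁻¹ := by
  rw [invDerivCoeff, taylorCoeffZero_zero]

namespace IsStrongSuctionSolution

variable {b T : ℝ} {f : ℝ → ℂ → ℂ}

theorem exists_isC1AnalyticFamily (hf : IsStrongSuctionSolution b f) (hT : 0 ≤ T) (hTb : T < b) :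
    ∃ r > 1, IsC1AnalyticFamily (Icc 0 T) (ball 0 r) f (timeDeriv b f) ∧
      ∀ t ∈ Icc 0 T, ∀ z ∈ ball (0 : ℂ) r, deriv (f t) z ≠ 0 := by
  obtain ⟨r, hr, hspace, htime, hcont, hcont'⟩ := hf.regular T hT hTb
  refine ⟨r, hr, ⟨fun t ht => (hspace t ht).1, fun t ht z hz => ?_, hcont, hcont'⟩,
    fun t ht z hz => ?_⟩
  · exact (htime t ht z hz).hasDerivWithinAt.mono fun s hs => ⟨hs.1, hs.2.trans_lt hTb⟩
  · have hnhds := isOpen_ball.mem_nhds hz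
    exact deriv_ne_zero_of_analyticAt_of_injOn ((hspace t ht).1.analyticAt hnhds) hnhds
      (hspace t ht).2

theorem timeDeriv_at_zero (hf : IsStrongSuctionSolution b f) {t : ℝ} (ht : t ∈ Ico 0 b) :
    timeDeriv b f t 0 = 0 := by
  rw [timeDeriv, derivWithin_congr (fun s hs => hf.map_zero s hs) (hf.map_zero t ht),
    derivWithin_fun_const]
  rfl

theorem deriv_timeDeriv_im (hf : IsStrongSuctionSolution b f) {r t : ℝ} (hT : 0 < T) (hTb : T < b)
    (hr : 0 < r) (hfam : IsC1AnalyticFamily (Icc 0 T) (ball 0 r) f (timeDeriv b f))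
    (ht : t ∈ Icc 0 T) : (deriv (timeDeriv b f t) 0).im = 0 := by
  have hunique := uniqueDiffOn_Icc hT
  have hderiv := Complex.imCLM.hasFDerivAt.comp_hasDerivWithinAt t
    ((hfam.deriv (convex_Icc 0 T) hunique isOpen_ball).hasDerivWithinAt t ht 0 (mem_ball_self hr))
  have him (s) (hs : s ∈ Icc 0 T) : (deriv (f s) 0).im = 0 :=
    (hf.deriv_zero_pos s ⟨hs.1, hs.2.trans_lt hTb⟩).2
  exact (hunique t ht).eq_deriv _ hderiv
    ((hasDerivWithinAt_const t (Icc 0 T) (0 : ℝ)).congr him (him t ht))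

theorem isDrivenBy_invDerivCoeff (hf : IsStrongSuctionSolution b f) (hT : 0 < T) (hTb : T < b) :
    IsDrivenBy T (invDerivCoeff f) (invDerivCoeff f) := fun t ht n => by
  obtain ⟨r, hr, hfam, hne⟩ := hf.exists_isC1AnalyticFamily hT.le hTb
  have hr0 : 0 < r := by linarith
  have htb : t ∈ Ico 0 b := ⟨ht.1, ht.2.trans_lt hTb⟩
  have hunique := uniqueDiffOn_Icc hT
  have hconvex := convex_Icc (𝕜 := ℝ) 0 T
  have hderiv := ((hfam.deriv hconvex hunique isOpen_ball).inv hne).hasDerivWithinAt_taylorCoeffZero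
    hconvex hunique isOpen_ball (mem_ball_self hr0) n ht
  rw [taylorCoeffZero_neg_deriv_div_sq_deriv hr (hfam.differentiableOn t ht)
    (hfam.differentiableOn_velocity hconvex hunique isOpen_ball ht) (hne t ht)
    (hf.timeDeriv_at_zero htb) (by
      rw [Complex.mul_im, Complex.inv_im, hf.deriv_timeDeriv_im hT hTb hr0 hfam ht,
        (hf.deriv_zero_pos t htb).2]
      simp) (hf.equation t htb)] at hderiv
  exact hderiv

theorem exists_dominated_invDerivCoeff (hf : IsStrongSuctionSolution b f) (hT : 0 ≤ T)
    (hTb : T < b) : ∃ ρ > 1, ∃ K, ∀ t ∈ Icc 0 T, Dominated ρ K (invDerivCoeff f t) := by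
  obtain ⟨r, hr, hfam, hne⟩ := hf.exists_isC1AnalyticFamily hT hTb
  obtain ⟨R, hR, hRr⟩ := exists_between hr
  obtain ⟨ρ, hρ, hρR⟩ := exists_between hR
  obtain ⟨A, hA⟩ := exists_dominated_taylorCoeffZero (by linarith) hρR hRr
  have hcont : ContinuousOn (fun p : ℝ × ℂ => (deriv (f p.1) p.2)⁻¹) (Icc 0 T ×ˢ ball 0 r) :=
    (continuousOn_deriv_family isOpen_ball hfam.differentiableOn hfam.continuousOn).inv₀
      fun p hp => hne p.1 hp.1 p.2 hp.2
  obtain ⟨M, hM⟩ :=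
    (isCompact_Icc.prod (isCompact_closedBall (0 : ℂ) R)).exists_bound_of_continuousOn
    (hcont.mono (prod_mono_right (closedBall_subset_ball hRr)))
  exact ⟨ρ, hρ, M * A, fun t ht => hA _ M
    (((hfam.differentiableOn t ht).deriv isOpen_ball).inv (hne t ht))
    fun z hz => hM (t, z) ⟨ht, hz⟩⟩

/-! ### Uniqueness of strong solutions -/

variable {b' : ℝ} {g : ℝ → ℂ → ℂ}

theorem invDerivCoeff_eq (hf : IsStrongSuctionSolution b f) (hg : IsStrongSuctionSolution b' g)
    (h0 : EqOn (f 0) (g 0) (ball 0 1)) (hT : 0 < T) (hTb : T < b) (hTb' : T < b') :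
    invDerivCoeff f T = invDerivCoeff g T := by
  obtain ⟨ρ, hρ, K, hK⟩ := hf.exists_dominated_invDerivCoeff hT.le hTb
  obtain ⟨ρ', hρ', K', hK'⟩ := hg.exists_dominated_invDerivCoeff hT.le hTb'
  have hmin : 1 < min ρ ρ' := lt_min hρ hρ'
  have hmin0 : 0 < min ρ ρ' := by linarith
  obtain ⟨r, hr, hfam, hne⟩ := hf.exists_isC1AnalyticFamily hT.le hTb
  have hinit : invDerivCoeff f 0 = invDerivCoeff g 0 := by
    have hzero : (0 : ℝ) ∈ Icc 0 T := ⟨le_rfl, hT.le⟩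
    refine taylorCoeffZero_congr one_pos ((((hfam.differentiableOn 0 hzero).deriv isOpen_ball).inv
      (hne 0 hzero)).mono (ball_subset_ball hr.le)) fun z hz => ?_
    simp only [h0.deriv isOpen_ball hz]
  exact (hf.isDrivenBy_invDerivCoeff hT hTb).eqOn hmin (hg.isDrivenBy_invDerivCoeff hT hTb')
    (fun t ht => ((hK t ht).mono_radius hmin0 (min_le_left _ _)).mono hmin0 (le_max_left K K'))
    (fun t ht => ((hK' t ht).mono_radius hmin0 (min_le_right _ _)).mono hmin0 (le_max_right K K'))
    hinit ⟨hT.le, le_rfl⟩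

theorem taylorCoeffZero_eq_of_invDerivCoeff_eq (hf : IsStrongSuctionSolution b f)
    (hg : IsStrongSuctionSolution b' g) (hT : 0 ≤ T) (hTb : T < b) (hTb' : T < b')
    (h : invDerivCoeff f T = invDerivCoeff g T) :
    taylorCoeffZero (f T) = taylorCoeffZero (g T) := by
  have hTmem : T ∈ Icc 0 T := ⟨hT, le_rfl⟩
  obtain ⟨r, hr, hfam, hne⟩ := hf.exists_isC1AnalyticFamily hT hTb
  obtain ⟨r', hr', hfam', hne'⟩ := hg.exists_isC1AnalyticFamily hT hTb'
  have hf' := (hfam.differentiableOn T hTmem).deriv isOpen_ball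
  have hg' := (hfam'.differentiableOn T hTmem).deriv isOpen_ball
  have hcoeff : taylorCoeffZero (deriv (f T))⁻¹ = taylorCoeffZero (deriv (g T))⁻¹ := h
  have hderiv : EqOn (deriv (f T)) (deriv (g T)) (ball 0 1) := fun z hz => by
    have hsum := hasSum_taylorCoeffZero (hf'.inv (hne T hTmem)) (ball_subset_ball hr.le hz)
    have hsum' := hasSum_taylorCoeffZero (hg'.inv (hne' T hTmem)) (ball_subset_ball hr'.le hz)
    rw [← hcoeff] at hsum'
    exact inv_injective (hsum.unique hsum')
  ext n
  cases n with
  | zero => simp [hf.map_zero T ⟨hT, hTb⟩, hg.map_zero T ⟨hT, hTb'⟩]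
  | succ n =>
    have hsucc := congrFun
      (taylorCoeffZero_congr one_pos (hf'.mono (ball_subset_ball hr.le)) hderiv) n
    rw [taylorCoeffZero_deriv, taylorCoeffZero_deriv] at hsucc
    exact mul_left_cancel₀ (Nat.cast_add_one_ne_zero n) hsucc

theorem taylorCoeffZero_eq (hf : IsStrongSuctionSolution b f) (hg : IsStrongSuctionSolution b' g)
    (h0 : EqOn (f 0) (g 0) (ball 0 1)) (hT : 0 ≤ T) (hTb : T < b) (hTb' : T < b') :
    taylorCoeffZero (f T) = taylorCoeffZero (g T) := by
  rcases hT.eq_or_lt with rfl | hT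
  · obtain ⟨r, hr, hspace, -⟩ := hf.regular 0 le_rfl hTb
    exact taylorCoeffZero_congr one_pos
      ((hspace 0 ⟨le_rfl, le_rfl⟩).1.mono (ball_subset_ball hr.le)) h0
  · exact hf.taylorCoeffZero_eq_of_invDerivCoeff_eq hg hT.le hTb hTb'
      (hf.invDerivCoeff_eq hg h0 hT hTb hTb')

theorem eqOn_powerSum (hf : IsStrongSuctionSolution b f) (hT : 0 ≤ T) (hTb : T < b) :
    EqOn (f T) (powerSum (taylorCoeffZero (f T))) (closedBall 0 1) := fun z hz => by
  obtain ⟨r, hr, hspace, -⟩ := hf.regular T hT hTb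
  exact (hasSum_taylorCoeffZero (hspace T ⟨hT, le_rfl⟩).1
    (closedBall_subset_ball hr hz)).tsum_eq.symm

theorem eqOn_closedBall (hf : IsStrongSuctionSolution b f) (hg : IsStrongSuctionSolution b' g)
    (h0 : EqOn (f 0) (g 0) (ball 0 1)) (hT : 0 ≤ T) (hTb : T < b) (hTb' : T < b') :
    EqOn (f T) (g T) (closedBall 0 1) := by
  refine (hf.eqOn_powerSum hT hTb).trans ?_
  rw [hf.taylorCoeffZero_eq hg h0 hT hTb hTb']
  exact (hg.eqOn_powerSum hT hTb').symm

end IsStrongSuctionSolution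

/-! ### The blow-up time is finite -/

theorem schwarzCoeff_self_zero (a : ℕ → ℂ) :
    schwarzCoeff a a 0 = ((∑' l, ‖a l‖ ^ 2 : ℝ) : ℂ) := by
  have hcorr : correlation a a 0 = ((∑' l, ‖a l‖ ^ 2 : ℝ) : ℂ) := by
    simp only [correlation, add_zero, Complex.mul_conj, Complex.normSq_eq_norm_sq,
      Complex.ofReal_tsum]
  rw [schwarzCoeff, if_pos rfl, hcorr]
  ring

theorem cubicForm_at_zero (a b c : ℕ → ℂ) : cubicForm a b c 0 = schwarzCoeff b c 0 * a 0 := by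
  simp [cubicForm]

theorem Dominated.sq_norm_zero_le_tsum {ρ κ : ℝ} {a : ℕ → ℂ} (hρ : 1 ≤ ρ) (ha : Dominated ρ κ a) :
    ‖a 0‖ ^ 2 ≤ ∑' l, ‖a l‖ ^ 2 := by
  have hsum : Summable fun l => ‖a l‖ ^ 2 := by
    simpa only [add_zero, norm_mul, RCLike.norm_conj, ← sq] using
      (ha.summable_correlation hρ ha 0).norm
  exact hsum.le_tsum 0 fun _ _ => by positivity

/-- The zeroth coefficient satisfies `x' ≥ x³`, that is `(x⁻²)' ≤ -2`. -/
theorem IsDrivenBy.two_mul_lt_inv_sq {ρ K T : ℝ} {a : ℝ → ℕ → ℂ} (hρ : 1 ≤ ρ) (hT : 0 ≤ T)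
    (ha : IsDrivenBy T a a) (haK : ∀ t ∈ Icc 0 T, Dominated ρ K (a t))
    (hpos : ∀ t ∈ Icc 0 T, 0 < (a t 0).re) : 2 * T < ((a 0 0).re ^ 2)⁻¹ := by
  set x : ℝ → ℝ := fun t => (a t 0).re
  set S : ℝ → ℝ := fun t => ∑' l, ‖a t l‖ ^ 2
  have hx (t) (ht : t ∈ Icc 0 T) : HasDerivWithinAt x (S t * x t) (Icc 0 T) t := by
    have h := Complex.reCLM.hasFDerivAt.comp_hasDerivWithinAt t (ha t ht 0)
    rwa [cubicForm_at_zero, schwarzCoeff_self_zero, Complex.reCLM_apply,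
      Complex.re_ofReal_mul] at h
  have hS (t) (ht : t ∈ Icc 0 T) : x t ^ 2 ≤ S t :=
    (sq_le_sq' (by linarith [neg_le_of_abs_le (Complex.abs_re_le_norm (a t 0))])
      (Complex.re_le_norm _)).trans ((haK t ht).sq_norm_zero_le_tsum hρ)
  have hderiv (t) (ht : t ∈ Icc 0 T) :
      HasDerivWithinAt (fun t => (x t ^ 2)⁻¹) (-2 * S t / x t ^ 2) (Icc 0 T) t := by
    have hxt : x t ≠ 0 := (hpos t ht).ne'
    refine (((hx t ht).fun_pow 2).fun_inv (pow_ne_zero 2 hxt)).congr_deriv ?_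
    field_simp
    ring
  have hbound := image_le_of_deriv_right_le_deriv_boundary (a := 0) (b := T)
    (fun t ht => (hderiv t ht).continuousWithinAt)
    (fun t ht => (hderiv t ⟨ht.1, ht.2.le⟩).mono_of_mem_nhdsWithin
      (Icc_mem_nhdsGE_of_mem ht)) (B := fun t => (x 0 ^ 2)⁻¹ - 2 * t) (B' := fun _ => -2)
    (by simp) (by fun_prop)
    (fun t _ => by
      simpa using (((hasDerivAt_id t).const_mul (2 : ℝ)).const_sub _).hasDerivWithinAt)
    (fun t ht => by
      have := hpos t ⟨ht.1, ht.2.le⟩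
      rw [div_le_iff₀ (by positivity)]
      linarith [hS t ⟨ht.1, ht.2.le⟩])
  have hT_mem : T ∈ Icc 0 T := ⟨hT, le_rfl⟩
  have := hpos T hT_mem
  have : 0 < (x T ^ 2)⁻¹ := by positivity
  linarith [hbound hT_mem]

theorem IsStrongSuctionSolution.blowup_time_le {b : ℝ} {f : ℝ → ℂ → ℂ}
    (hf : IsStrongSuctionSolution b f) : b ≤ (deriv (f 0) 0).re ^ 2 / 2 := by
  by_contra! hcon
  have hb : 0 < b := lt_of_le_of_lt (by positivity) hcon
  have hre (t) (ht : t ∈ Ico 0 b) : (invDerivCoeff f t 0).re = (deriv (f t) 0).re⁻¹ := by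
    rw [invDerivCoeff_at_zero, Complex.inv_re, Complex.normSq_apply, (hf.deriv_zero_pos t ht).2]
    have := (hf.deriv_zero_pos t ht).1.ne'
    field_simp
    ring
  have hpos := (hf.deriv_zero_pos 0 ⟨le_rfl, hb⟩).1
  obtain ⟨ρ, hρ, K, hK⟩ := hf.exists_dominated_invDerivCoeff (by positivity) hcon
  have hlt := (hf.isDrivenBy_invDerivCoeff (by positivity) hcon).two_mul_lt_inv_sq hρ.le
    (by positivity) hK fun t ht => by
      have htb : t ∈ Ico 0 b := ⟨ht.1, ht.2.trans_lt hcon⟩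
      rw [hre t htb]
      exact inv_pos.2 (hf.deriv_zero_pos t htb).1
  rw [hre 0 ⟨le_rfl, hb⟩, inv_pow, inv_inv] at hlt
  linarith

/-! ### The maximal strong solution -/

theorem Ico_zero_eventuallyEq {b b' t : ℝ} (htb : t < b) (htb' : t < b') :
    Ico 0 b =ᶠ[𝓝 t] Ico 0 b' := by
  filter_upwards [Iio_mem_nhds htb, Iio_mem_nhds htb'] with s hs hs'
  exact propext ⟨fun h => ⟨h.1, hs'⟩, fun h => ⟨h.1, hs⟩⟩

theorem timeDeriv_congr_time {b b' t : ℝ} (htb : t < b) (htb' : t < b') (f : ℝ → ℂ → ℂ) :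
    timeDeriv b f t = timeDeriv b' f t :=
  funext fun _ => derivWithin_congr_set (Ico_zero_eventuallyEq htb htb')

theorem isStrongSuctionSolution_of_forall_lt {b : ℝ} {f : ℝ → ℂ → ℂ}
    (h : ∀ T, 0 ≤ T → T < b → ∃ b' > T, IsStrongSuctionSolution b' f) :
    IsStrongSuctionSolution b f where
  regular T hT hTb := by
    obtain ⟨b', hTb', hf⟩ := h T hT hTb
    obtain ⟨r, hr, hspace, htime, hcont, hcont'⟩ := hf.regular T hT hTb'
    refine ⟨r, hr, hspace, fun t ht ξ hξ => ?_, hcont, hcont'.congr fun p hp => ?_⟩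
    · exact (differentiableWithinAt_congr_set
        (Ico_zero_eventuallyEq (ht.2.trans_lt hTb') (ht.2.trans_lt hTb))).1 (htime t ht ξ hξ)
    · exact congrFun (timeDeriv_congr_time (hp.1.2.trans_lt hTb) (hp.1.2.trans_lt hTb') f) p.2
  map_zero t ht := by
    obtain ⟨b', htb', hf⟩ := h t ht.1 ht.2
    exact hf.map_zero t ⟨ht.1, htb'⟩
  deriv_zero_pos t ht := by
    obtain ⟨b', htb', hf⟩ := h t ht.1 ht.2
    exact hf.deriv_zero_pos t ⟨ht.1, htb'⟩
  equation t ht ξ hξ := by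
    obtain ⟨b', htb', hf⟩ := h t ht.1 ht.2
    rw [timeDeriv_congr_time ht.2 htb']
    exact hf.equation t ⟨ht.1, htb'⟩ ξ hξ

theorem IsC1AnalyticFamily.congr {K : Set ℝ} {U : Set ℂ} {f g G : ℝ → ℂ → ℂ}
    (hg : IsC1AnalyticFamily K U g G) (h : ∀ t ∈ K, EqOn (f t) (g t) U) :
    IsC1AnalyticFamily K U f G where
  differentiableOn t ht := (hg.differentiableOn t ht).congr (h t ht)
  hasDerivWithinAt t ht z hz :=
    (hg.hasDerivWithinAt t ht z hz).congr (fun s hs => h s hs hz) (h t ht hz)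
  continuousOn := hg.continuousOn.congr fun p hp => h p.1 hp.1 hp.2
  continuousOn_velocity := hg.continuousOn_velocity

theorem IsC1AnalyticFamily.mono {K L : Set ℝ} {U V : Set ℂ} {f G : ℝ → ℂ → ℂ}
    (h : IsC1AnalyticFamily L V f G) (hKL : K ⊆ L) (hUV : U ⊆ V) :
    IsC1AnalyticFamily K U f G where
  differentiableOn t ht := (h.differentiableOn t (hKL ht)).mono hUV
  hasDerivWithinAt t ht z hz := (h.hasDerivWithinAt t (hKL ht) z (hUV hz)).mono hKL
  continuousOn := h.continuousOn.mono (prod_mono hKL hUV)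
  continuousOn_velocity := h.continuousOn_velocity.mono (prod_mono hKL hUV)

theorem IsC1AnalyticFamily.timeDeriv_eq {b T t : ℝ} {U : Set ℂ} {f G : ℝ → ℂ → ℂ}
    (h : IsC1AnalyticFamily (Icc 0 T) U f G) (hTb : T < b) (ht : 0 ≤ t) (htT : t < T) {ξ : ℂ}
    (hξ : ξ ∈ U) : HasDerivWithinAt (fun s => f s ξ) (timeDeriv b f t ξ) (Ico 0 b) t ∧
      timeDeriv b f t ξ = G t ξ := by
  have hderiv : HasDerivWithinAt (fun s => f s ξ) (G t ξ) (Ico 0 b) t := by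
    refine (h.hasDerivWithinAt t ⟨ht, htT.le⟩ ξ hξ).mono_of_mem_nhdsWithin ?_
    filter_upwards [self_mem_nhdsWithin, nhdsWithin_le_nhds (Iio_mem_nhds htT)] with s hs hsT
    exact ⟨hs.1, le_of_lt hsT⟩
  exact ⟨hderiv.differentiableWithinAt.hasDerivWithinAt,
    hderiv.derivWithin (uniqueDiffOn_Ico 0 b t ⟨ht, htT.trans hTb⟩)⟩

theorem isStrongSuctionSolution_of_isC1AnalyticFamily {b : ℝ} {f G : ℝ → ℂ → ℂ}
    (hfam : ∀ T, 0 ≤ T → T < b → ∃ r > 1, IsC1AnalyticFamily (Icc 0 T) (ball 0 r) f G ∧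
      ∀ t ∈ Icc 0 T, InjOn (f t) (ball 0 r))
    (hzero : ∀ t ∈ Ico 0 b, f t 0 = 0)
    (hpos : ∀ t ∈ Ico 0 b, 0 < (deriv (f t) 0).re ∧ (deriv (f t) 0).im = 0)
    (heq : ∀ t ∈ Ico 0 b, ∀ ξ : ℂ, ‖ξ‖ = 1 →
      (G t ξ * (starRingEnd ℂ) (deriv (f t) ξ * ξ)).re = -1) : IsStrongSuctionSolution b f := by
  refine ⟨fun T hT hTb => ?_, hzero, hpos, fun t ht ξ hξ => ?_⟩
  · obtain ⟨T', hTT', hT'b⟩ := exists_between hTb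
    obtain ⟨r, hr, h, hinj⟩ := hfam T' (hT.trans hTT'.le) hT'b
    have hI : Icc 0 T ⊆ Icc 0 T' := Icc_subset_Icc_right hTT'.le
    refine ⟨r, hr, fun t ht => ⟨h.differentiableOn t (hI ht), hinj t (hI ht)⟩, fun t ht ξ hξ => ?_,
      h.continuousOn.mono (prod_mono_left hI),
      (h.continuousOn_velocity.mono (prod_mono_left hI)).congr fun p hp => ?_⟩
    · exact (h.timeDeriv_eq hT'b ht.1 (ht.2.trans_lt hTT') hξ).1.differentiableWithinAt
    · exact (h.timeDeriv_eq hT'b hp.1.1 (hp.1.2.trans_lt hTT') hp.2).2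
  · obtain ⟨T', htT', hT'b⟩ := exists_between ht.2
    obtain ⟨r, hr, h, -⟩ := hfam T' (ht.1.trans htT'.le) hT'b
    rw [(h.timeDeriv_eq hT'b ht.1 htT' (by simpa [hξ] using hr)).2]
    exact heq t ht ξ hξ

namespace IsStrongSuctionSolution

variable {b : ℝ} {f g : ℝ → ℂ → ℂ}

theorem congr_powerSum (hg : IsStrongSuctionSolution b g)
    (hfg : ∀ t ∈ Ico 0 b, f t = powerSum (taylorCoeffZero (g t))) :
    IsStrongSuctionSolution b f := by
  have heqOn {r t : ℝ} (ht : t ∈ Ico 0 b) (hd : DifferentiableOn ℂ (g t) (ball 0 r)) :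
      EqOn (f t) (g t) (ball 0 r) := fun z hz => by
    rw [hfg t ht]
    exact (hasSum_taylorCoeffZero hd hz).tsum_eq
  have hderiv (t) (ht : t ∈ Ico 0 b) : EqOn (deriv (f t)) (deriv (g t)) (closedBall 0 1) := by
    obtain ⟨r, hr, hspace, -⟩ := hg.regular t ht.1 ht.2
    exact ((heqOn ht (hspace t ⟨ht.1, le_rfl⟩).1).deriv isOpen_ball).mono
      (closedBall_subset_ball hr)
  refine isStrongSuctionSolution_of_isC1AnalyticFamily (G := timeDeriv b g) (fun T hT hTb => ?_)
    (fun t ht => ?_) (fun t ht => ?_) fun t ht ξ hξ => ?_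
  · obtain ⟨r, hr, hfam, -⟩ := hg.exists_isC1AnalyticFamily hT hTb
    obtain ⟨r', hr', hspace, -⟩ := hg.regular T hT hTb
    have hmem (t) (ht : t ∈ Icc 0 T) : t ∈ Ico 0 b := ⟨ht.1, ht.2.trans_lt hTb⟩
    have hsub : ball (0 : ℂ) (min r r') ⊆ ball 0 r := ball_subset_ball (min_le_left r r')
    have hsub' : ball (0 : ℂ) (min r r') ⊆ ball 0 r' := ball_subset_ball (min_le_right r r')
    refine ⟨min r r', lt_min hr hr', (hfam.mono Subset.rfl hsub).congr fun t ht =>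
      (heqOn (hmem t ht) (hfam.differentiableOn t ht)).mono hsub, fun t ht => ?_⟩
    exact ((hspace t ht).2.mono hsub').congr
      ((heqOn (hmem t ht) (hspace t ht).1).mono hsub').symm
  · rw [hfg t ht, ← hg.eqOn_powerSum ht.1 ht.2 (by simp)]
    exact hg.map_zero t ht
  · rw [hderiv t ht (by simp)]
    exact hg.deriv_zero_pos t ht
  · rw [hderiv t ht (by simp [hξ])]
    exact hg.equation t ht ξ hξ

end IsStrongSuctionSolution

theorem exists_eq_powerSum_of_isStrongSuctionSolution (f₀ : ℂ → ℂ) : ∃ f : ℝ → ℂ → ℂ,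
    ∀ b g, IsStrongSuctionSolution b g → EqOn (g 0) f₀ (ball 0 1) →
      ∀ t ∈ Ico 0 b, f t = powerSum (taylorCoeffZero (g t)) := by
  have h (t : ℝ) : ∃ F : ℂ → ℂ, ∀ b g, IsStrongSuctionSolution b g →
      EqOn (g 0) f₀ (ball 0 1) → t ∈ Ico 0 b → F = powerSum (taylorCoeffZero (g t)) := by
    by_cases hex : ∃ b g, IsStrongSuctionSolution b g ∧ EqOn (g 0) f₀ (ball 0 1) ∧ t ∈ Ico 0 b
    · obtain ⟨b, g, hg, hgi, ht⟩ := hex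
      refine ⟨powerSum (taylorCoeffZero (g t)), fun b' g' hg' hgi' ht' => ?_⟩
      rw [hg.taylorCoeffZero_eq hg' (hgi.trans hgi'.symm) ht.1 ht.2 ht'.2]
    · exact ⟨0, fun b g hg hgi ht => (hex ⟨b, g, hg, hgi, ht⟩).elim⟩
  choose f hf using h
  exact ⟨f, fun b g hg hgi t ht => hf t b g hg hgi ht⟩

theorem IsStrongSuctionSolution.blowup_time_le_of_initial {b : ℝ} {f₀ : ℂ → ℂ} {g : ℝ → ℂ → ℂ}
    (hg : IsStrongSuctionSolution b g) (hgi : EqOn (g 0) f₀ (ball 0 1)) :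
    b ≤ (deriv f₀ 0).re ^ 2 / 2 := by
  rw [← (hgi.eventuallyEq_of_mem (ball_mem_nhds 0 one_pos)).deriv_eq]
  exact hg.blowup_time_le

theorem IsStrongSuctionSolution.exists_isMaximalStrongSuctionSolution {b₀ : ℝ} {f₀ : ℂ → ℂ}
    {g₀ : ℝ → ℂ → ℂ} (hb₀ : 0 < b₀) (hg₀ : IsStrongSuctionSolution b₀ g₀)
    (hi : EqOn (g₀ 0) f₀ (ball 0 1)) :
    ∃ b f, b₀ ≤ b ∧ IsMaximalStrongSuctionSolution f₀ b f := by
  obtain ⟨f, hf⟩ := exists_eq_powerSum_of_isStrongSuctionSolution f₀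
  let S : Set ℝ := {b | ∃ g, IsStrongSuctionSolution b g ∧ EqOn (g 0) f₀ (ball 0 1)}
  have hS : BddAbove S :=
    ⟨(deriv f₀ 0).re ^ 2 / 2, fun b ⟨_, hg, hgi⟩ => hg.blowup_time_le_of_initial hgi⟩
  have hmem : b₀ ∈ S := ⟨g₀, hg₀, hi⟩
  have hclosed {b g} (hg : IsStrongSuctionSolution b g) (hgi : EqOn (g 0) f₀ (ball 0 1)) (t)
      (ht : t ∈ Ico 0 b) : EqOn (g t) (f t) (closedBall 0 1) := by
    rw [hf b g hg hgi t ht]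
    exact hg.eqOn_powerSum ht.1 ht.2
  refine ⟨sSup S, f, le_csSup hS hmem, isStrongSuctionSolution_of_forall_lt fun T _ hT => ?_, ?_,
    fun b g hg hgi => ⟨le_csSup hS ⟨g, hg, hgi⟩, hclosed hg hgi⟩⟩
  · obtain ⟨b, ⟨g, hg, hgi⟩, hTb⟩ := exists_lt_of_lt_csSup ⟨b₀, hmem⟩ hT
    exact ⟨b, hTb, hg.congr_powerSum fun t ht => hf b g hg hgi t ht⟩
  · exact ((hclosed hg₀ hi 0 ⟨le_rfl, hb₀⟩).mono ball_subset_closedBall).symm.trans hi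

/-! ### Strong solutions from the coefficients of `1 / f'` -/

theorem hasDerivWithinAt_tsum_of_convex {E : Type*} [NormedAddCommGroup E] [NormedSpace ℝ E]
    [CompleteSpace E] {f f' : ℕ → ℝ → E} {u : ℕ → ℝ} {S : Set ℝ} {t : ℝ}
    (hS : Convex ℝ S) (hu : Summable u)
    (hf : ∀ n, ∀ s ∈ S, HasDerivWithinAt (f n) (f' n s) S s) (hf' : ∀ n, ∀ s ∈ S, ‖f' n s‖ ≤ u n)
    (hsum : ∀ s ∈ S, Summable fun n => f n s) (ht : t ∈ S) :
    HasDerivWithinAt (fun s => ∑' n, f n s) (∑' n, f' n t) S t := by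
  rw [hasDerivWithinAt_iff_tendsto_slope]
  have hslope : EqOn (slope (fun s => ∑' n, f n s) t) (fun s => ∑' n, slope (f n) t s) (S \ {t}) :=
    fun s hs => by
      simp only [slope_def_module]
      rw [← (hsum s hs.1).tsum_sub (hsum t ht), tsum_const_smul'']
  refine Tendsto.congr' (eventually_mem_nhdsWithin.mono fun s hs => (hslope hs).symm)
    (tendsto_tsum_of_dominated_convergence hu
      (fun n => hasDerivWithinAt_iff_tendsto_slope.1 (hf n t ht)) ?_)
  filter_upwards [eventually_mem_nhdsWithin] with s hs n
  have hlip := hS.norm_image_sub_le_of_norm_hasDerivWithin_le (hf n) (hf' n) ht hs.1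
  rw [slope_def_module, norm_smul, norm_inv]
  exact inv_mul_le_of_le_mul₀ (norm_nonneg _) ((norm_nonneg _).trans (hf' n t ht))
    (hlip.trans_eq (mul_comm _ _))

theorem hasDerivAt_integral_family {G : ℝ → ℂ → ℂ} {U : Set ℂ} {T t : ℝ} (hU : IsOpen U)
    (hd : ∀ s ∈ Icc 0 T, DifferentiableOn ℂ (G s) U)
    (hc : ContinuousOn (fun p : ℝ × ℂ => G p.1 p.2) (Icc 0 T ×ˢ U)) (ht : t ∈ Icc 0 T)
    {z : ℂ} (hz : z ∈ U) :
    HasDerivAt (fun z => ∫ s in (0 : ℝ)..t, G s z) (∫ s in (0 : ℝ)..t, deriv (G s) z) z := by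
  obtain ⟨ε, hε, hsub⟩ := Metric.nhds_basis_closedBall.mem_iff.1 (hU.mem_nhds hz)
  have hc' := continuousOn_deriv_family hU hd hc
  have hI : uIcc 0 t ⊆ Icc 0 T := by rw [uIcc_of_le ht.1]; exact Icc_subset_Icc_right ht.2
  have slice {F : ℝ → ℂ → ℂ} (hF : ContinuousOn (fun p : ℝ × ℂ => F p.1 p.2) (Icc 0 T ×ˢ U))
      (x) (hx : x ∈ U) : ContinuousOn (fun s => F s x) (uIcc 0 t) :=
    hF.comp (f := fun s => (s, x)) (by fun_prop) fun s hs => ⟨hI hs, hx⟩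
  obtain ⟨M, hM⟩ := (isCompact_Icc.prod (isCompact_closedBall z ε)).exists_bound_of_continuousOn
    (hc'.mono (prod_mono_right hsub))
  refine (intervalIntegral.hasDerivAt_integral_of_dominated_loc_of_deriv_le
    (F := fun x s => G s x) (F' := fun x s => deriv (G s) x) (bound := fun _ => M)
    (closedBall_mem_nhds z hε) ?_ (slice hc z hz).intervalIntegrable ?_ ?_ ?_ ?_).2
  · filter_upwards [hU.mem_nhds hz] with x hx
    exact ((slice hc x hx).mono uIoc_subset_uIcc).aestronglyMeasurable measurableSet_uIoc
  · exact ((slice hc' z hz).mono uIoc_subset_uIcc).aestronglyMeasurable measurableSet_uIoc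
  · exact Eventually.of_forall fun s hs x hx => hM (s, x) ⟨hI (uIoc_subset_uIcc hs), hx⟩
  · exact intervalIntegrable_const
  · exact Eventually.of_forall fun s hs x hx => ((hd s (hI (uIoc_subset_uIcc hs))).differentiableAt
      (hU.mem_nhds (hsub hx))).hasDerivAt

theorem hasDerivWithinAt_integral_of_continuousOn {E : Type*} [NormedAddCommGroup E]
    [NormedSpace ℝ E] [CompleteSpace E] {g : ℝ → E} {T t : ℝ}
    (hg : ContinuousOn g (Icc 0 T)) (ht : t ∈ Icc 0 T) :
    HasDerivWithinAt (fun t => ∫ s in (0 : ℝ)..t, g s) (g t) (Icc 0 T) t := by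
  have : Fact (t ∈ Icc 0 T) := ⟨ht⟩
  exact intervalIntegral.integral_hasDerivWithinAt_right
    (hg.mono (by rw [uIcc_of_le ht.1]; exact Icc_subset_Icc_right ht.2)).intervalIntegrable
    (hg.stronglyMeasurableAtFilter_nhdsWithin measurableSet_Icc t) (hg t ht)

-- The Noshiro–Warschawski criterion: along a segment, `f` increases in the direction of the
-- segment.
theorem injOn_of_re_deriv_pos {f f' : ℂ → ℂ} {s : Set ℂ} (hs : Convex ℝ s)
    (hd : ∀ z ∈ s, HasDerivAt f (f' z) z) (hpos : ∀ z ∈ s, 0 < (f' z).re) : InjOn f s := by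
  intro x hx y hy hxy
  by_contra hne
  have hne' : y - x ≠ 0 := sub_ne_zero.2 (Ne.symm hne)
  have hseg (u : ℝ) (hu : u ∈ Icc (0 : ℝ) 1) : x + (u : ℂ) * (y - x) ∈ s := by
    simpa only [Complex.real_smul] using hs.add_smul_sub_mem hx hy hu
  let φ : ℝ → ℝ := fun u => (f (x + (u : ℂ) * (y - x)) / (y - x)).re
  have hφ (u : ℝ) (hu : u ∈ Icc (0 : ℝ) 1) :
      HasDerivAt φ (f' (x + (u : ℂ) * (y - x))).re u := by
    have hline : HasDerivAt (fun u : ℝ => x + (u : ℂ) * (y - x)) (y - x) u := by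
      simpa using (Complex.ofRealCLM.hasDerivAt.mul_const (y - x)).const_add x
    have hquot := ((hd _ (hseg u hu)).comp u hline).div_const (y - x)
    rw [mul_div_cancel_right₀ _ hne'] at hquot
    exact Complex.reCLM.hasFDerivAt.comp_hasDerivAt u hquot
  obtain ⟨u, hu, hslope⟩ := exists_hasDerivAt_eq_slope φ _ one_pos
    (fun u hu => (hφ u hu).continuousAt.continuousWithinAt) (fun u hu => hφ u ⟨hu.1.le, hu.2.le⟩)
  have hφ01 : φ 1 = φ 0 := by simp [φ, hxy]
  have hu_pos := hpos _ (hseg u ⟨hu.1.le, hu.2.le⟩)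
  rw [hslope, hφ01, sub_self, zero_div] at hu_pos
  exact hu_pos.false

theorem continuousOn_powerSum_family {X : Type*} [TopologicalSpace X] {S : Set X}
    {a : X → ℕ → ℂ} {ρ K : ℝ} (hρ : 0 < ρ) (ha : ∀ t ∈ S, Dominated ρ K (a t))
    (hc : ∀ n, ContinuousOn (fun t => a t n) S) :
    ContinuousOn (fun p : X × ℂ => powerSum (a p.1) p.2) (S ×ˢ closedBall 0 ρ) :=
  continuousOn_tsum (fun n => ((hc n).comp continuousOn_fst fun _ hp => hp.1).mul (by fun_prop))
    (summable_inv_succ_sq.mul_left K)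
    fun n p hp => (ha p.1 hp.1).norm_term_le hρ (mem_closedBall_zero_iff.1 hp.2) n

theorem Dominated.powerSum_cubicForm {ρ κ κ' κ'' : ℝ} {a b c : ℕ → ℂ} (hρ : 1 ≤ ρ)
    (ha : Dominated ρ κ a) (hb : Dominated ρ κ' b) (hc : Dominated ρ κ'' c) {z : ℂ}
    (hz : z ∈ ball (0 : ℂ) ρ) :
    powerSum (cubicForm a b c) z = powerSum (schwarzCoeff b c) z * powerSum a z -
      (powerSum (schwarzCoeff b c) z * (z * deriv (powerSum a) z) -
        z * deriv (powerSum (schwarzCoeff b c)) z * powerSum a z) := by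
  have hρ0 : 0 < ρ := by linarith
  have hs := dominated_schwarzCoeff hρ hb hc
  have da := ha.differentiableOn_powerSum hρ0
  have ds := hs.differentiableOn_powerSum hρ0
  have did : DifferentiableOn ℂ (fun z : ℂ => z) (ball 0 ρ) := differentiableOn_id
  have hcoeff := taylorCoeffZero_mul_add_id_mul_deriv_mul_sub hρ0 ds da
  simp only [hs.taylorCoeffZero_powerSum hρ0, ha.taylorCoeffZero_powerSum hρ0] at hcoeff
  rw [powerSum, ← (hasSum_taylorCoeffZero ((ds.fun_mul da).fun_sub
    ((ds.fun_mul (did.fun_mul (da.deriv isOpen_ball))).fun_sub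
      ((did.fun_mul (ds.deriv isOpen_ball)).fun_mul da))) hz).tsum_eq]
  exact tsum_congr fun n => by rw [hcoeff, cubicForm]

/-- The velocity `f_t = -ξ p / h` of a solution of the suction equation for which `h = 1 / f'` has
the coefficients `a`; here `p` is analytic with `Re p = |h|²` on the unit circle. -/
noncomputable def suctionVelocity (a : ℕ → ℂ) (z : ℂ) : ℂ :=
  -(z * powerSum (schwarzCoeff a a) z * (powerSum a z)⁻¹)

theorem Dominated.hasDerivAt_suctionVelocity {ρ K : ℝ} {a : ℕ → ℂ} (hρ : 1 ≤ ρ)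
    (ha : Dominated ρ K a) {z : ℂ} (hz : z ∈ ball (0 : ℂ) ρ) (h0 : powerSum a z ≠ 0) :
    HasDerivAt (suctionVelocity a) (-powerSum (cubicForm a a a) z / powerSum a z ^ 2) z := by
  have hρ0 : 0 < ρ := by linarith
  have hn := isOpen_ball.mem_nhds hz
  have da := ((ha.differentiableOn_powerSum hρ0).differentiableAt hn).hasDerivAt
  have ds := (((dominated_schwarzCoeff hρ ha ha).differentiableOn_powerSum
    hρ0).differentiableAt hn).hasDerivAt
  refine ((((hasDerivAt_id' z).fun_mul ds).fun_mul (da.fun_inv h0)).fun_neg).congr_deriv ?_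
  rw [ha.powerSum_cubicForm hρ ha ha hz]
  field_simp
  ring

theorem Dominated.re_suctionVelocity_mul_conj {ρ K : ℝ} {a : ℕ → ℂ} (hρ : 1 ≤ ρ)
    (ha : Dominated ρ K a) {z : ℂ} (hz : ‖z‖ = 1) (h0 : powerSum a z ≠ 0) :
    (suctionVelocity a z * (starRingEnd ℂ) ((powerSum a z)⁻¹ * z)).re = -1 := by
  have hre := re_powerSum_schwarzCoeff hρ ha ha hz
  rw [Complex.mul_conj, Complex.ofReal_re] at hre
  have hzz : z * (starRingEnd ℂ) z = 1 := by
    rw [Complex.mul_conj, Complex.normSq_eq_norm_sq, hz, one_pow, Complex.ofReal_one]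
  have hprod : suctionVelocity a z * (starRingEnd ℂ) ((powerSum a z)⁻¹ * z) =
      -(powerSum (schwarzCoeff a a) z * ((Complex.normSq (powerSum a z))⁻¹ : ℝ)) := by
    rw [← map_inv₀, ← Complex.mul_conj, map_mul, suctionVelocity]
    linear_combination (-(powerSum (schwarzCoeff a a) z * (powerSum a z)⁻¹ *
      (starRingEnd ℂ) (powerSum a z)⁻¹)) * hzz
  rw [hprod, Complex.neg_re, Complex.re_mul_ofReal, hre,
    mul_inv_cancel₀ (Complex.normSq_pos.2 h0).ne']

/-- The map with initial value `g` moved by the velocity `suctionVelocity (h t)`. -/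
noncomputable def suctionFlow (g : ℂ → ℂ) (h : ℝ → ℕ → ℂ) (t : ℝ) (z : ℂ) : ℂ :=
  g z + ∫ s in (0 : ℝ)..t, suctionVelocity (h s) z

theorem suctionFlow_zero (g : ℂ → ℂ) (h : ℝ → ℕ → ℂ) : suctionFlow g h 0 = g := by
  ext z
  simp [suctionFlow]

theorem suctionFlow_apply_zero (g : ℂ → ℂ) (h : ℝ → ℕ → ℂ) (t : ℝ) :
    suctionFlow g h t 0 = g 0 := by
  simp [suctionFlow, suctionVelocity]

namespace IsDrivenBy

variable {ρ T K : ℝ} {h : ℝ → ℕ → ℂ} {g : ℂ → ℂ}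

theorem hasDerivWithinAt_powerSum (hh : IsDrivenBy T h h) (hρ : 1 ≤ ρ)
    (hK : ∀ t ∈ Icc 0 T, Dominated ρ K (h t)) {t : ℝ} (ht : t ∈ Icc 0 T) {z : ℂ}
    (hz : z ∈ ball (0 : ℂ) ρ) :
    HasDerivWithinAt (fun s => powerSum (h s) z) (powerSum (cubicForm (h t) (h t) (h t)) z)
      (Icc 0 T) t := by
  have hρ0 : 0 < ρ := by linarith
  have hK0 : 0 ≤ K := (hK t ht).nonneg
  have hzρ : ‖z‖ < ρ := mem_ball_zero_iff.1 hz
  have hbd (n : ℕ) (s : ℝ) (hs : s ∈ Icc 0 T) :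
      ‖cubicForm (h s) (h s) (h s) n * z ^ n‖ ≤ 32 * K ^ 3 * (‖z‖ / ρ) ^ n := by
    rw [norm_mul, norm_pow]
    have hform := (hK s hs).norm_cubicForm_le hρ (hK s hs) (hK s hs) n
    calc ‖cubicForm (h s) (h s) (h s) n‖ * ‖z‖ ^ n
        ≤ ((n : ℝ) + 1) * (32 * K * K * K * seqWeight ρ n) * ‖z‖ ^ n := by gcongr
      _ = 32 * K ^ 3 * (‖z‖ / ρ) ^ n * ((n : ℝ) + 1)⁻¹ := by
          rw [seqWeight, div_pow]; field_simp
      _ ≤ 32 * K ^ 3 * (‖z‖ / ρ) ^ n :=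
          mul_le_of_le_one_right (by positivity)
            (inv_le_one_of_one_le₀ (le_add_of_nonneg_left n.cast_nonneg))
  have hgeom : Summable fun n : ℕ => 32 * K ^ 3 * (‖z‖ / ρ) ^ n :=
    (summable_geometric_of_lt_one (by positivity) ((div_lt_one hρ0).2 hzρ)).mul_left _
  exact hasDerivWithinAt_tsum_of_convex (convex_Icc 0 T) hgeom
    (fun n s hs => (hh s hs n).mul_const (z ^ n)) hbd
    (fun s hs => ((hK s hs).hasSum hρ0 hzρ.le).summable) ht

theorem im_apply_zero (hh : IsDrivenBy T h h) (hρ : 1 ≤ ρ)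
    (hK : ∀ t ∈ Icc 0 T, Dominated ρ K (h t)) (h0 : (h 0 0).im = 0) {t : ℝ} (ht : t ∈ Icc 0 T) :
    (h t 0).im = 0 := by
  refine eq_zero_of_abs_deriv_le_mul_abs_self_of_eq_zero_right (f := fun t => (h t 0).im)
    (f' := fun t => (cubicForm (h t) (h t) (h t) 0).im) (K := 4 * K * K) (a := 0) (b := T)
    (Complex.continuous_im.comp_continuousOn (hh.continuousOn 0)) (fun s hs => ?_) h0
    (fun s hs => ?_) t ht
  · exact (Complex.imCLM.hasFDerivAt.comp_hasDerivWithinAt s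
      (hh s (Ico_subset_Icc_self hs) 0)).mono_of_mem_nhdsWithin (Icc_mem_nhdsGE_of_mem hs)
  · have hs' := hK s (Ico_subset_Icc_self hs)
    have hcoeff := dominated_schwarzCoeff hρ hs' hs' 0
    rw [seqWeight_zero, mul_one] at hcoeff
    rw [cubicForm_at_zero, Complex.mul_im, schwarzCoeff_zero_im, zero_mul, add_zero, norm_mul]
    exact mul_le_mul_of_nonneg_right ((Complex.abs_re_le_norm _).trans hcoeff) (norm_nonneg _)

theorem continuousOn_suctionVelocity (hh : IsDrivenBy T h h) (hρ : 1 ≤ ρ)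
    (hK : ∀ t ∈ Icc 0 T, Dominated ρ K (h t))
    (hne : ∀ t ∈ Icc 0 T, ∀ z ∈ closedBall (0 : ℂ) ρ, powerSum (h t) z ≠ 0) :
    ContinuousOn (fun p : ℝ × ℂ => suctionVelocity (h p.1) p.2) (Icc 0 T ×ˢ closedBall 0 ρ) := by
  have hρ0 : 0 < ρ := by linarith
  have hpow := continuousOn_powerSum_family hρ0 hK hh.continuousOn
  have hschwarz := continuousOn_powerSum_family hρ0
    (fun t ht => dominated_schwarzCoeff hρ (hK t ht) (hK t ht))
    (continuousOn_schwarzCoeff hρ hK hh.continuousOn)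
  exact ((continuousOn_snd.mul hschwarz).mul (hpow.inv₀ fun p hp => hne p.1 hp.1 p.2 hp.2)).neg

theorem integral_deriv_suctionVelocity (hh : IsDrivenBy T h h) (hρ : 1 ≤ ρ)
    (hK : ∀ t ∈ Icc 0 T, Dominated ρ K (h t))
    (hne : ∀ t ∈ Icc 0 T, ∀ z ∈ closedBall (0 : ℂ) ρ, powerSum (h t) z ≠ 0) {t : ℝ}
    (ht : t ∈ Icc 0 T) {z : ℂ} (hz : z ∈ ball (0 : ℂ) ρ) :
    ∫ s in (0 : ℝ)..t, deriv (suctionVelocity (h s)) z =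
      (powerSum (h t) z)⁻¹ - (powerSum (h 0) z)⁻¹ := by
  have hsub : uIcc 0 t ⊆ Icc 0 T := by rw [uIcc_of_le ht.1]; exact Icc_subset_Icc_right ht.2
  have hvel (s) (hs : s ∈ Icc 0 T) (w) (hw : w ∈ ball (0 : ℂ) ρ) :=
    (hK s hs).hasDerivAt_suctionVelocity hρ hw (hne s hs w (ball_subset_closedBall hw))
  have hd (s) (hs : s ∈ Icc 0 T) : HasDerivWithinAt (fun s => (powerSum (h s) z)⁻¹)
      (deriv (suctionVelocity (h s)) z) (Icc 0 T) s := by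
    rw [(hvel s hs z hz).deriv]
    exact (hh.hasDerivWithinAt_powerSum hρ hK hs hz).fun_inv
      (hne s hs z (ball_subset_closedBall hz))
  have hc : ContinuousOn (fun s => deriv (suctionVelocity (h s)) z) (Icc 0 T) :=
    (continuousOn_deriv_family isOpen_ball
      (fun s hs w hw => (hvel s hs w hw).differentiableAt.differentiableWithinAt)
      ((hh.continuousOn_suctionVelocity hρ hK hne).mono
        (prod_mono_right ball_subset_closedBall))).comp
      (f := fun s => (s, z)) (by fun_prop) fun s hs => ⟨hs, hz⟩
  refine intervalIntegral.integral_eq_sub_of_hasDeriv_right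
    (f := fun s => (powerSum (h s) z)⁻¹)
    (fun s hs => ((hd s (hsub hs)).mono hsub).continuousWithinAt) (fun s hs => ?_)
    (hc.mono hsub).intervalIntegrable
  rw [min_eq_left ht.1, max_eq_right ht.1] at hs
  have hs' : s ∈ Ico 0 T := ⟨hs.1.le, hs.2.trans_le ht.2⟩
  exact ((hd s (Ico_subset_Icc_self hs')).mono_of_mem_nhdsWithin
    (Icc_mem_nhdsGE_of_mem hs')).mono Ioi_subset_Ici_self

theorem hasDerivAt_suctionFlow (hh : IsDrivenBy T h h) (hρ : 1 ≤ ρ)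
    (hK : ∀ t ∈ Icc 0 T, Dominated ρ K (h t))
    (hne : ∀ t ∈ Icc 0 T, ∀ z ∈ closedBall (0 : ℂ) ρ, powerSum (h t) z ≠ 0)
    (hg : ∀ z ∈ ball (0 : ℂ) ρ, HasDerivAt g (powerSum (h 0) z)⁻¹ z) {t : ℝ} (ht : t ∈ Icc 0 T)
    {z : ℂ} (hz : z ∈ ball (0 : ℂ) ρ) :
    HasDerivAt (suctionFlow g h t) (powerSum (h t) z)⁻¹ z := by
  have hint := hasDerivAt_integral_family isOpen_ball
    (fun s hs w hw => ((hK s hs).hasDerivAt_suctionVelocity hρ hw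
      (hne s hs w (ball_subset_closedBall hw))).differentiableAt.differentiableWithinAt)
    ((hh.continuousOn_suctionVelocity hρ hK hne).mono (prod_mono_right ball_subset_closedBall))
    ht hz
  refine ((hg z hz).fun_add hint).congr_deriv ?_
  rw [hh.integral_deriv_suctionVelocity hρ hK hne ht hz, add_sub_cancel]

theorem isC1AnalyticFamily_suctionFlow (hh : IsDrivenBy T h h) (hρ : 1 ≤ ρ)
    (hK : ∀ t ∈ Icc 0 T, Dominated ρ K (h t))
    (hne : ∀ t ∈ Icc 0 T, ∀ z ∈ closedBall (0 : ℂ) ρ, powerSum (h t) z ≠ 0)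
    (hg : ∀ z ∈ ball (0 : ℂ) ρ, HasDerivAt g (powerSum (h 0) z)⁻¹ z) :
    IsC1AnalyticFamily (Icc 0 T) (ball 0 ρ) (suctionFlow g h)
      fun t => suctionVelocity (h t) := by
  have hspace (t) (ht : t ∈ Icc 0 T) (z) (hz : z ∈ ball (0 : ℂ) ρ) :=
    (hh.hasDerivAt_suctionFlow hρ hK hne hg ht hz).differentiableAt
  have hvel := hh.continuousOn_suctionVelocity hρ hK hne
  have htime (t) (ht : t ∈ Icc 0 T) (z) (hz : z ∈ ball (0 : ℂ) ρ) :
      HasDerivWithinAt (fun s => suctionFlow g h s z) (suctionVelocity (h t) z) (Icc 0 T) t :=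
    (hasDerivWithinAt_integral_of_continuousOn (g := fun s => suctionVelocity (h s) z)
      (hvel.comp (f := fun s => (s, z)) (by fun_prop)
        fun s hs => ⟨hs, ball_subset_closedBall hz⟩) ht).const_add _
  refine ⟨fun t ht z hz => (hspace t ht z hz).differentiableWithinAt, htime, ?_,
    hvel.mono (prod_mono_right ball_subset_closedBall)⟩
  obtain ⟨M, hM⟩ :=
    (isCompact_Icc.prod (isCompact_closedBall (0 : ℂ) ρ)).exists_bound_of_continuousOn hvel
  refine continuousOn_prod_of_continuousOn_lipschitzOnWith _ M.toNNReal
    (fun t ht z hz => (hspace t ht z hz).continuousAt.continuousWithinAt)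
    fun z hz => (convex_Icc 0 T).lipschitzOnWith_of_nnnorm_hasDerivWithin_le
      (fun t ht => htime t ht z hz) fun t ht => ?_
  rw [← NNReal.coe_le_coe, coe_nnnorm]
  exact (hM (t, z) ⟨ht, ball_subset_closedBall hz⟩).trans (Real.le_coe_toNNReal M)

theorem isStrongSuctionSolution_suctionFlow (hh : IsDrivenBy T h h) (hρ : 1 < ρ)
    (hK : ∀ t ∈ Icc 0 T, Dominated ρ K (h t))
    (hpos : ∀ t ∈ Icc 0 T, ∀ z ∈ closedBall (0 : ℂ) ρ, 0 < (powerSum (h t) z).re)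
    (him : (h 0 0).im = 0) (hg : ∀ z ∈ ball (0 : ℂ) ρ, HasDerivAt g (powerSum (h 0) z)⁻¹ z)
    (hg0 : g 0 = 0) : IsStrongSuctionSolution T (suctionFlow g h) := by
  have hne (t) (ht : t ∈ Icc 0 T) (z) (hz : z ∈ closedBall (0 : ℂ) ρ) : powerSum (h t) z ≠ 0 :=
    fun h0 => by simpa [h0] using hpos t ht z hz
  have hinv_pos (t) (ht : t ∈ Icc 0 T) (z) (hz : z ∈ ball (0 : ℂ) ρ) :
      0 < ((powerSum (h t) z)⁻¹).re := by
    rw [Complex.inv_re]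
    exact div_pos (hpos t ht z (ball_subset_closedBall hz))
      (Complex.normSq_pos.2 (hne t ht z (ball_subset_closedBall hz)))
  have hfam := hh.isC1AnalyticFamily_suctionFlow hρ.le hK hne hg
  have hspace (t) (ht : t ∈ Icc 0 T) (z) (hz : z ∈ ball (0 : ℂ) ρ) :=
    hh.hasDerivAt_suctionFlow hρ.le hK hne hg ht hz
  refine isStrongSuctionSolution_of_isC1AnalyticFamily (G := fun t => suctionVelocity (h t))
    (fun T' _ hT' => ⟨ρ, hρ, hfam.mono (Icc_subset_Icc_right hT'.le) Subset.rfl, fun t ht => ?_⟩)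
    (fun t _ => by rw [suctionFlow_apply_zero, hg0]) (fun t ht => ?_) fun t ht z hz => ?_
  · have ht' := Icc_subset_Icc_right hT'.le ht
    exact injOn_of_re_deriv_pos (convex_ball 0 ρ) (hspace t ht') (hinv_pos t ht')
  · have ht' := Ico_subset_Icc_self ht
    have h0 : (0 : ℂ) ∈ ball 0 ρ := mem_ball_self (by linarith)
    rw [(hspace t ht' 0 h0).deriv]
    refine ⟨hinv_pos t ht' 0 h0, ?_⟩
    rw [powerSum_at_zero, Complex.inv_im, hh.im_apply_zero hρ.le hK him ht', neg_zero, zero_div]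
  · have ht' := Ico_subset_Icc_self ht
    have hzρ : z ∈ ball (0 : ℂ) ρ := by rwa [mem_ball_zero_iff, hz]
    rw [(hspace t ht' z hzρ).deriv]
    exact (hK t ht').re_suctionVelocity_mul_conj hρ.le hz
      (hne t ht' z (ball_subset_closedBall hzρ))

end IsDrivenBy

/-! ### The shrinking disk -/

theorem hasDerivAt_sqrt_one_sub_two_mul {t : ℝ} (ht : t < 1 / 2) :
    HasDerivAt (fun s => Real.sqrt (1 - 2 * s)) (-(Real.sqrt (1 - 2 * t))⁻¹) t := by
  have hlin : HasDerivAt (fun s : ℝ => 1 - 2 * s) (-2) t := by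
    simpa using ((hasDerivAt_id t).const_mul (2 : ℝ)).const_sub 1
  refine (hlin.sqrt (by linarith)).congr_deriv ?_
  have : Real.sqrt (1 - 2 * t) ≠ 0 := (Real.sqrt_pos.2 (by linarith)).ne'
  field_simp

theorem hasDerivAt_diskSolution (t : ℝ) (ξ : ℂ) :
    HasDerivAt (diskSolution t) (Real.sqrt (1 - 2 * t) : ℝ) ξ :=
  ((hasDerivAt_id ξ).const_mul _).congr_deriv (mul_one _)

theorem isC1AnalyticFamily_diskSolution {T : ℝ} (hT : T < 1 / 2) (U : Set ℂ) :
    IsC1AnalyticFamily (Icc 0 T) U diskSolution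
      fun t ξ => ((-(Real.sqrt (1 - 2 * t))⁻¹ : ℝ) : ℂ) * ξ where
  differentiableOn t _ ξ _ :=
    (hasDerivAt_diskSolution t ξ).differentiableAt.differentiableWithinAt
  hasDerivWithinAt t ht ξ _ :=
    ((hasDerivAt_sqrt_one_sub_two_mul
      (ht.2.trans_lt hT)).ofReal_comp.mul_const ξ).hasDerivWithinAt
  continuousOn := by
    unfold diskSolution
    fun_prop
  continuousOn_velocity := by
    refine (Complex.continuous_ofReal.comp_continuousOn ?_).mul continuousOn_snd
    refine (ContinuousOn.inv₀ (by fun_prop) fun p hp => ?_).neg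
    exact (Real.sqrt_pos.2 (by linarith [hp.1.2])).ne'

theorem isStrongSuctionSolution_diskSolution :
    IsStrongSuctionSolution (1 / 2) diskSolution := by
  have hpos {t : ℝ} (ht : t < 1 / 2) : 0 < Real.sqrt (1 - 2 * t) :=
    Real.sqrt_pos.2 (by linarith)
  refine isStrongSuctionSolution_of_isC1AnalyticFamily
    (fun T _ hTb => ⟨2, one_lt_two, isC1AnalyticFamily_diskSolution hTb _, fun t ht => ?_⟩)
    (fun t _ => mul_zero _) (fun t ht => ?_) fun t ht ξ hξ => ?_
  · exact (mul_right_injective₀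
      (Complex.ofReal_ne_zero.2 (hpos (ht.2.trans_lt hTb)).ne')).injOn
  · rw [(hasDerivAt_diskSolution t 0).deriv]
    exact ⟨hpos ht.2, Complex.ofReal_im _⟩
  · have hξξ : ξ * (starRingEnd ℂ) ξ = 1 := by
      rw [Complex.mul_conj, Complex.normSq_eq_norm_sq, hξ]
      norm_num
    rw [(hasDerivAt_diskSolution t ξ).deriv, map_mul, Complex.conj_ofReal, mul_mul_mul_comm, hξξ,
      mul_one, ← Complex.ofReal_mul, neg_mul, inv_mul_cancel₀ (hpos ht.2).ne', Complex.ofReal_re]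

theorem isMaximalStrongSuctionSolution_diskSolution :
    IsMaximalStrongSuctionSolution (fun ξ => ξ) (1 / 2) diskSolution := by
  have hi : EqOn (diskSolution 0) (fun ξ => ξ) (ball 0 1) := fun z _ => by simp [diskSolution]
  refine ⟨isStrongSuctionSolution_diskSolution, hi, fun b' g hg hgi => ?_⟩
  have hb' : b' ≤ 1 / 2 := by simpa using hg.blowup_time_le_of_initial hgi
  exact ⟨hb', fun t ht => hg.eqOn_closedBall isStrongSuctionSolution_diskSolution
    (hgi.trans hi.symm) ht.1 ht.2 (ht.2.trans_le hb')⟩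

theorem volume_ball_eq_ofReal {r : ℝ} (hr : 0 ≤ r) (z : ℂ) :
    volume (ball z r) = ENNReal.ofReal (r ^ 2 * Real.pi) := by
  rw [Complex.volume_ball, ENNReal.ofReal_mul (by positivity), ENNReal.ofReal_pow hr,
    ← NNReal.coe_real_pi, ENNReal.ofReal_coe_nnreal]

open scoped Pointwise in
theorem volume_diskSolution_image {t : ℝ} (ht : t ≤ 1 / 2) :
    volume (diskSolution t '' ball (0 : ℂ) 1) = ENNReal.ofReal (Real.pi * (1 - 2 * t)) := by
  have himage : diskSolution t '' ball (0 : ℂ) 1 = Real.sqrt (1 - 2 * t) • ball (0 : ℂ) 1 := by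
    ext z
    simp [diskSolution, mem_smul_set]
  have h0 : 0 ≤ 1 - 2 * t := by linarith
  rw [himage, Measure.addHaar_smul, Complex.finrank_real_complex, Real.sq_sqrt h0,
    abs_of_nonneg h0, volume_ball_eq_ofReal zero_le_one, one_pow, one_mul,
    ← ENNReal.ofReal_mul h0, mul_comm]

/-! ### Coefficients near those of the shrinking disk -/

theorem dominated_single {ρ : ℝ} (hρ : 0 < ρ) (x : ℂ) : Dominated ρ ‖x‖ (Pi.single 0 x) :=
  fun n => by
    rcases n.eq_zero_or_pos with rfl | hn
    · rw [Pi.single_eq_same, seqWeight_zero, mul_one]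
    · rw [Pi.single_eq_of_ne hn.ne', norm_zero]
      exact mul_nonneg (norm_nonneg x) (seqWeight_pos hρ n).le

theorem correlation_single (x y : ℂ) (k : ℕ) :
    correlation (Pi.single 0 x) (Pi.single 0 y) k =
      if k = 0 then x * (starRingEnd ℂ) y else 0 := by
  rw [correlation, tsum_eq_single 0 fun l hl => by rw [Pi.single_eq_of_ne hl, map_zero, mul_zero],
    zero_add, Pi.single_eq_same, Pi.single_apply, ite_mul, zero_mul]

theorem schwarzCoeff_single (x : ℂ) (k : ℕ) :
    schwarzCoeff (Pi.single 0 x) (Pi.single 0 x) k = if k = 0 then (‖x‖ : ℂ) ^ 2 else 0 := by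
  rw [schwarzCoeff, correlation_single, Complex.mul_conj']
  split_ifs <;> ring

theorem cubicForm_single (x : ℂ) :
    cubicForm (Pi.single 0 x) (Pi.single 0 x) (Pi.single 0 x) =
      Pi.single 0 ((‖x‖ : ℂ) ^ 2 * x) := by
  ext n
  rcases n.eq_zero_or_pos with rfl | hn
  · rw [cubicForm_at_zero, schwarzCoeff_single, if_pos rfl, Pi.single_eq_same, Pi.single_eq_same]
  · rw [Pi.single_eq_of_ne hn.ne', cubicForm]
    refine Finset.sum_eq_zero fun p hp => ?_
    rw [schwarzCoeff_single]
    split_ifs with hp0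
    · have hp1 : p.2 ≠ 0 := by have := mem_antidiagonal.1 hp; omega
      rw [Pi.single_eq_of_ne hp1, mul_zero, mul_zero]
    · rw [zero_mul, mul_zero]

/-- The coefficient `1 / f₁'` of the shrinking disk `f₁`. -/
noncomputable def diskInv (t : ℝ) : ℝ := (Real.sqrt (1 - 2 * t))⁻¹

theorem hasDerivAt_diskInv {t : ℝ} (ht : t < 1 / 2) : HasDerivAt diskInv (diskInv t ^ 3) t := by
  have hpos : 0 < Real.sqrt (1 - 2 * t) := Real.sqrt_pos.2 (by linarith)
  refine ((hasDerivAt_sqrt_one_sub_two_mul ht).fun_inv hpos.ne').congr_deriv ?_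
  rw [diskInv]
  field_simp

theorem diskInv_zero : diskInv 0 = 1 := by simp [diskInv]

theorem diskInv_mono {s t : ℝ} (hst : s ≤ t) (ht : t < 1 / 2) : diskInv s ≤ diskInv t := by
  unfold diskInv
  have : 0 < Real.sqrt (1 - 2 * t) := Real.sqrt_pos.2 (by linarith)
  gcongr

theorem one_le_diskInv {t : ℝ} (h0 : 0 ≤ t) (ht : t < 1 / 2) : 1 ≤ diskInv t :=
  diskInv_zero ▸ diskInv_mono h0 ht

theorem isDrivenBy_diskInv {T : ℝ} (hT : T < 1 / 2) :
    IsDrivenBy T (fun t => Pi.single 0 (diskInv t : ℂ)) fun t => Pi.single 0 (diskInv t : ℂ) := by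
  intro t ht n
  have htT : t < 1 / 2 := ht.2.trans_lt hT
  simp only [cubicForm_single, Complex.norm_real,
    Real.norm_of_nonneg (zero_le_one.trans (one_le_diskInv ht.1 htT))]
  rcases n.eq_zero_or_pos with rfl | hn
  · simp only [Pi.single_eq_same]
    refine (hasDerivAt_diskInv htT).ofReal_comp.hasDerivWithinAt.congr_deriv ?_
    push_cast
    ring
  · simp only [Pi.single_eq_of_ne hn.ne']
    exact hasDerivWithinAt_const ..

theorem exists_isDrivenBy_near_diskInv {T : ℝ} (hT0 : 0 ≤ T) (hT : T < 1 / 2) :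
    ∃ ρ ≥ 2, ∃ η > 0, ∀ c : ℕ → ℂ, Dominated ρ η (c - Pi.single 0 1) →
      ∃ h : ℝ → ℕ → ℂ, h 0 = c ∧ IsDrivenBy T h h ∧
        ∀ t ∈ Icc 0 T, Dominated 2 (1 / 8) (h t - Pi.single 0 (diskInv t : ℂ)) := by
  have hD := one_le_diskInv hT0 hT
  set ν := 192 * (diskInv T + 1 / 8) ^ 2
  have hν : 0 < ν := by positivity
  refine ⟨2 * Real.exp (ν * T),
    le_mul_of_one_le_right zero_le_two (Real.one_le_exp (by positivity)),
    1 / 8 * Real.exp (-(ν * T)) / 2, by positivity, fun c hc => ?_⟩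
  refine exists_isDrivenBy_near one_le_two hT0 hν le_rfl (isDrivenBy_diskInv hT) (fun t ht => ?_)
    (by rwa [diskInv_zero, Complex.ofReal_one])
  have hnorm : ‖(diskInv t : ℂ)‖ ≤ diskInv T := by
    rw [Complex.norm_real,
      Real.norm_of_nonneg (zero_le_one.trans (one_le_diskInv ht.1 (ht.2.trans_lt hT)))]
    exact diskInv_mono ht.2 hT
  exact (dominated_single (by positivity) _).mono (by positivity) hnorm

theorem hasSum_single_zero_mul_pow (x z : ℂ) :
    HasSum (fun n => (Pi.single 0 x : ℕ → ℂ) n * z ^ n) x := by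
  have h := hasSum_single (f := fun n => (Pi.single 0 x : ℕ → ℂ) n * z ^ n) 0
    fun n hn => by rw [Pi.single_eq_of_ne hn, zero_mul]
  rwa [Pi.single_eq_same, pow_zero, mul_one] at h

theorem Dominated.norm_powerSum_sub_le {ρ κ : ℝ} {a : ℕ → ℂ} {x : ℂ} (hρ : 0 < ρ)
    (h : Dominated ρ κ (a - Pi.single 0 x)) {z : ℂ} (hz : ‖z‖ ≤ ρ) :
    ‖powerSum a z - x‖ ≤ 2 * κ := by
  have hsum := (h.hasSum hρ hz).add (hasSum_single_zero_mul_pow x z)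
  simp only [Pi.sub_apply, ← add_mul, sub_add_cancel] at hsum
  rw [powerSum, hsum.tsum_eq, add_sub_cancel_right]
  exact h.norm_powerSum_le hρ hz

theorem re_pos_of_norm_sub_ofReal_lt {w : ℂ} {x : ℝ} (h : ‖w - x‖ < x) : 0 < w.re := by
  have hre := (Complex.abs_re_le_norm (w - x)).trans_lt h
  rw [Complex.sub_re, Complex.ofReal_re, abs_lt] at hre
  linarith

theorem norm_inv_le_of_norm_sub_le {w : ℂ} {x : ℝ} (hx : 0 < x) (h : ‖w - x‖ ≤ x / 2) :
    ‖w⁻¹‖ ≤ 2 * x⁻¹ := by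
  have hdiff := norm_sub_norm_le (x : ℂ) w
  rw [norm_sub_rev, Complex.norm_real, Real.norm_of_nonneg hx.le] at hdiff
  rw [norm_inv, ← inv_inv (2 : ℝ), ← mul_inv]
  exact inv_anti₀ (by positivity) (by linarith)

/-! ### Initial functions close to the identity -/

theorem norm_mul_succ_mul_pow_le {ρ : ℝ} (a : ℕ → ℂ) {z : ℂ} (hz : ‖z‖ ≤ ρ) (n : ℕ) :
    ‖a n * (((n : ℂ) + 1) * z ^ n)‖ ≤ ((n : ℝ) + 1) * ‖a n‖ * ρ ^ n := by
  rw [norm_mul, norm_mul, norm_pow, ← Nat.cast_succ, Complex.norm_natCast, Nat.cast_succ,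
    mul_left_comm, ← mul_assoc]
  gcongr

theorem hasDerivAt_tsum_mul_pow_succ {ρ : ℝ} {a : ℕ → ℂ}
    (ha : Summable fun n : ℕ => ((n : ℝ) + 1) * ‖a n‖ * ρ ^ n) {z : ℂ} (hz : z ∈ ball 0 ρ) :
    HasDerivAt (fun z => ∑' n, a n * z ^ (n + 1)) (∑' n, a n * (((n : ℂ) + 1) * z ^ n)) z := by
  refine hasDerivAt_tsum_of_isPreconnected ha isOpen_ball (convex_ball (0 : ℂ) ρ).isPreconnected
    (fun n y _ => ?_)
    (fun n y hy => norm_mul_succ_mul_pow_le a (mem_ball_zero_iff.1 hy).le n)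
    (mem_ball_self (pos_of_mem_ball hz)) ?_ hz
  · simpa only [Nat.cast_succ, Nat.add_sub_cancel]
      using (hasDerivAt_pow (n + 1) y).const_mul (a n)
  · simp only [zero_pow (Nat.succ_ne_zero _), mul_zero, summable_zero]

theorem IsCloseToDisk.sum_succ_mul_norm_taylorCoeffZero_le {ρ δ : ℝ} {f₀ : ℂ → ℂ} (hρ : 1 ≤ ρ)
    (hδ : 0 ≤ δ) (h : IsCloseToDisk ρ δ f₀) (s : Finset ℕ) :
    ∑ n ∈ s, ((n : ℝ) + 1) * ‖taylorCoeffZero (fun ξ => f₀ ξ - ξ) (n + 1)‖ * ρ ^ n ≤ δ := by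
  set a : ℕ → ℂ := fun n => taylorCoeffZero (fun ξ => f₀ ξ - ξ) (n + 1)
  set w : ℕ → ℝ := fun n =>
    ‖a n‖ * ρ ^ (n + 1) * ((n + 1 : ℕ) : ℝ) ^ ((1 / 2 : ℝ) + ((1 : ℕ) : ℝ))
  have hsucc (n : ℕ) : (n : ℝ) + 1 ≤ ((n + 1 : ℕ) : ℝ) ^ ((1 / 2 : ℝ) + ((1 : ℕ) : ℝ)) := by
    rw [← Nat.cast_succ]
    refine Real.self_le_rpow_of_one_le ?_ (by norm_num)
    exact_mod_cast Nat.succ_le_succ n.zero_le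
  have hle (n : ℕ) : ((n : ℝ) + 1) * ‖a n‖ * ρ ^ n ≤ w n :=
    calc ((n : ℝ) + 1) * ‖a n‖ * ρ ^ n = ‖a n‖ * ρ ^ n * ((n : ℝ) + 1) := by ring
      _ ≤ w n := by
        have hpow : ρ ^ n ≤ ρ ^ (n + 1) := pow_le_pow_right₀ hρ n.le_succ
        exact mul_le_mul (mul_le_mul_of_nonneg_left hpow (norm_nonneg _)) (hsucc n)
          (by positivity) (by positivity)
  have hw (n : ℕ) : 0 ≤ w n := by positivity
  refine (Finset.sum_le_sum fun n _ => hle n).trans ?_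
  rw [← ENNReal.ofReal_le_ofReal_iff hδ, ENNReal.ofReal_sum_of_nonneg fun n _ => hw n]
  exact (ENNReal.sum_le_tsum s).trans h.close.le

theorem IsCloseToDisk.exists_extension {ρ δ : ℝ} {f₀ : ℂ → ℂ} (hρ : 1 ≤ ρ) (hδ : 0 ≤ δ)
    (h : IsCloseToDisk ρ δ f₀) : ∃ g : ℂ → ℂ, DifferentiableOn ℂ g (ball 0 ρ) ∧
      EqOn g f₀ (ball 0 1) ∧ ∀ z ∈ ball (0 : ℂ) ρ, ‖deriv g z - 1‖ ≤ δ := by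
  set v : ℂ → ℂ := fun ξ => f₀ ξ - ξ with hv
  set a : ℕ → ℂ := fun n => taylorCoeffZero v (n + 1)
  have hsum := h.sum_succ_mul_norm_taylorCoeffZero_le hρ hδ
  have hnonneg (n : ℕ) : 0 ≤ ((n : ℝ) + 1) * ‖a n‖ * ρ ^ n := by positivity
  have hsummable := summable_of_sum_le hnonneg hsum
  have hderiv : ∀ z ∈ ball (0 : ℂ) ρ, HasDerivAt (fun z => z + ∑' n, a n * z ^ (n + 1))
      (1 + ∑' n, a n * (((n : ℂ) + 1) * z ^ n)) z := fun z hz =>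
    (hasDerivAt_id' z).fun_add (hasDerivAt_tsum_mul_pow_succ hsummable hz)
  refine ⟨fun z => z + ∑' n, a n * z ^ (n + 1),
    fun z hz => (hderiv z hz).differentiableAt.differentiableWithinAt, fun z hz => ?_,
    fun z hz => ?_⟩
  · have hseries := hasSum_taylorCoeffZero (f := v) (h.analytic.fun_sub differentiableOn_id) hz
    rw [← hasSum_nat_add_iff' 1, Finset.sum_range_one, taylorCoeffZero_zero, pow_zero, mul_one]
      at hseries
    change z + ∑' n, taylorCoeffZero v (n + 1) * z ^ (n + 1) = f₀ z
    rw [hseries.tsum_eq]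
    simp only [hv, h.map_zero]
    ring
  · rw [(hderiv z hz).deriv, add_sub_cancel_left]
    exact (tsum_of_norm_bounded hsummable.hasSum fun n =>
      norm_mul_succ_mul_pow_le a (mem_ball_zero_iff.1 hz).le n).trans
      (Real.tsum_le_of_sum_le hnonneg hsum)

theorem ne_zero_of_norm_sub_one_le_half {w : ℂ} (h : ‖w - 1‖ ≤ 1 / 2) : w ≠ 0 := by
  rintro rfl
  norm_num at h

theorem norm_inv_sub_one_le {w : ℂ} {δ : ℝ} (h : ‖w - 1‖ ≤ δ) (hδ : δ ≤ 1 / 2) :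
    ‖w⁻¹ - 1‖ ≤ 2 * δ := by
  have hinv : ‖w⁻¹‖ ≤ 2 * (1 : ℝ)⁻¹ :=
    norm_inv_le_of_norm_sub_le one_pos (by rw [Complex.ofReal_one]; exact h.trans hδ)
  rw [inv_one, mul_one] at hinv
  have hw := ne_zero_of_norm_sub_one_le_half (h.trans hδ)
  calc ‖w⁻¹ - 1‖ = ‖w⁻¹‖ * ‖w - 1‖ := by
        rw [← norm_mul, mul_sub, inv_mul_cancel₀ hw, mul_one, norm_sub_rev]
    _ ≤ 2 * δ := by gcongr

theorem exists_dominated_taylorCoeffZero_inv_deriv {ρ r η : ℝ} (hρ : 0 < ρ) (hr : ρ < r)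
    (hη : 0 < η) : ∃ δ, 0 < δ ∧ δ ≤ 1 / 2 ∧ ∀ g : ℂ → ℂ, DifferentiableOn ℂ g (ball 0 r) →
      (∀ z ∈ ball (0 : ℂ) r, ‖deriv g z - 1‖ ≤ δ) →
        Dominated ρ η (taylorCoeffZero (fun z => (deriv g z)⁻¹) - Pi.single 0 1) := by
  obtain ⟨A, hA⟩ := exists_dominated_taylorCoeffZero hρ (left_lt_add_div_two.2 hr)
    (add_div_two_lt_right.2 hr)
  refine ⟨min (1 / 2) (η / (2 * (|A| + 1))), by positivity, min_le_left _ _, fun g hg hd => ?_⟩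
  set δ := min (1 / 2) (η / (2 * (|A| + 1)))
  have hδ : δ ≤ 1 / 2 := min_le_left _ _
  have hδA : 2 * δ * A ≤ η := by
    have hδη : δ * (2 * (|A| + 1)) ≤ η := (le_div_iff₀ (by positivity)).1 (min_le_right _ _)
    have hδ0 : 0 ≤ δ := by positivity
    nlinarith [le_abs_self A]
  have hinv : DifferentiableOn ℂ (fun z => (deriv g z)⁻¹) (ball 0 r) :=
    (hg.deriv isOpen_ball).fun_inv fun z hz =>
      ne_zero_of_norm_sub_one_le_half ((hd z hz).trans hδ)
  have hcoeff : taylorCoeffZero (fun z => (deriv g z)⁻¹ - 1) =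
      taylorCoeffZero (fun z => (deriv g z)⁻¹) - Pi.single 0 1 :=
    taylorCoeffZero_eq_of_hasSum (hρ.trans hr) fun z hz => by
      simpa only [Pi.sub_apply, sub_mul]
        using (hasSum_taylorCoeffZero hinv hz).sub (hasSum_single_zero_mul_pow 1 z)
  rw [← hcoeff]
  refine (hA _ (2 * δ) (hinv.fun_sub (differentiableOn_const 1)) fun z hz => ?_).mono hρ hδA
  exact norm_inv_sub_one_le
    (hd z (closedBall_subset_ball (add_div_two_lt_right.2 hr) hz)) hδ

theorem ball_subset_image_of_norm_deriv_sub_one_le {g : ℂ → ℂ}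
    (hg : DifferentiableOn ℂ g (ball 0 1)) (hg0 : g 0 = 0)
    (hd : ∀ z ∈ ball (0 : ℂ) 1, ‖deriv g z - 1‖ ≤ 1 / 2) :
    ball (0 : ℂ) (1 / 8) ⊆ g '' ball 0 1 := by
  have hsub : closedBall (0 : ℂ) (1 / 2) ⊆ ball 0 1 := closedBall_subset_ball (by norm_num)
  have hderiv : ∀ z ∈ ball (0 : ℂ) 1, HasDerivAt g (deriv g z) z := fun z hz =>
    (hg.differentiableAt (isOpen_ball.mem_nhds hz)).hasDerivAt
  have hlow : ∀ z ∈ sphere (0 : ℂ) (1 / 2), 1 / 4 ≤ ‖g z - g 0‖ := fun z hz => by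
    have hclose := (convex_ball (0 : ℂ) 1).norm_image_sub_le_of_norm_hasDerivWithin_le
      (f := fun z => g z - z)
      (fun x hx => ((hderiv x hx).fun_sub (hasDerivAt_id' x)).hasDerivWithinAt)
      hd (mem_ball_self one_pos) (hsub (sphere_subset_closedBall hz))
    rw [hg0, sub_zero, sub_zero, sub_zero, mem_sphere_zero_iff_norm.1 hz] at hclose
    have htriangle := norm_sub_norm_le z (g z)
    rw [norm_sub_rev, mem_sphere_zero_iff_norm.1 hz] at htriangle
    rw [hg0, sub_zero]
    linarith
  have hne : deriv g 0 ≠ 0 := ne_zero_of_norm_sub_one_le_half (hd 0 (mem_ball_self one_pos))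
  have hfreq : ∃ᶠ z in 𝓝 (0 : ℂ), g z ≠ g 0 :=
    ((hderiv 0 (mem_ball_self one_pos)).eventually_ne hne).frequently.filter_mono
      nhdsWithin_le_nhds
  have hcont : DiffContOnCl ℂ g (ball 0 (1 / 2)) :=
    (hg.mono (by rw [closure_ball _ (by norm_num)]; exact hsub)).diffContOnCl
  have himage := hcont.ball_subset_image_closedBall (by norm_num) hlow hfreq
  rw [hg0] at himage
  exact (ball_subset_ball (by norm_num)).trans (himage.trans (image_mono hsub))

namespace IsDrivenBy

variable {T : ℝ} {h : ℝ → ℕ → ℂ} {g : ℂ → ℂ}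

theorem isStrongSuctionSolution_and_norm_suctionFlow_le (hh : IsDrivenBy T h h)
    (hT : T < 1 / 2)
    (hnear : ∀ t ∈ Icc 0 T, Dominated 2 (1 / 8) (h t - Pi.single 0 (diskInv t : ℂ)))
    (him : (h 0 0).im = 0) (hg : ∀ z ∈ ball (0 : ℂ) 2, HasDerivAt g (powerSum (h 0) z)⁻¹ z)
    (hg0 : g 0 = 0) :
    IsStrongSuctionSolution T (suctionFlow g h) ∧
      ∀ t ∈ Icc 0 T, ∀ z ∈ closedBall (0 : ℂ) 1,
        ‖suctionFlow g h t z‖ ≤ 2 * Real.sqrt (1 - 2 * t) := by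
  have hone (t) (ht : t ∈ Icc 0 T) : 1 ≤ diskInv t := one_le_diskInv ht.1 (ht.2.trans_lt hT)
  have hdom (t) (ht : t ∈ Icc 0 T) : Dominated 2 (1 / 8 + diskInv T) (h t) := by
    have hnorm : ‖(diskInv t : ℂ)‖ ≤ diskInv T := by
      rw [Complex.norm_real, Real.norm_of_nonneg (zero_le_one.trans (hone t ht))]
      exact diskInv_mono ht.2 hT
    have hsum := (hnear t ht).add ((dominated_single two_pos _).mono two_pos hnorm)
    rwa [sub_add_cancel] at hsum
  have hclose (t) (ht : t ∈ Icc 0 T) (z) (hz : z ∈ closedBall (0 : ℂ) 2) :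
      ‖powerSum (h t) z - diskInv t‖ ≤ diskInv t / 2 := by
    have := (hnear t ht).norm_powerSum_sub_le two_pos (mem_closedBall_zero_iff.1 hz)
    linarith [hone t ht]
  have hpos (t) (ht : t ∈ Icc 0 T) (z) (hz : z ∈ closedBall (0 : ℂ) 2) :
      0 < (powerSum (h t) z).re :=
    re_pos_of_norm_sub_ofReal_lt ((hclose t ht z hz).trans_lt (by linarith [hone t ht]))
  have hne (t) (ht : t ∈ Icc 0 T) (z) (hz : z ∈ closedBall (0 : ℂ) 2) : powerSum (h t) z ≠ 0 :=
    fun h0 => by simpa only [h0, Complex.zero_re, lt_irrefl] using hpos t ht z hz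
  refine ⟨hh.isStrongSuctionSolution_suctionFlow one_lt_two hdom hpos him hg hg0,
    fun t ht z hz => ?_⟩
  have hsub : closedBall (0 : ℂ) 1 ⊆ ball 0 2 := closedBall_subset_ball one_lt_two
  have hlip := (convex_closedBall (0 : ℂ) 1).norm_image_sub_le_of_norm_hasDerivWithin_le
    (fun w hw => (hh.hasDerivAt_suctionFlow one_le_two hdom hne hg ht (hsub hw)).hasDerivWithinAt)
    (fun w hw => norm_inv_le_of_norm_sub_le (zero_lt_one.trans_le (hone t ht))
      (hclose t ht w (ball_subset_closedBall (hsub hw))))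
    (mem_closedBall_self zero_le_one) hz
  rw [suctionFlow_apply_zero, hg0, sub_zero, sub_zero, diskInv, inv_inv] at hlip
  exact hlip.trans (mul_le_of_le_one_right (by positivity) (mem_closedBall_zero_iff.1 hz))

end IsDrivenBy

theorem exists_isStrongSuctionSolution_of_norm_deriv_sub_one_le {T : ℝ} (hT0 : 0 ≤ T)
    (hT : T < 1 / 2) :
    ∃ ρ δ : ℝ, 1 < ρ ∧ 0 < δ ∧ δ ≤ 1 / 2 ∧ ∀ g : ℂ → ℂ, DifferentiableOn ℂ g (ball 0 ρ) →
      g 0 = 0 → (deriv g 0).im = 0 → (∀ z ∈ ball (0 : ℂ) ρ, ‖deriv g z - 1‖ ≤ δ) →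
        ∃ f, IsStrongSuctionSolution T f ∧ f 0 = g ∧
          ∀ t ∈ Icc 0 T, ∀ z ∈ closedBall (0 : ℂ) 1, ‖f t z‖ ≤ 2 * Real.sqrt (1 - 2 * t) := by
  obtain ⟨ρ, hρ, η, hη, hdriven⟩ := exists_isDrivenBy_near_diskInv hT0 hT
  obtain ⟨δ, hδ0, hδ, hdom⟩ := exists_dominated_taylorCoeffZero_inv_deriv
    (ρ := ρ) (r := 2 * ρ) (by linarith) (by linarith) hη
  refine ⟨2 * ρ, δ, by linarith, hδ0, hδ, fun g hg hg0 him hd => ?_⟩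
  obtain ⟨h, h0, hh, hnear⟩ := hdriven _ (hdom g hg hd)
  have hsub : ball (0 : ℂ) 2 ⊆ ball 0 (2 * ρ) := ball_subset_ball (by linarith)
  have hinv : DifferentiableOn ℂ (fun z => (deriv g z)⁻¹) (ball 0 (2 * ρ)) :=
    (hg.deriv isOpen_ball).fun_inv fun z hz =>
      ne_zero_of_norm_sub_one_le_half ((hd z hz).trans hδ)
  have hgder : ∀ z ∈ ball (0 : ℂ) 2, HasDerivAt g (powerSum (h 0) z)⁻¹ z := fun z hz => by
    rw [h0, powerSum, (hasSum_taylorCoeffZero hinv (hsub hz)).tsum_eq, inv_inv]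
    exact (hg.differentiableAt (isOpen_ball.mem_nhds (hsub hz))).hasDerivAt
  have him0 : (h 0 0).im = 0 := by
    rw [h0, taylorCoeffZero_zero, Complex.inv_im, him, neg_zero, zero_div]
  obtain ⟨hstrong, hnorm⟩ :=
    hh.isStrongSuctionSolution_and_norm_suctionFlow_le hT hnear him0 hgder hg0
  exact ⟨suctionFlow g h, hstrong, suctionFlow_zero g h, hnorm⟩

theorem exists_isStrongSuctionSolution_of_isCloseToDisk {T : ℝ} (hT0 : 0 ≤ T) (hT : T < 1 / 2) :
    ∃ ρ δ : ℝ, 1 < ρ ∧ 0 < δ ∧ ∀ f₀ : ℂ → ℂ, IsCloseToDisk ρ δ f₀ →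
      ball (0 : ℂ) (1 / 8) ⊆ f₀ '' ball 0 1 ∧
      ∃ f, IsStrongSuctionSolution T f ∧ EqOn (f 0) f₀ (ball 0 1) ∧
        ∀ t ∈ Icc 0 T, ∀ z ∈ closedBall (0 : ℂ) 1, ‖f t z‖ ≤ 2 * Real.sqrt (1 - 2 * t) := by
  obtain ⟨ρ, δ, hρ, hδ0, hδ, hexists⟩ :=
    exists_isStrongSuctionSolution_of_norm_deriv_sub_one_le hT0 hT
  refine ⟨ρ, δ, hρ, hδ0, fun f₀ h => ?_⟩
  obtain ⟨g, hg, hgf, hgd⟩ := h.exists_extension hρ.le hδ0.le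
  have hg0 : g 0 = 0 := by rw [hgf (mem_ball_self one_pos), h.map_zero]
  have him : (deriv g 0).im = 0 := by
    rw [(hgf.eventuallyEq_of_mem (ball_mem_nhds 0 one_pos)).deriv_eq, h.deriv_zero_pos.2]
  have hsub : ball (0 : ℂ) 1 ⊆ ball 0 ρ := ball_subset_ball hρ.le
  obtain ⟨f, hf, hf0, hnorm⟩ := hexists g hg hg0 him hgd
  refine ⟨hgf.image_eq ▸ ball_subset_image_of_norm_deriv_sub_one_le (hg.mono hsub) hg0
    fun z hz => (hgd z (hsub hz)).trans hδ, f, hf, hf0 ▸ hgf, hnorm⟩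

theorem exists_lt_blowup_time_of_isCloseToDisk {T₀ : ℝ} (hT₀ : T₀ < 1 / 2) :
    ∃ ρ δ : ℝ, 1 < ρ ∧ 0 < δ ∧ ∀ f₀ : ℂ → ℂ, IsCloseToDisk ρ δ f₀ →
      ∃ (b : ℝ) (f : ℝ → ℂ → ℂ), IsMaximalStrongSuctionSolution f₀ b f ∧ T₀ < b := by
  obtain ⟨T, hT₀T, hT⟩ := exists_between (max_lt hT₀ one_half_pos)
  have hT0 : 0 < T := (le_max_right _ _).trans_lt hT₀T
  obtain ⟨ρ, δ, hρ, hδ, hexists⟩ := exists_isStrongSuctionSolution_of_isCloseToDisk hT0.le hT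
  refine ⟨ρ, δ, hρ, hδ, fun f₀ hf₀ => ?_⟩
  obtain ⟨-, g, hg, hgi, -⟩ := hexists f₀ hf₀
  obtain ⟨b, f, hb, hf⟩ := hg.exists_isMaximalStrongSuctionSolution hT0 hgi
  exact ⟨b, f, hf, ((le_max_left _ _).trans_lt hT₀T).trans_le hb⟩

theorem volume_image_le_of_forall_norm_le {f : ℂ → ℂ} {s : Set ℂ} {r : ℝ} (hr : 0 ≤ r)
    (h : ∀ z ∈ s, ‖f z‖ ≤ r) : volume (f '' s) ≤ ENNReal.ofReal (r ^ 2 * Real.pi) := by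
  have hsub : f '' s ⊆ closedBall 0 r := image_subset_iff.2 fun z hz =>
    mem_closedBall_zero_iff.2 (h z hz)
  refine (measure_mono hsub).trans_eq ?_
  rw [← volume_ball_eq_ofReal hr 0, Complex.volume_closedBall, Complex.volume_ball]

theorem exists_volume_image_le_of_isCloseToDisk {ε : ℝ} (hε : 0 < ε) :
    ∃ ρ δ : ℝ, 1 < ρ ∧ 0 < δ ∧ ∀ f₀ : ℂ → ℂ, IsCloseToDisk ρ δ f₀ →
      ∃ (b : ℝ) (f : ℝ → ℂ → ℂ), IsMaximalStrongSuctionSolution f₀ b f ∧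
        ∃ T ∈ Ioo 0 b, volume (f T '' ball (0 : ℂ) 1) ≤
          ENNReal.ofReal ε * volume (f 0 '' ball (0 : ℂ) 1) := by
  obtain ⟨x, hx0, hx⟩ := exists_between (show 0 < min (ε / 256) (1 / 2) by positivity)
  obtain ⟨hxε, hx1⟩ := lt_min_iff.1 hx
  obtain ⟨ρ, δ, hρ, hδ, hexists⟩ := exists_isStrongSuctionSolution_of_isCloseToDisk
    (T := (1 - x / 2) / 2) (by linarith) (by linarith)
  refine ⟨ρ, δ, hρ, hδ, fun f₀ hf₀ => ?_⟩
  obtain ⟨hball, g, hg, hgi, hnorm⟩ := hexists f₀ hf₀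
  obtain ⟨b, f, hb, hf⟩ := hg.exists_isMaximalStrongSuctionSolution (by linarith) hgi
  refine ⟨b, f, hf, (1 - x) / 2, ⟨by linarith, by linarith⟩, ?_⟩
  have hgf := (hf.maximal _ g hg hgi).2 ((1 - x) / 2) ⟨by linarith, by linarith⟩
  have hsmall (z) (hz : z ∈ ball (0 : ℂ) 1) : ‖f ((1 - x) / 2) z‖ ≤ 2 * Real.sqrt x := by
    have hz' := ball_subset_closedBall hz
    have := hnorm ((1 - x) / 2) ⟨by linarith, by linarith⟩ z hz'
    rwa [hgf hz', show 1 - 2 * ((1 - x) / 2) = x by ring] at this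
  calc volume (f ((1 - x) / 2) '' ball (0 : ℂ) 1)
      ≤ ENNReal.ofReal ((2 * Real.sqrt x) ^ 2 * Real.pi) :=
        volume_image_le_of_forall_norm_le (by positivity) hsmall
    _ ≤ ENNReal.ofReal (ε * ((1 / 8) ^ 2 * Real.pi)) := by
        refine ENNReal.ofReal_le_ofReal ?_
        rw [mul_pow, Real.sq_sqrt hx0.le, ← mul_assoc]
        exact mul_le_mul_of_nonneg_right (by linarith) Real.pi_pos.le
    _ = ENNReal.ofReal ε * volume (ball (0 : ℂ) (1 / 8)) := by
        rw [ENNReal.ofReal_mul hε.le, volume_ball_eq_ofReal (by norm_num)]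
    _ ≤ ENNReal.ofReal ε * volume (f₀ '' ball (0 : ℂ) 1) := by gcongr
    _ = ENNReal.ofReal ε * volume (f 0 '' ball (0 : ℂ) 1) := by rw [hf.initial.image_eq]

theorem mainTheorem5 :
    (IsMaximalStrongSuctionSolution (fun ξ => ξ) (1 / 2) diskSolution ∧
      ∀ t ∈ Icc (0 : ℝ) (1 / 2),
        volume (diskSolution t '' ball (0 : ℂ) 1) = ENNReal.ofReal (Real.pi * (1 - 2 * t))) ∧
    (∀ T₀ : ℝ, T₀ < 1 / 2 → ∃ ρ δ : ℝ, 1 < ρ ∧ 0 < δ ∧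
      ∀ f₀ : ℂ → ℂ, IsCloseToDisk ρ δ f₀ →
        ∃ (b : ℝ) (f : ℝ → ℂ → ℂ), IsMaximalStrongSuctionSolution f₀ b f ∧ T₀ < b) ∧
    (∀ ε : ℝ, 0 < ε → ∃ ρ δ : ℝ, 1 < ρ ∧ 0 < δ ∧
      ∀ f₀ : ℂ → ℂ, IsCloseToDisk ρ δ f₀ →
        ∃ (b : ℝ) (f : ℝ → ℂ → ℂ), IsMaximalStrongSuctionSolution f₀ b f ∧
          ∃ T ∈ Ioo 0 b, volume (f T '' ball (0 : ℂ) 1) ≤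
            ENNReal.ofReal ε * volume (f 0 '' ball (0 : ℂ) 1)) :=
  ⟨⟨isMaximalStrongSuctionSolution_diskSolution, fun _ ht => volume_diskSolution_image ht.2⟩,
    fun _ hT₀ => exists_lt_blowup_time_of_isCloseToDisk hT₀,
    fun _ hε => exists_volume_image_le_of_isCloseToDisk hε⟩
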